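/- Let $\mathcal B$ be the ring of functions of $\bm m=(m_1,m_2)\in\mathbb Z^2$ with values in the formal power series over $\mathbb C$ in the variables $t_k^{(a)}$ ($a=1,2$, $k\ge1$). Let $\Lambda_a$ be the shift $\Lambda_a f(\bm m)=f(\bm m+\bm e_a)$, $\bm e_1=(1,0)$, $\bm e_2=(0,1)$, $\bm e=(1,1)$, and put $\Delta_a=\Lambda_a-1$, $\Delta_a^*=\Lambda_a^{-1}-1$, $\Delta_1^{-1}=\sum_{j\ge1}\Lambda_1^{-j}$, $\Delta_2^{*-1}=\sum_{j\ge1}\Lambda_2^{j}$. For an operator $A=\sum a_{j_1,j_2}(\bm m)\Lambda_1^{j_1}\Lambda_2^{j_2}$ let $A_{1,\ge0}$ be its part with $j_1\ge0$ and $A_{a,[0]}$ its part with $j_a=0$; for $A=\sum_j b_j\Delta_2^{*j}\in\mathcal B((\Lambda_2))$ let $A_{\Delta_2^*,\ge1}=\sum_{j\ge1}b_j\Delta_2^{*j}$. $A(\bm m+\bm e)$ denotes $A$ with all coefficients shifted by $\bm e$, and $\partial_{t_k^{(a)}}$ acts on coefficients. Let $$L_1=\Lambda_1+\sum_{i\ge0}u^{(1)}_i\Lambda_1^{-i},\qquad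 L_2=u^{(2)}_{-1}\Lambda_2^{-1}+\sum_{i\ge0}u^{(2)}_i\Lambda_2^{i},\qquad H=\Lambda_1\Delta_2+\rho$$ with coefficients in $\mathcal B$, where $u^{(2)}_{-1}$ and $\rho$ are invertible in $\mathcal B$. Put $\mathcal E_{(1)}=\mathcal B[\Lambda_2,\Lambda_2^{-1}]((\Lambda_1^{-1}))$, $\mathcal E^0_{(1)}=\mathcal B((\Lambda_1^{-1}))$, $\mathcal E_{(2)}=\mathcal B[\Lambda_1,\Lambda_1^{-1}]((\Lambda_2))$, $\mathcal E^0_{(2)}=\mathcal B((\Lambda_2))$, and let $\pi_a:\mathcal E_{(a)}=\mathcal E^0_{(a)}\oplus\mathcal E_{(a)}H\to\mathcal E^0_{(a)}$ be the projection. For $k\ge1$ put $B_k^{(1)}=(L_1^k)_{1,\ge0}$, $B_k^{(2)}=(L_2^k)_{\Delta_2^*,\ge1}$, $C_k^{(1)}(\bm m)=B_k^{(1)}(\bm m+\bm e)$, $C_k^{(2)}(\bm m)=\Delta_2^*B_k^{(2)}(\bm m+\bm e)\Delta_2^{*-1}$. Suppose that for all $a,b\in\{1,2\}$ and $k\ge1$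 $$\partial_{t_k^{(a)}}L_b=[\pi_b(B_k^{(a)}),L_b],\qquad \partial_{t_k^{(a)}}H=C_k^{(a)}H-HB_k^{(a)},$$ $$H(\bm m)L_1(\bm m)=L_1(\bm m+\bm e)H(\bm m),\qquad H(\bm m)L_2(\bm m)=\Delta_2^*L_2(\bm m+\bm e)\Delta_2^{*-1}H(\bm m).$$ Then there exist operators $S_1=1+\sum_{k\ge1}a^{(1)}_k\Lambda_1^{-k}$ and $S_2=a^{(2)}_0+\sum_{k\ge1}a^{(2)}_k\Lambda_2^{k}$ with coefficients in $\mathcal B$ and $a^{(2)}_0$ invertible in $\mathcal B$ (so that $S_1^{-1}\in\mathcal B((\Lambda_1^{-1}))$ and $S_2^{-1}\in\mathcal B((\Lambda_2))$ exist) such that $$L_1=S_1\Lambda_1S_1^{-1},\qquad L_2=S_2\Lambda_2^{-1}S_2^{-1},\qquad H=-\Lambda_1\Lambda_2S_1\Delta_2^*S_1^{-1}=-\Lambda_1\Delta_2S_2\Delta_1^*S_2^{-1},$$ and for all $k\ge1$ $$\partial_{t_k^{(1)}}S_1=B_k^{(1)}S_1-S_1\Lambda_1^k,\qquad \partial_{t_k^{(1)}}S_2=\bigl(B_k^{(1)}S_1\Delta_2^{*-1}S_1^{-1}\bigr)_{1,[0]}\Delta_2^*S_2,$$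 $$\partial_{t_k^{(2)}}S_1=\bigl(B_k^{(2)}S_2\Delta_1^{-1}S_2^{-1}\Delta_2^{*-1}\bigr)_{2,[0]}S_1,\qquad \partial_{t_k^{(2)}}S_2=B_k^{(2)}S_2-S_2\Lambda_2^{-k}.$$ -/

import Mathlib

noncomputable section

namespace TwoDKP

/-- The time variables: `(0, k)` is `t_k^{(1)}` and `(1, k)` is `t_k^{(2)}`, for `k ≥ 1`. -/
abbrev Time : Type := Fin 2 × ℕ+

/-- The ring `𝓑` of coefficient functions of `m ∈ ℤ²` and of `t = (t^{(1)}, t^{(2)})`: for each `m`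
a formal power series in all the time variables, with pointwise operations. -/
abbrev Coef : Type := ℤ × ℤ → MvPowerSeries Time ℂ

/-- The shift `(Λ₁^{j₁} Λ₂^{j₂} f)(m) = f (m + j)` on coefficient functions. -/
def shift (j : ℤ × ℤ) (f : Coef) : Coef := fun m => f (m + j)

/-- Formal difference operators `∑_{j ∈ ℤ²} a_j(m) Λ₁^{j₁} Λ₂^{j₂}`, given by the family of their
(left) coefficients `a_j ∈ 𝓑`. -/
def Op : Type := ℤ × ℤ → Coef

instance : AddCommGroup Op := inferInstanceAs (AddCommGroup (ℤ × ℤ → Coef))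

/-- Composition of operators, determined by `Λ^i · b = (Λ^i b) · Λ^i`.  The coefficient sum is
the usual one whenever it is finite; this is so for all the products formed below. -/
instance : Mul Op := ⟨fun A B n => ∑ᶠ i : ℤ × ℤ, A i * shift i (B (n - i))⟩

/-- The operator of multiplication by a function. -/
def mulOp (f : Coef) : Op := fun n => if n = 0 then f else 0

instance : One Op := ⟨mulOp 1⟩

instance : Pow Op ℕ := ⟨fun A k => npowRec k A⟩

/-- `Λ₁^{j₁} Λ₂^{j₂}`. -/
def Lam (j : ℤ × ℤ) : Op := fun n => if n = j then 1 else 0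

/-- `A(m + j)`: all coefficients of the operator are evaluated at `m + j`. -/
def translate (j : ℤ × ℤ) (A : Op) : Op := fun n => shift j (A n)

/-- `∂A/∂t_k^{(1)}`, coefficient by coefficient. -/
def dt1 (k : ℕ+) (A : Op) : Op := fun n m => MvPowerSeries.pderiv ℂ ((0, k) : Time) (A n m)

/-- `∂A/∂t_k^{(2)}`, coefficient by coefficient. -/
def dt2 (k : ℕ+) (A : Op) : Op := fun n m => MvPowerSeries.pderiv ℂ ((1, k) : Time) (A n m)

/-- The commutator `[A, B]`. -/
def comm (A B : Op) : Op := A * B - B * A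

/-- `Δ₂ = Λ₂ - 1`. -/
def Delta2 : Op := Lam (0, 1) - 1

/-- `Δ₁^* = Λ₁⁻¹ - 1`. -/
def Delta1Star : Op := Lam (-1, 0) - 1

/-- `Δ₂^* = Λ₂⁻¹ - 1`. -/
def Delta2Star : Op := Lam (0, -1) - 1

/-- `Δ₁⁻¹ = ∑_{j ≥ 1} Λ₁^{-j}`. -/
def Delta1Inv : Op := fun n => if n.2 = 0 ∧ n.1 ≤ -1 then 1 else 0

/-- `Δ₂^{*-1} = ∑_{j ≥ 1} Λ₂^j`. -/
def Delta2StarInv : Op := fun n => if n.1 = 0 ∧ 1 ≤ n.2 then 1 else 0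

/-- `A_{1,≥0}`: the part with nonnegative powers of `Λ₁`. -/
def nonneg1 (A : Op) : Op := fun n => if 0 ≤ n.1 then A n else 0

/-- `A_{1,[0]}`: the part with `Λ₁^0`. -/
def zeroPart1 (A : Op) : Op := fun n => if n.1 = 0 then A n else 0

/-- `A_{2,[0]}`: the part with `Λ₂^0`. -/
def zeroPart2 (A : Op) : Op := fun n => if n.2 = 0 then A n else 0

/-- For `A = ∑_i a_i Λ₂^i` with `i` bounded below, and `p ≥ 1`, the coefficient of `Δ₂^{*p}` in the
re-expansion `A = ∑_p b_p Δ₂^{*p}`.  Since `Λ₂^{-i} = (Δ₂^* + 1)^i = ∑_p (i choose p) Δ₂^{*p}` for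
`i ≥ 0`, while `Λ₂^i = (Δ₂^* + 1)^{-i}` has only negative powers of `Δ₂^*` for `i ≥ 1`, it is
`b_p = ∑_{i ≥ p} (i choose p) a_{-i}`. -/
def dstarCoeff (A : Op) (p : ℕ) : Coef := ∑ᶠ i : ℕ, (i.choose p : Coef) * A (0, -(i : ℤ))

/-- `A_{Δ₂^*, ≥1} = ∑_{p ≥ 1} b_p Δ₂^{*p}` for `A = ∑_p b_p Δ₂^{*p}` in `𝓑((Λ₂))`. -/
def dstarPos (A : Op) : Op :=
  fun n => ∑ᶠ p : ℕ, dstarCoeff A (p + 1) * (Delta2Star ^ (p + 1)) n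

/-- `H = Λ₁ Δ₂ + ρ`. -/
def opH (ρ : Coef) : Op := Lam (1, 0) * Delta2 + mulOp ρ

/-- `𝓔₁⁰ = 𝓑((Λ₁⁻¹))`. -/
def InE1Zero (A : Op) : Prop :=
  (∀ n, A n ≠ 0 → n.2 = 0) ∧ ∃ M : ℤ, ∀ n, A n ≠ 0 → n.1 ≤ M

/-- `𝓔₁ = 𝓑[Λ₂, Λ₂⁻¹]((Λ₁⁻¹))`. -/
def InE1 (A : Op) : Prop :=
  (∀ i : ℤ, {j : ℤ | A (i, j) ≠ 0}.Finite) ∧ ∃ M : ℤ, ∀ n, A n ≠ 0 → n.1 ≤ M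

/-- `𝓔₂⁰ = 𝓑((Λ₂))`. -/
def InE2Zero (A : Op) : Prop :=
  (∀ n, A n ≠ 0 → n.1 = 0) ∧ ∃ M : ℤ, ∀ n, A n ≠ 0 → M ≤ n.2

/-- `𝓔₂ = 𝓑[Λ₁, Λ₁⁻¹]((Λ₂))`. -/
def InE2 (A : Op) : Prop :=
  (∀ j : ℤ, {i : ℤ | A (i, j) ≠ 0}.Finite) ∧ ∃ M : ℤ, ∀ n, A n ≠ 0 → M ≤ n.2

open Classical in
/-- The projection `π₁ : 𝓔₁ = 𝓔₁⁰ ⊕ 𝓔₁ H → 𝓔₁⁰`. -/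
def proj1 (ρ : Coef) (A : Op) : Op :=
  if h : ∃ A₀, InE1Zero A₀ ∧ ∃ P, InE1 P ∧ A = A₀ + P * opH ρ then h.choose else 0

open Classical in
/-- The projection `π₂ : 𝓔₂ = 𝓔₂⁰ ⊕ 𝓔₂ H → 𝓔₂⁰`. -/
def proj2 (ρ : Coef) (A : Op) : Op :=
  if h : ∃ A₀, InE2Zero A₀ ∧ ∃ P, InE2 P ∧ A = A₀ + P * opH ρ then h.choose else 0

/-- `L₁ = Λ₁ + ∑_{i ≥ 0} u_i^{(1)} Λ₁^{-i}`. -/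
def IsLax1 (L : Op) : Prop :=
  (∀ n, L n ≠ 0 → n.2 = 0 ∧ n.1 ≤ 1) ∧ L (1, 0) = 1

/-- `L₂ = u_{-1}^{(2)} Λ₂⁻¹ + ∑_{i ≥ 0} u_i^{(2)} Λ₂^i` with invertible leading coefficient. -/
def IsLax2 (L : Op) : Prop :=
  (∀ n, L n ≠ 0 → n.1 = 0 ∧ -1 ≤ n.2) ∧ IsUnit (L (0, -1))

/-- `B_k^{(1)} = (L₁^k)_{1,≥0}`. -/
def opB1 (L₁ : Op) (k : ℕ+) : Op := nonneg1 (L₁ ^ (k : ℕ))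

/-- `B_k^{(2)} = (L₂^k)_{Δ₂^*,≥1}`. -/
def opB2 (L₂ : Op) (k : ℕ+) : Op := dstarPos (L₂ ^ (k : ℕ))

/-- `C_k^{(1)}(m) = B_k^{(1)}(m + e)`, with `e = (1, 1)`. -/
def opC1 (L₁ : Op) (k : ℕ+) : Op := translate (1, 1) (opB1 L₁ k)

/-- `C_k^{(2)}(m) = Δ₂^* · B_k^{(2)}(m + e) · Δ₂^{*-1}`. -/
def opC2 (L₂ : Op) (k : ℕ+) : Op :=
  Delta2Star * translate (1, 1) (opB2 L₂ k) * Delta2StarInv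

/-- The Lax equations of the two-component discrete KP hierarchy for `L₁`, `L₂` and
`H = Λ₁ Δ₂ + ρ`. -/
structure LaxSystem (L₁ L₂ : Op) (ρ : Coef) : Prop where
  flow11 : ∀ k, dt1 k L₁ = comm (proj1 ρ (opB1 L₁ k)) L₁
  flow12 : ∀ k, dt1 k L₂ = comm (proj2 ρ (opB1 L₁ k)) L₂
  flow21 : ∀ k, dt2 k L₁ = comm (proj1 ρ (opB2 L₂ k)) L₁
  flow22 : ∀ k, dt2 k L₂ = comm (proj2 ρ (opB2 L₂ k)) L₂
  intertwine1 : opH ρ * L₁ = translate (1, 1) L₁ * opH ρ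
  intertwine2 : opH ρ * L₂ = Delta2Star * translate (1, 1) L₂ * Delta2StarInv * opH ρ
  flowH1 : ∀ k, dt1 k (opH ρ) = opC1 L₁ k * opH ρ - opH ρ * opB1 L₁ k
  flowH2 : ∀ k, dt2 k (opH ρ) = opC2 L₂ k * opH ρ - opH ρ * opB2 L₂ k

/-- `S₁ = 1 + ∑_{k ≥ 1} a_k^{(1)} Λ₁^{-k}`. -/
def IsWave1 (S : Op) : Prop :=
  (∀ n, S n ≠ 0 → n.2 = 0 ∧ n.1 ≤ 0) ∧ S 0 = 1

/-- `S₂ = a_0^{(2)} + ∑_{k ≥ 1} a_k^{(2)} Λ₂^k` with `a_0^{(2)}` invertible. -/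
def IsWave2 (S : Op) : Prop :=
  (∀ n, S n ≠ 0 → n.1 = 0 ∧ 0 ≤ n.2) ∧ IsUnit (S 0)

end TwoDKP

end

noncomputable section

namespace TwoDKP

/-! All operators involved have exponents bounded above in `Λ₁` and below in `Λ₂`. Such operators
form a ring, `BOp`, in which every product is a finite sum, so the algebra is done there. With `X1`
a series in `Λ₁⁻¹` and `X2` a series in `Λ₂`, one has `H = -Λ₁ (X1 - Λ₂) = (1 - Λ₂) (X2 - Λ₁)`. The
required formulas for `H` then become `X1 S₁ = S₁(m + e₂)` and `X2 S₂ = S₂(m + e₁)`, and the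
intertwining relations become `X L = L(m + w) X` with `w = e₂`, respectively `w = e₁`. A `Frame`
treats both cases at once: series in `Λ^v`, translated by `w`.

Dressing (`Frame.exists_dressing`): solving difference equations along `v` gives `S₀` with `L S₀ =
S₀ Λ^{-v}`. The defect `S₀(m + w)⁻¹ X S₀` is then invariant under `v`, and a `v`-invariant factor
`T`, found by solving along `w`, removes it without spoiling the first equation.

Times (`Frame.Flow.exists_wave`): let `Q_r` be the projection of `B_r`, let `K_r` be the vacuum
operator (a power of `Λ^v` or zero), and let `N_r = S⁻¹ (Q_r S - ∂_r S) - K_r`. Differentiating the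
two equations for `S` shows that `N_r` commutes with `Λ^v` and is invariant under `w`. Hence its
coefficients do not depend on `m`, and all the `N_r` commute. If the `Q_r` satisfy the
zero-curvature equations, then `∂_s N_r = ∂_r N_s`, so `∂_r U = N_r U` is solvable in formal power
series (`exists_linear_flow`), and `S U` is the wave operator.

Zero curvature is not assumed and is the main point (`BOp.both_projections_eq_zero`). Modulo the
left ideal of `H`, the curvature of the `B_r` agrees with the curvature of both families of
projections. The dressing confines these to `Λ₁^{≤ -1}` and `Λ₂^{≥ 0}`, while the curvature of the
`B_r` lives in `Λ₁^{≥ 0} Λ₂^{≤ 0}`. These supports are compatible only if both projected curvatures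
vanish.

The mixed flow equations come from writing the projections explicitly through `H⁻¹` (`exists_proj1`,
`exists_proj2`), together with `S₁ Δ₂^{*-1} S₁⁻¹ = -H⁻¹ Λ₁ Λ₂` and `S₂ Δ₁⁻¹ S₂⁻¹ = -H⁻¹ ρ`. -/

/-! ### Shifts of coefficients and composition of operators. -/

@[simp] theorem shift_apply (j m : ℤ × ℤ) (f : Coef) : shift j f m = f (m + j) := rfl

@[simp] theorem shift_zero_coef (j : ℤ × ℤ) : shift j (0 : Coef) = 0 := rfl

@[simp] theorem shift_one_coef (j : ℤ × ℤ) : shift j (1 : Coef) = 1 := rfl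

@[simp] theorem shift_add (j : ℤ × ℤ) (f g : Coef) : shift j (f + g) = shift j f + shift j g := rfl

@[simp] theorem shift_neg (j : ℤ × ℤ) (f : Coef) : shift j (-f) = -shift j f := rfl

@[simp] theorem shift_mul (j : ℤ × ℤ) (f g : Coef) : shift j (f * g) = shift j f * shift j g := rfl

@[simp] theorem shift_shift (i j : ℤ × ℤ) (f : Coef) : shift i (shift j f) = shift (i + j) f := by
  funext m
  simp [add_assoc]

@[simp] theorem zero_shift (f : Coef) : shift 0 f = f := by
  funext m
  simp

theorem shift_sum {ι : Type*} (j : ℤ × ℤ) (s : Finset ι) (f : ι → Coef) :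
    shift j (∑ i ∈ s, f i) = ∑ i ∈ s, shift j (f i) := by
  funext m
  simp [Finset.sum_apply]

theorem shift_eq_zero_iff (j : ℤ × ℤ) (f : Coef) : shift j f = 0 ↔ f = 0 := by
  refine ⟨fun h => ?_, fun h => by rw [h, shift_zero_coef]⟩
  have := congrArg (shift (-j)) h
  simpa using this

theorem isUnit_shift {f : Coef} (j : ℤ × ℤ) (hf : IsUnit f) : IsUnit (shift j f) := by
  obtain ⟨u, rfl⟩ := hf
  exact ⟨⟨shift j u.1, shift j u.2, by rw [← shift_mul, u.val_inv, shift_one_coef],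
    by rw [← shift_mul, u.inv_val, shift_one_coef]⟩, rfl⟩

namespace Op

@[simp] theorem zero_apply (n : ℤ × ℤ) : (0 : Op) n = 0 := rfl

@[simp] theorem add_apply (A B : Op) (n : ℤ × ℤ) : (A + B) n = A n + B n := rfl

@[simp] theorem sub_apply (A B : Op) (n : ℤ × ℤ) : (A - B) n = A n - B n := rfl

@[simp] theorem neg_apply (A : Op) (n : ℤ × ℤ) : (-A) n = -A n := rfl

theorem one_apply (n : ℤ × ℤ) : (1 : Op) n = if n = 0 then 1 else 0 := rfl

@[ext] theorem ext {A B : Op} (h : ∀ n, A n = B n) : A = B := funext h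

theorem mul_apply (A B : Op) (n : ℤ × ℤ) :
    (A * B) n = ∑ᶠ i : ℤ × ℤ, A i * shift i (B (n - i)) := rfl

theorem mul_apply_eq_sum {A B : Op} {n : ℤ × ℤ} (s : Finset (ℤ × ℤ))
    (hs : ∀ i, A i ≠ 0 → B (n - i) ≠ 0 → i ∈ s) :
    (A * B) n = ∑ i ∈ s, A i * shift i (B (n - i)) := by
  rw [mul_apply]
  refine finsum_eq_sum_of_support_subset _ fun i hi => ?_
  refine hs i (fun h => hi ?_) fun h => hi ?_
  · change A i * shift i (B (n - i)) = 0
    rw [h, zero_mul]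
  · change A i * shift i (B (n - i)) = 0
    rw [h, shift_zero_coef, mul_zero]

theorem exists_of_mul_apply_ne_zero {A B : Op} {n : ℤ × ℤ} (h : (A * B) n ≠ 0) :
    ∃ i, A i ≠ 0 ∧ B (n - i) ≠ 0 := by
  by_contra! hc
  exact h (by rw [mul_apply_eq_sum (A := A) (B := B) (n := n) ∅
    (fun i h1 h2 => absurd (hc i h1) h2)]; simp)

end Op

/-! ### The ring of quadrant-supported operators. -/

/-- The operators supported in a quadrant `{n | n.1 ≤ M ∧ N ≤ n.2}`; they form a ring, in which all
coefficient sums of products are finite. -/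
def boundedOps : AddSubgroup Op where
  carrier := {A | ∃ M N : ℤ, ∀ n, A n ≠ 0 → n.1 ≤ M ∧ N ≤ n.2}
  zero_mem' := ⟨0, 0, fun n h => absurd rfl h⟩
  add_mem' := by
    rintro A B ⟨M, N, h⟩ ⟨M', N', h'⟩
    refine ⟨max M M', min N N', fun n hn => ?_⟩
    by_cases hA : A n = 0
    · have hB : B n ≠ 0 := fun hB => hn (by rw [Op.add_apply, hA, hB, add_zero])
      exact ⟨(h' n hB).1.trans (le_max_right _ _), (min_le_right _ _).trans (h' n hB).2⟩
    · exact ⟨(h n hA).1.trans (le_max_left _ _), (min_le_left _ _).trans (h n hA).2⟩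
  neg_mem' := by
    rintro A ⟨M, N, h⟩
    exact ⟨M, N, fun n hn => h n fun h0 => hn (by rw [Op.neg_apply, h0, neg_zero])⟩

/-- The ring of operators supported in a quadrant. -/
abbrev BOp : Type := boundedOps

namespace BOp

theorem mul_mem {A B : Op} (hA : A ∈ boundedOps) (hB : B ∈ boundedOps) : A * B ∈ boundedOps := by
  obtain ⟨M, N, h⟩ := hA
  obtain ⟨M', N', h'⟩ := hB
  refine ⟨M + M', N + N', fun n hn => ?_⟩
  obtain ⟨i, hi, hi'⟩ := Op.exists_of_mul_apply_ne_zero hn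
  have h1 := h _ hi
  have h2 := h' _ hi'
  simp only [Prod.fst_sub, Prod.snd_sub] at h2
  constructor <;> omega

theorem one_mem : (1 : Op) ∈ boundedOps := by
  refine ⟨0, 0, fun n hn => ?_⟩
  rw [Op.one_apply] at hn
  have : n = 0 := by
    by_contra h
    exact hn (if_neg h)
  simp [this]

instance : Mul BOp := ⟨fun A B => ⟨A.1 * B.1, mul_mem A.2 B.2⟩⟩

instance : One BOp := ⟨⟨1, one_mem⟩⟩

@[simp] theorem coe_mul (A B : BOp) : ((A * B : BOp) : Op) = A.1 * B.1 := rfl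

theorem finite_pairs {A B : Op} (hA : A ∈ boundedOps) (hB : B ∈ boundedOps) (n : ℤ × ℤ) :
    ∃ s : Finset (ℤ × ℤ), ∀ i, A i ≠ 0 → B (n - i) ≠ 0 → i ∈ s := by
  obtain ⟨M, N, h⟩ := hA
  obtain ⟨M', N', h'⟩ := hB
  refine ⟨Finset.Icc (n.1 - M', N) (M, n.2 - N'), fun i hi hi' => ?_⟩
  have h1 := h _ hi
  have h2 := h' _ hi'
  simp only [Prod.fst_sub, Prod.snd_sub] at h2
  rw [Finset.mem_Icc, Prod.le_def, Prod.le_def]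
  refine ⟨⟨?_, ?_⟩, ?_, ?_⟩ <;> simp only <;> omega

/-- Associativity is proved by bringing both bracketings to one double sum over explicit boxes,
large enough to contain every nonzero term. -/
theorem assoc_left {A B C : Op} {n : ℤ × ℤ} {M N M' N' M'' N'' : ℤ}
    (hA : ∀ n, A n ≠ 0 → n.1 ≤ M ∧ N ≤ n.2) (hB : ∀ n, B n ≠ 0 → n.1 ≤ M' ∧ N' ≤ n.2)
    (hC : ∀ n, C n ≠ 0 → n.1 ≤ M'' ∧ N'' ≤ n.2) :
    (A * B * C) n = ∑ i ∈ Finset.Icc (n.1 - M' - M'', N) (M, n.2 - N' - N''),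
      ∑ k ∈ Finset.Icc (n.1 - M'', N + N') (M + M', n.2 - N''),
        A i * shift i (B (k - i)) * shift k (C (n - k)) := by
  rw [Op.mul_apply_eq_sum (Finset.Icc (n.1 - M'', N + N') (M + M', n.2 - N'')), Finset.sum_comm]
  · refine Finset.sum_congr rfl fun k hk => ?_
    rw [← Finset.sum_mul, Op.mul_apply_eq_sum]
    intro i hi hi'
    have h1 := hA _ hi
    have h2 := hB _ hi'
    rw [Finset.mem_Icc, Prod.le_def, Prod.le_def] at hk ⊢
    simp only [Prod.fst_sub, Prod.snd_sub] at h2 hk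
    refine ⟨⟨?_, ?_⟩, ?_, ?_⟩ <;> simp only <;> omega
  · intro k hk hk'
    obtain ⟨i, hi, hi'⟩ := Op.exists_of_mul_apply_ne_zero hk
    have h1 := hA _ hi
    have h2 := hB _ hi'
    have h3 := hC _ hk'
    simp only [Prod.fst_sub, Prod.snd_sub] at h2 h3
    rw [Finset.mem_Icc, Prod.le_def, Prod.le_def]
    refine ⟨⟨?_, ?_⟩, ?_, ?_⟩ <;> simp only <;> omega

theorem assoc_right {A B C : Op} {n : ℤ × ℤ} {M N M' N' M'' N'' : ℤ}
    (hA : ∀ n, A n ≠ 0 → n.1 ≤ M ∧ N ≤ n.2) (hB : ∀ n, B n ≠ 0 → n.1 ≤ M' ∧ N' ≤ n.2)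
    (hC : ∀ n, C n ≠ 0 → n.1 ≤ M'' ∧ N'' ≤ n.2) :
    (A * (B * C)) n = ∑ i ∈ Finset.Icc (n.1 - M' - M'', N) (M, n.2 - N' - N''),
      ∑ k ∈ Finset.Icc (n.1 - M'', N + N') (M + M', n.2 - N''),
        A i * shift i (B (k - i)) * shift k (C (n - k)) := by
  rw [Op.mul_apply_eq_sum (Finset.Icc (n.1 - M' - M'', N) (M, n.2 - N' - N''))]
  · refine Finset.sum_congr rfl fun i _ => ?_
    by_cases hAi : A i = 0
    · simp [hAi]
    have h1 := hA _ hAi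
    rw [Op.mul_apply_eq_sum ((Finset.Icc (n.1 - M'', N + N') (M + M', n.2 - N'')).map
      (Equiv.subRight i).toEmbedding), Finset.sum_map, shift_sum, Finset.mul_sum]
    · refine Finset.sum_congr rfl fun k _ => ?_
      simp [mul_assoc]
    · intro j hj hj'
      rw [Finset.mem_map]
      refine ⟨j + i, ?_, by simp⟩
      have h2 := hB _ hj
      have h3 := hC _ hj'
      simp only [Prod.fst_sub, Prod.snd_sub] at h3
      rw [Finset.mem_Icc, Prod.le_def, Prod.le_def]
      refine ⟨⟨?_, ?_⟩, ?_, ?_⟩ <;> simp only [Prod.fst_add, Prod.snd_add] <;> omega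
  · intro i hi hi'
    obtain ⟨j, hj, hj'⟩ := Op.exists_of_mul_apply_ne_zero hi'
    have h1 := hA _ hi
    have h2 := hB _ hj
    have h3 := hC _ hj'
    simp only [Prod.fst_sub, Prod.snd_sub] at h3
    rw [Finset.mem_Icc, Prod.le_def, Prod.le_def]
    refine ⟨⟨?_, ?_⟩, ?_, ?_⟩ <;> simp only <;> omega

theorem finite_pairs₂ {A B B' : Op} (hA : A ∈ boundedOps) (hB : B ∈ boundedOps)
    (hB' : B' ∈ boundedOps) (n : ℤ × ℤ) : ∃ s : Finset (ℤ × ℤ),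
      ∀ i, A i ≠ 0 → B (n - i) ≠ 0 ∨ B' (n - i) ≠ 0 → i ∈ s := by
  obtain ⟨s, hs⟩ := finite_pairs hA hB n
  obtain ⟨t, ht⟩ := finite_pairs hA hB' n
  refine ⟨s ∪ t, fun i hi h => Finset.mem_union.2 ?_⟩
  exact h.imp (hs i hi) (ht i hi)

theorem finite_pairs₂' {A A' B : Op} (hA : A ∈ boundedOps) (hA' : A' ∈ boundedOps)
    (hB : B ∈ boundedOps) (n : ℤ × ℤ) : ∃ s : Finset (ℤ × ℤ),
      ∀ i, A i ≠ 0 ∨ A' i ≠ 0 → B (n - i) ≠ 0 → i ∈ s := by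
  obtain ⟨s, hs⟩ := finite_pairs hA hB n
  obtain ⟨t, ht⟩ := finite_pairs hA' hB n
  refine ⟨s ∪ t, fun i hi h => Finset.mem_union.2 ?_⟩
  exact hi.imp (fun hi => hs i hi h) (fun hi => ht i hi h)

theorem ne_or_ne_of_add_ne {f g : Coef} (h : f + g ≠ 0) : f ≠ 0 ∨ g ≠ 0 := by
  by_contra! hc
  exact h (by rw [hc.1, hc.2, add_zero])

instance : Ring BOp :=
  { (inferInstance : AddCommGroup BOp) with
    mul := (· * ·)
    one := 1
    mul_assoc := by
      rintro ⟨A, M, N, hA⟩ ⟨B, M', N', hB⟩ ⟨C, M'', N'', hC⟩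
      refine Subtype.ext (Op.ext fun n => ?_)
      exact (assoc_left hA hB hC).trans (assoc_right hA hB hC).symm
    one_mul := by
      rintro ⟨A, hA⟩
      refine Subtype.ext (Op.ext fun n => ?_)
      change ((1 : Op) * A) n = A n
      rw [Op.mul_apply_eq_sum {0}]
      · simp [Op.one_apply]
      · intro i hi _
        by_contra h
        exact hi (by rw [Op.one_apply, if_neg (by simpa using h)])
    mul_one := by
      rintro ⟨A, hA⟩
      refine Subtype.ext (Op.ext fun n => ?_)
      change (A * (1 : Op)) n = A n
      rw [Op.mul_apply_eq_sum {n}]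
      · simp [Op.one_apply]
      · intro i _ hi
        by_contra h
        refine hi ?_
        rw [Op.one_apply, if_neg]
        exact fun h0 => h (by rw [Finset.mem_singleton, sub_eq_zero.1 h0])
    zero_mul := fun A => Subtype.ext (Op.ext fun n => by
      change ((0 : Op) * A.1) n = 0
      rw [Op.mul_apply_eq_sum (A := 0) (B := A.1) ∅ (fun i hi => absurd rfl hi), Finset.sum_empty])
    mul_zero := fun A => Subtype.ext (Op.ext fun n => by
      change (A.1 * (0 : Op)) n = 0
      rw [Op.mul_apply_eq_sum ∅ (fun i _ hi => absurd rfl hi), Finset.sum_empty])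
    left_distrib := by
      rintro ⟨A, hA⟩ ⟨B, hB⟩ ⟨C, hC⟩
      refine Subtype.ext (Op.ext fun n => ?_)
      change (A * (B + C)) n = (A * B) n + (A * C) n
      obtain ⟨s, hs⟩ := finite_pairs₂ hA hB hC n
      rw [Op.mul_apply_eq_sum (A := A) (B := B + C) s fun i hi h => hs i hi (ne_or_ne_of_add_ne h),
        Op.mul_apply_eq_sum s fun i hi h => hs i hi (Or.inl h),
        Op.mul_apply_eq_sum s fun i hi h => hs i hi (Or.inr h), ← Finset.sum_add_distrib]
      exact Finset.sum_congr rfl fun i _ => by rw [Op.add_apply, shift_add, mul_add]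
    right_distrib := by
      rintro ⟨A, hA⟩ ⟨B, hB⟩ ⟨C, hC⟩
      refine Subtype.ext (Op.ext fun n => ?_)
      change ((A + B) * C) n = (A * C) n + (B * C) n
      obtain ⟨s, hs⟩ := finite_pairs₂' hA hB hC n
      rw [Op.mul_apply_eq_sum (A := A + B) (B := C) s fun i hi h => hs i (ne_or_ne_of_add_ne hi) h,
        Op.mul_apply_eq_sum s fun i hi h => hs i (Or.inl hi) h,
        Op.mul_apply_eq_sum s fun i hi h => hs i (Or.inr hi) h, ← Finset.sum_add_distrib]
      exact Finset.sum_congr rfl fun i _ => by rw [Op.add_apply, add_mul] }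

/-- The coefficient of `Λ^n`. -/
def coeff (A : BOp) (n : ℤ × ℤ) : Coef := A.1 n

theorem ext_coeff {A B : BOp} (h : ∀ n, A.coeff n = B.coeff n) : A = B :=
  Subtype.ext (Op.ext h)

@[simp] theorem coeff_zero (n : ℤ × ℤ) : (0 : BOp).coeff n = 0 := rfl

@[simp] theorem coeff_add (A B : BOp) (n : ℤ × ℤ) : (A + B).coeff n = A.coeff n + B.coeff n := rfl

@[simp] theorem coeff_sub (A B : BOp) (n : ℤ × ℤ) : (A - B).coeff n = A.coeff n - B.coeff n := rfl

@[simp] theorem coeff_neg (A : BOp) (n : ℤ × ℤ) : (-A).coeff n = -A.coeff n := rfl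

theorem coeff_one (n : ℤ × ℤ) : (1 : BOp).coeff n = if n = 0 then 1 else 0 := rfl

theorem coeff_mul_eq_sum {A B : BOp} {n : ℤ × ℤ} (s : Finset (ℤ × ℤ))
    (hs : ∀ i, A.coeff i ≠ 0 → B.coeff (n - i) ≠ 0 → i ∈ s) :
    (A * B).coeff n = ∑ i ∈ s, A.coeff i * shift i (B.coeff (n - i)) :=
  Op.mul_apply_eq_sum (A := A.1) (B := B.1) s hs

theorem exists_of_coeff_mul_ne_zero {A B : BOp} {n : ℤ × ℤ} (h : (A * B).coeff n ≠ 0) :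
    ∃ i, A.coeff i ≠ 0 ∧ B.coeff (n - i) ≠ 0 :=
  Op.exists_of_mul_apply_ne_zero h

/-- The operator `A` is supported in the set of exponents satisfying `p`. -/
def Supp (p : ℤ × ℤ → Prop) (A : BOp) : Prop := ∀ n, A.coeff n ≠ 0 → p n

variable {p q r : ℤ × ℤ → Prop} {A B : BOp}

theorem Supp.coeff_eq_zero (hA : Supp p A) {n : ℤ × ℤ} (hn : ¬ p n) : A.coeff n = 0 :=
  not_not.1 fun h => hn (hA n h)

theorem Supp.mono (hA : Supp p A) (h : ∀ n, p n → q n) : Supp q A := fun n hn => h n (hA n hn)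

theorem Supp.zero : Supp p 0 := fun _ h => absurd rfl h

theorem Supp.add (hA : Supp p A) (hB : Supp p B) : Supp p (A + B) := fun n hn =>
  (ne_or_ne_of_add_ne hn).elim (hA n) (hB n)

theorem Supp.neg (hA : Supp p A) : Supp p (-A) := fun n hn =>
  hA n fun h => hn (by rw [coeff_neg, h, neg_zero])

theorem Supp.sub (hA : Supp p A) (hB : Supp p B) : Supp p (A - B) := by
  rw [sub_eq_add_neg]
  exact hA.add hB.neg

theorem Supp.mul (hA : Supp p A) (hB : Supp q B) (h : ∀ a b, p a → q b → r (a + b)) :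
    Supp r (A * B) := fun n hn => by
  obtain ⟨i, hi, hi'⟩ := exists_of_coeff_mul_ne_zero hn
  have := h _ _ (hA _ hi) (hB _ hi')
  rwa [add_sub_cancel] at this

theorem Supp.one (h : p 0) : Supp p 1 := fun n hn => by
  rw [coeff_one] at hn
  rw [show n = 0 from not_not.1 fun h => hn (if_neg h)]
  exact h

theorem Supp.pow (hA : Supp p A) (h0 : p 0) (h : ∀ a b, p a → p b → p (a + b)) (k : ℕ) :
    Supp p (A ^ k) := by
  induction k with
  | zero => rw [pow_zero]; exact Supp.one h0
  | succ k ih => rw [pow_succ]; exact ih.mul hA h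

/-- `Λ^j`. -/
def lam (j : ℤ × ℤ) : BOp := ⟨Lam j, j.1, j.2, fun n hn => by
  have : n = j := not_not.1 fun h => hn (if_neg h)
  rw [this]
  exact ⟨le_rfl, le_rfl⟩⟩

theorem coeff_lam (j n : ℤ × ℤ) : (lam j).coeff n = if n = j then 1 else 0 := rfl

theorem Supp.lam {j : ℤ × ℤ} (h : p j) : Supp p (lam j) := fun n hn => by
  rw [coeff_lam] at hn
  rw [show n = j from not_not.1 fun h => hn (if_neg h)]
  exact h

theorem coeff_lam_mul (j : ℤ × ℤ) (A : BOp) (n : ℤ × ℤ) :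
    (lam j * A).coeff n = shift j (A.coeff (n - j)) := by
  rw [coeff_mul_eq_sum {j}]
  · simp [coeff_lam]
  · intro i hi _
    rw [coeff_lam] at hi
    exact Finset.mem_singleton.2 (not_not.1 fun h => hi (if_neg h))

theorem coeff_mul_lam (j : ℤ × ℤ) (A : BOp) (n : ℤ × ℤ) :
    (A * lam j).coeff n = A.coeff (n - j) := by
  rw [coeff_mul_eq_sum {n - j}]
  · simp [coeff_lam]
  · intro i _ hi
    rw [coeff_lam] at hi
    have : n - i = j := not_not.1 fun h => hi (if_neg h)
    rw [Finset.mem_singleton, ← this, sub_sub_cancel]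

theorem lam_zero : lam 0 = 1 := rfl

theorem lam_mul_lam (i j : ℤ × ℤ) : lam i * lam j = lam (i + j) := by
  refine ext_coeff fun n => ?_
  simp only [coeff_mul_lam, coeff_lam, sub_eq_iff_eq_add]

theorem lam_pow (j : ℤ × ℤ) (k : ℕ) : lam j ^ k = lam (k • j) := by
  induction k with
  | zero => rw [pow_zero, zero_smul, lam_zero]
  | succ k ih => rw [pow_succ, ih, lam_mul_lam, succ_nsmul]

/-- Multiplication by a function. -/
def func (f : Coef) : BOp := ⟨mulOp f, 0, 0, fun n hn => by
  have : n = 0 := not_not.1 fun h => hn (if_neg h)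
  rw [this]
  exact ⟨le_rfl, le_rfl⟩⟩

theorem coeff_func (f : Coef) (n : ℤ × ℤ) : (func f).coeff n = if n = 0 then f else 0 := rfl

theorem Supp.func {f : Coef} (h : p 0) : Supp p (func f) := fun n hn => by
  rw [coeff_func] at hn
  rw [show n = 0 from not_not.1 fun h => hn (if_neg h)]
  exact h

theorem coeff_func_mul (f : Coef) (A : BOp) (n : ℤ × ℤ) :
    (func f * A).coeff n = f * A.coeff n := by
  rw [coeff_mul_eq_sum {0}]
  · simp [coeff_func]
  · intro i hi _
    rw [coeff_func] at hi
    exact Finset.mem_singleton.2 (not_not.1 fun h => hi (if_neg h))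

theorem coeff_mul_func (f : Coef) (A : BOp) (n : ℤ × ℤ) :
    (A * func f).coeff n = A.coeff n * shift n f := by
  rw [coeff_mul_eq_sum {n}]
  · simp [coeff_func]
  · intro i _ hi
    rw [coeff_func] at hi
    have : n - i = 0 := not_not.1 fun h => hi (if_neg h)
    rw [Finset.mem_singleton, sub_eq_zero.1 this]

theorem func_mul_func (f g : Coef) : func f * func g = func (f * g) := by
  refine ext_coeff fun n => ?_
  rw [coeff_func_mul, coeff_func, coeff_func]
  split_ifs <;> simp

theorem func_one : func 1 = 1 := rfl

/-- Translation of all coefficients. -/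
def trans (j : ℤ × ℤ) : BOp →+* BOp where
  toFun A := ⟨translate j A.1, by
    obtain ⟨M, N, h⟩ := A.2
    refine ⟨M, N, fun n hn => h n fun h0 => hn ?_⟩
    change shift j (A.1 n) = 0
    rw [h0, shift_zero_coef]⟩
  map_one' := by
    refine ext_coeff fun n => ?_
    change shift j ((1 : BOp).coeff n) = (1 : BOp).coeff n
    rw [coeff_one]
    split_ifs <;> simp
  map_mul' A B := by
    refine ext_coeff fun n => ?_
    obtain ⟨s, hs⟩ := finite_pairs A.2 B.2 n
    change shift j ((A * B).coeff n) = _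
    rw [coeff_mul_eq_sum s hs, shift_sum, coeff_mul_eq_sum s]
    · refine Finset.sum_congr rfl fun i _ => ?_
      change _ = shift j (A.coeff i) * shift i (shift j (B.coeff (n - i)))
      rw [shift_mul, shift_shift, shift_shift, add_comm]
    · intro i hi hi'
      exact hs i (fun h => hi ((shift_eq_zero_iff j _).2 h))
        fun h => hi' ((shift_eq_zero_iff j _).2 h)
  map_zero' := rfl
  map_add' _ _ := rfl

@[simp] theorem coeff_trans (j : ℤ × ℤ) (A : BOp) (n : ℤ × ℤ) :
    (trans j A).coeff n = shift j (A.coeff n) := rfl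

@[simp] theorem trans_lam (i j : ℤ × ℤ) : trans i (lam j) = lam j := by
  refine ext_coeff fun n => ?_
  rw [coeff_trans, coeff_lam]
  split_ifs <;> simp

theorem trans_trans (i j : ℤ × ℤ) (A : BOp) : trans i (trans j A) = trans (i + j) A :=
  ext_coeff fun n => by simp

@[simp] theorem zero_trans (A : BOp) : trans 0 A = A := ext_coeff fun n => by simp

theorem lam_mul (j : ℤ × ℤ) (A : BOp) : lam j * A = trans j A * lam j :=
  ext_coeff fun n => by rw [coeff_lam_mul, coeff_mul_lam, coeff_trans]

theorem Supp.trans (hA : Supp p A) (j : ℤ × ℤ) : Supp p (trans j A) := fun n hn =>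
  hA n fun h => hn ((shift_eq_zero_iff j _).2 h)

/-- The time derivative on coefficient functions. -/
def dCoef (r : Time) (f : Coef) : Coef := fun m => MvPowerSeries.pderiv ℂ r (f m)

theorem dCoef_zero (r : Time) : dCoef r 0 = 0 := funext fun _ => map_zero _

theorem dCoef_one (r : Time) : dCoef r 1 = 0 := funext fun _ => Derivation.map_one_eq_zero _

theorem dCoef_add (r : Time) (f g : Coef) : dCoef r (f + g) = dCoef r f + dCoef r g :=
  funext fun _ => map_add _ _ _

theorem dCoef_mul (r : Time) (f g : Coef) :
    dCoef r (f * g) = dCoef r f * g + f * dCoef r g := funext fun m => by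
  change MvPowerSeries.pderiv ℂ r (f m * g m) = _
  rw [Derivation.leibniz]
  simp only [smul_eq_mul, dCoef, Pi.add_apply, Pi.mul_apply]
  ring

theorem dCoef_sum {ι : Type*} (r : Time) (s : Finset ι) (f : ι → Coef) :
    dCoef r (∑ i ∈ s, f i) = ∑ i ∈ s, dCoef r (f i) := by
  funext m
  simp [dCoef, Finset.sum_apply]

theorem dCoef_shift (r : Time) (j : ℤ × ℤ) (f : Coef) : dCoef r (shift j f) = shift j (dCoef r f) :=
  rfl

theorem dCoef_comm (r s : Time) (f : Coef) : dCoef r (dCoef s f) = dCoef s (dCoef r f) := by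
  funext m
  ext n
  simp only [dCoef, MvPowerSeries.coeff_pderiv, Finsupp.add_apply]
  rw [add_right_comm]
  by_cases h : r = s
  · subst h; rfl
  · rw [Finsupp.single_eq_of_ne (Ne.symm h), Finsupp.single_eq_of_ne h]
    push_cast
    ring

/-- The time derivative of operators, coefficient by coefficient. -/
def D (r : Time) : BOp →+ BOp where
  toFun A := ⟨fun n => dCoef r (A.1 n), by
    obtain ⟨M, N, h⟩ := A.2
    refine ⟨M, N, fun n hn => h n fun h0 => hn ?_⟩
    change dCoef r (A.1 n) = 0
    rw [h0, dCoef_zero]⟩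
  map_zero' := ext_coeff fun _ => dCoef_zero r
  map_add' _ _ := ext_coeff fun _ => dCoef_add r _ _

@[simp] theorem coeff_D (r : Time) (A : BOp) (n : ℤ × ℤ) :
    (D r A).coeff n = dCoef r (A.coeff n) := rfl

theorem Supp.D (hA : Supp p A) (r : Time) : Supp p (D r A) := fun n hn =>
  hA n fun h => hn (by rw [coeff_D, h, dCoef_zero])

theorem D_mul (r : Time) (A B : BOp) : D r (A * B) = D r A * B + A * D r B := by
  refine ext_coeff fun n => ?_
  obtain ⟨s, hs⟩ := finite_pairs A.2 B.2 n
  rw [coeff_D, coeff_mul_eq_sum s hs, dCoef_sum, coeff_add, coeff_mul_eq_sum s, coeff_mul_eq_sum s,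
    ← Finset.sum_add_distrib]
  · refine Finset.sum_congr rfl fun i _ => ?_
    rw [dCoef_mul, coeff_D, coeff_D, dCoef_shift]
  · intro i hi hi'
    exact hs i hi fun h => hi' (by
      rw [coeff_D]
      exact (congrArg _ h).trans (dCoef_zero r))
  · intro i hi hi'
    exact hs i (fun h => hi (by
      rw [coeff_D]
      exact (congrArg _ h).trans (dCoef_zero r))) hi'

@[simp] theorem D_lam (r : Time) (j : ℤ × ℤ) : D r (lam j) = 0 := by
  refine ext_coeff fun n => ?_
  rw [coeff_D, coeff_lam, coeff_zero]
  split_ifs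
  · exact dCoef_one r
  · exact dCoef_zero r

theorem D_one (r : Time) : D r 1 = 0 := D_lam r 0

theorem D_trans (r : Time) (j : ℤ × ℤ) (A : BOp) : D r (trans j A) = trans j (D r A) := rfl

theorem D_comm (r s : Time) (A : BOp) : D r (D s A) = D s (D r A) :=
  ext_coeff fun _ => dCoef_comm r s _

open Classical in
/-- The part of `A` with exponents satisfying `p`. -/
def restrict (p : ℤ × ℤ → Prop) (A : BOp) : BOp := ⟨fun n => if p n then A.1 n else 0, by
  obtain ⟨M, N, h⟩ := A.2
  refine ⟨M, N, fun n hn => h n fun h0 => hn ?_⟩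
  change (if p n then A.1 n else 0) = 0
  rw [h0, ite_self]⟩

theorem coeff_restrict_of (A : BOp) {n : ℤ × ℤ} (h : p n) :
    (restrict p A).coeff n = A.coeff n := if_pos h

theorem coeff_restrict_of_not (A : BOp) {n : ℤ × ℤ} (h : ¬ p n) :
    (restrict p A).coeff n = 0 := if_neg h

theorem restrict_supp (p : ℤ × ℤ → Prop) (A : BOp) : Supp p (restrict p A) := fun _ hn =>
  not_not.1 fun h => hn (if_neg h)

theorem Supp.restrict (hA : Supp q A) (p : ℤ × ℤ → Prop) : Supp q (restrict p A) := fun n hn =>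
  hA n fun h => hn (by
    by_cases hp : p n
    · rw [coeff_restrict_of A hp, h]
    · exact coeff_restrict_of_not A hp)

theorem sub_restrict_supp (p : ℤ × ℤ → Prop) (A : BOp) :
    Supp (fun n => ¬ p n) (A - BOp.restrict p A) := fun _ hn hp => hn (by
  rw [coeff_sub, coeff_restrict_of A hp, sub_self])

end BOp

/-! ### Recursion and first-order difference equations. -/

theorem exists_strong_rec {α : Type*} (F : (k : ℕ) → (Fin k → α) → α) :
    ∃ y : ℕ → α, ∀ k, y k = F k fun i => y i := by
  refine ⟨fun k => Nat.strongRec (motive := fun _ => α) (fun k ih => F k fun i => ih i i.2) k,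
    fun k => ?_⟩
  beta_reduce
  rw [Nat.strongRec_eq]

section FirstOrder

variable {R : Type*} [CommRing R]

/-- Forward solution of `y (n + 1) = a n * y n + f n`, `y 0 = c`. -/
def solveUp (a f : ℤ → R) (c : R) : ℕ → R
  | 0 => c
  | k + 1 => a k * solveUp a f c k + f k

/-- Backward solution of `y (n + 1) = a n * y n + f n`, `y 0 = c`; the index is `-n`. -/
def solveDown (a f : ℤ → R) (c : R) : ℕ → R
  | 0 => c
  | k + 1 => Ring.inverse (a (Int.negSucc k)) * (solveDown a f c k - f (Int.negSucc k))

/-- The solution of `y (n + 1) = a n * y n + f n` on `ℤ` with `y 0 = c`. -/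
def solve (a f : ℤ → R) (c : R) : ℤ → R
  | Int.ofNat k => solveUp a f c k
  | Int.negSucc k => solveDown a f c (k + 1)

theorem solve_add_one (a f : ℤ → R) (c : R) (ha : ∀ n, IsUnit (a n)) (n : ℤ) :
    solve a f c (n + 1) = a n * solve a f c n + f n := by
  match n with
  | Int.ofNat k => rfl
  | Int.negSucc 0 =>
    change c = a (Int.negSucc 0) * (Ring.inverse (a (Int.negSucc 0)) * (c - f (Int.negSucc 0))) + _
    rw [← mul_assoc, Ring.mul_inverse_cancel _ (ha _)]
    ring
  | Int.negSucc (k + 1) =>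
    change solveDown a f c (k + 1) = a (Int.negSucc (k + 1)) *
      (Ring.inverse (a (Int.negSucc (k + 1))) *
        (solveDown a f c (k + 1) - f (Int.negSucc (k + 1)))) + f (Int.negSucc (k + 1))
    rw [← mul_assoc, Ring.mul_inverse_cancel _ (ha _)]
    ring

theorem isUnit_solve (a : ℤ → R) (ha : ∀ n, IsUnit (a n)) (n : ℤ) :
    IsUnit (solve a 0 1 n) := by
  have hup : ∀ k, IsUnit (solveUp a 0 1 k) := fun k => by
    induction k with
    | zero => exact isUnit_one
    | succ k ih =>
      rw [solveUp, Pi.zero_apply, add_zero]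
      exact (ha _).mul ih
  have hdown : ∀ k, IsUnit (solveDown a 0 1 k) := fun k => by
    induction k with
    | zero => exact isUnit_one
    | succ k ih =>
      rw [solveDown, Pi.zero_apply, sub_zero]
      exact (IsUnit.ringInverse (ha _)).mul ih
  match n with
  | Int.ofNat k => exact hup k
  | Int.negSucc k => exact hdown (k + 1)

/-- This keeps the leading coefficient of a monic dressing operator equal to `1`, and not merely
invertible. -/
theorem solve_one (n : ℤ) : solve (1 : ℤ → R) 0 1 n = 1 := by
  have hup : ∀ k, solveUp (1 : ℤ → R) 0 1 k = 1 := fun k => by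
    induction k with
    | zero => rfl
    | succ k ih => simp [solveUp, ih]
  have hdown : ∀ k, solveDown (1 : ℤ → R) 0 1 k = 1 := fun k => by
    induction k with
    | zero => rfl
    | succ k ih => simp [solveDown, ih]
  match n with
  | Int.ofNat k => exact hup k
  | Int.negSucc k => exact hdown (k + 1)

end FirstOrder

/-- The solution `s` of `s (m + d) = a m * s m + f m` with `s = c` on the line `φ = 0`. -/
def solveCoef (d : ℤ × ℤ) (φ : ℤ × ℤ →+ ℤ) (a f : Coef) (c : MvPowerSeries Time ℂ) : Coef :=
  fun m => solve (fun n => a (m - φ m • d + n • d)) (fun n => f (m - φ m • d + n • d)) c (φ m)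

section solveCoef

variable {d : ℤ × ℤ} {φ : ℤ × ℤ →+ ℤ}

/-- Since `φ d = 1`, each `m` lies on exactly one line in direction `d` through the set `φ = 0`, so
the equation splits into independent scalar recursions over `ℤ`. -/
theorem shift_solveCoef (hφ : φ d = 1) {a : Coef} (ha : IsUnit a) (f : Coef)
    (c : MvPowerSeries Time ℂ) :
    shift d (solveCoef d φ a f c) = a * solveCoef d φ a f c + f := by
  funext m
  have h : m + d - φ (m + d) • d = m - φ m • d := by
    rw [map_add, hφ, add_smul, one_smul]
    abel
  change solve (fun n => a (m + d - φ (m + d) • d + n • d))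
    (fun n => f (m + d - φ (m + d) • d + n • d)) c (φ (m + d)) = _
  rw [h, map_add, hφ, solve_add_one _ _ _ fun n => Pi.isUnit_iff.1 ha _, sub_add_cancel]
  rfl

/-- The initial value is the same constant on all of `φ = 0`, so a translation inside that set which
preserves the data also preserves the solution. -/
theorem shift_solveCoef_eq_self {u : ℤ × ℤ} (hu : φ u = 0) {a f : Coef}
    (ha : shift u a = a) (hf : shift u f = f) (c : MvPowerSeries Time ℂ) :
    shift u (solveCoef d φ a f c) = solveCoef d φ a f c := by
  funext m
  have h : ∀ n : ℤ, m + u - φ (m + u) • d + n • d = m - φ m • d + n • d + u := fun n => by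
    rw [map_add, hu, add_zero]
    abel
  change solve (fun n => a (m + u - φ (m + u) • d + n • d))
    (fun n => f (m + u - φ (m + u) • d + n • d)) c (φ (m + u)) = _
  simp only [h]
  rw [map_add, hu, add_zero]
  have ha' : ∀ x, a (x + u) = a x := congrFun ha
  have hf' : ∀ x, f (x + u) = f x := congrFun hf
  simp only [ha', hf']
  rfl

theorem isUnit_solveCoef {a : Coef} (ha : IsUnit a) : IsUnit (solveCoef d φ a 0 1) :=
  Pi.isUnit_iff.2 fun _ => isUnit_solve _ (fun _ => Pi.isUnit_iff.1 ha _) _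

theorem solveCoef_one : solveCoef d φ 1 0 1 = 1 := funext fun _ => solve_one _

end solveCoef

/-! ### Formal series in one direction of the lattice. -/

/-- A direction `v` of formal series, a complementary direction `w`, and the dual basis. -/
structure Frame where
  /-- The direction of the series. -/
  v : ℤ × ℤ
  /-- The complementary direction. -/
  w : ℤ × ℤ
  /-- The coordinate along `v`. -/
  l : ℤ × ℤ →+ ℤ
  /-- The coordinate along `w`. -/
  l' : ℤ × ℤ →+ ℤ
  l_v : l v = 1
  l_w : l w = 0
  l'_v : l' v = 0
  l'_w : l' w = 1
  decomp : ∀ n, n = l n • v + l' n • w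
  fst_nonpos : v.1 ≤ 0
  snd_nonneg : 0 ≤ v.2

namespace Frame

open BOp

variable (F : Frame)

/-- `A` is a series in `Λ^v` starting at order `k`. -/
def Ord (k : ℤ) (A : BOp) : Prop := Supp (fun n => F.l' n = 0 ∧ k ≤ F.l n) A

theorem eq_smul {n : ℤ × ℤ} (h : F.l' n = 0) : n = F.l n • F.v := by
  conv_lhs => rw [F.decomp n, h, zero_smul, add_zero]

theorem l_smul (k : ℤ) : F.l (k • F.v) = k := by rw [map_zsmul, F.l_v, smul_eq_mul, mul_one]

theorem l'_smul (k : ℤ) : F.l' (k • F.v) = 0 := by rw [map_zsmul, F.l'_v, smul_zero]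

variable {F} {A B : BOp} {i j : ℤ}

theorem Ord.mono (hA : F.Ord i A) (h : j ≤ i) : F.Ord j A :=
  Supp.mono hA fun _ hn => ⟨hn.1, h.trans hn.2⟩

theorem Ord.mul' (hA : F.Ord i A) (hB : F.Ord j B) : F.Ord (i + j) (A * B) :=
  Supp.mul hA hB fun a b ha hb => by
    rw [map_add, map_add, ha.1, hb.1]
    exact ⟨rfl, add_le_add ha.2 hb.2⟩

theorem Ord.mul {k : ℤ} (hA : F.Ord i A) (hB : F.Ord j B) (h : k ≤ i + j) : F.Ord k (A * B) :=
  (hA.mul' hB).mono h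

theorem ord_lam (k : ℤ) : F.Ord k (lam (k • F.v)) :=
  Supp.lam ⟨F.l'_smul k, (F.l_smul k).ge⟩

theorem ord_one : F.Ord 0 1 := Supp.one ⟨map_zero _, (map_zero F.l).ge⟩

theorem Ord.ext (hA : F.Ord i A) (hB : F.Ord i B)
    (h : ∀ k : ℤ, i ≤ k → A.coeff (k • F.v) = B.coeff (k • F.v)) : A = B := by
  refine ext_coeff fun n => ?_
  by_cases hn : F.l' n = 0 ∧ i ≤ F.l n
  · rw [F.eq_smul hn.1]
    exact h _ hn.2
  · rw [hA.coeff_eq_zero hn, hB.coeff_eq_zero hn]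

theorem Ord.ext_nat (hA : F.Ord 0 A) (hB : F.Ord 0 B)
    (h : ∀ k : ℕ, A.coeff ((k : ℤ) • F.v) = B.coeff ((k : ℤ) • F.v)) : A = B :=
  hA.ext hB fun k hk => by
    lift k to ℕ using hk
    exact h k

variable (F) in
/-- The series `∑_{k ≥ 0} x_k Λ^{k v}`. -/
def series (x : ℕ → Coef) : BOp :=
  ⟨fun n => if F.l' n = 0 ∧ 0 ≤ F.l n then x (F.l n).toNat else 0, 0, 0, fun n hn => by
    have h : F.l' n = 0 ∧ 0 ≤ F.l n := not_not.1 fun h => hn (if_neg h)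
    rw [F.eq_smul h.1]
    exact ⟨mul_nonpos_of_nonneg_of_nonpos h.2 F.fst_nonpos, mul_nonneg h.2 F.snd_nonneg⟩⟩

theorem ord_series (x : ℕ → Coef) : F.Ord 0 (F.series x) := fun _ hn =>
  not_not.1 fun h => hn (if_neg h)

theorem coeff_series (x : ℕ → Coef) (k : ℕ) : (F.series x).coeff ((k : ℤ) • F.v) = x k := by
  have h : F.l' ((k : ℤ) • F.v) = 0 ∧ 0 ≤ F.l ((k : ℤ) • F.v) :=
    ⟨F.l'_smul k, (Int.natCast_nonneg k).trans (F.l_smul k).ge⟩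
  refine (if_pos h).trans ?_
  rw [F.l_smul, Int.toNat_natCast]

theorem coeff_mul (hA : F.Ord 0 A) (hB : F.Ord 0 B) (k : ℕ) :
    (A * B).coeff ((k : ℤ) • F.v) = ∑ j ∈ Finset.range (k + 1),
      A.coeff (((k - j : ℕ) : ℤ) • F.v) *
        shift (((k - j : ℕ) : ℤ) • F.v) (B.coeff ((j : ℤ) • F.v)) := by
  rw [coeff_mul_eq_sum ((Finset.range (k + 1)).image fun j => (((k - j : ℕ) : ℤ) • F.v)),
    Finset.sum_image]
  · refine Finset.sum_congr rfl fun j hj => ?_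
    rw [← sub_smul, Nat.cast_sub (Nat.lt_succ_iff.1 (Finset.mem_range.1 hj)), sub_sub_cancel]
  · intro a ha b hb hab
    have := congrArg F.l hab
    simp only [F.l_smul] at this
    rw [Finset.coe_range, Set.mem_Iio] at ha hb
    omega
  · intro n hn hn'
    have h1 := hA n hn
    have h2 : F.l' ((k : ℤ) • F.v - n) = 0 ∧ 0 ≤ F.l ((k : ℤ) • F.v - n) := hB _ hn'
    rw [map_sub, map_sub, F.l_smul, F.l'_smul] at h2
    refine Finset.mem_image.2 ⟨k - (F.l n).toNat, ?_, ?_⟩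
    · rw [Finset.mem_range]; omega
    · conv_rhs => rw [F.eq_smul h1.1]
      congr 1
      omega

theorem coeff_mul_zero (hA : F.Ord 0 A) (hB : F.Ord 0 B) :
    (A * B).coeff 0 = A.coeff 0 * B.coeff 0 := by
  have := coeff_mul hA hB 0
  simpa using this

theorem exists_right_inverse (hA : F.Ord 0 A) (h0 : IsUnit (A.coeff 0)) :
    ∃ B, F.Ord 0 B ∧ IsUnit (B.coeff 0) ∧ A * B = 1 := by
  obtain ⟨y, hy⟩ := exists_strong_rec (α := Coef) fun k y => Ring.inverse (A.coeff 0) *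
    ((if k = 0 then 1 else 0) - ∑ j : Fin k, A.coeff (((k - j : ℕ) : ℤ) • F.v) *
      shift (((k - j : ℕ) : ℤ) • F.v) (y j))
  refine ⟨F.series y, ord_series y, ?_, ?_⟩
  · have := coeff_series (F := F) y 0
    rw [Nat.cast_zero, zero_smul] at this
    rw [this, hy]
    simpa using h0.ringInverse
  · refine (hA.mul (ord_series y) (by norm_num)).ext_nat ord_one fun k => ?_
    rw [coeff_mul hA (ord_series y)]
    simp only [coeff_series]
    rw [Finset.sum_range_succ, Nat.sub_self, Nat.cast_zero, zero_smul, zero_shift]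
    conv_lhs => enter [2]; rw [hy k]
    rw [← mul_assoc, Ring.mul_inverse_cancel _ h0, one_mul, ← Fin.sum_univ_eq_sum_range
      fun j => A.coeff (((k - j : ℕ) : ℤ) • F.v) * shift (((k - j : ℕ) : ℤ) • F.v) (y j),
      add_sub_cancel, coeff_one]
    refine if_congr ⟨fun h => by simp [h], fun h => ?_⟩ rfl rfl
    have := congrArg F.l h
    rw [F.l_smul, map_zero] at this
    exact_mod_cast this

theorem exists_inverse (hA : F.Ord 0 A) (h0 : IsUnit (A.coeff 0)) :
    ∃ B, F.Ord 0 B ∧ A * B = 1 ∧ B * A = 1 := by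
  obtain ⟨B, hB, hB0, hAB⟩ := exists_right_inverse hA h0
  obtain ⟨C, -, -, hBC⟩ := exists_right_inverse hB hB0
  refine ⟨B, hB, hAB, ?_⟩
  rwa [left_inv_eq_right_inv hAB hBC]

/-- At order `k` the equation reads `s_k(m + d) = X_0 s_k + (terms in s_j, j < k)`, a first-order
difference equation with invertible coefficient. The initial values `1` for `k = 0` and `0`
otherwise give an invertible leading coefficient and respect the symmetries of `X`. -/
theorem exists_mul_eq_trans {X : BOp} (hX : F.Ord 0 X) (h0 : IsUnit (X.coeff 0)) {d : ℤ × ℤ}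
    {φ : ℤ × ℤ →+ ℤ} (hφ : φ d = 1) :
    ∃ S, F.Ord 0 S ∧ IsUnit (S.coeff 0) ∧ X * S = trans d S ∧ (X.coeff 0 = 1 → S.coeff 0 = 1) ∧
      ∀ u, φ u = 0 → trans u X = X → trans u S = S := by
  obtain ⟨s, hs⟩ := exists_strong_rec (α := Coef) fun k s => solveCoef d φ (X.coeff 0)
    (∑ j : Fin k, X.coeff (((k - j : ℕ) : ℤ) • F.v) * shift (((k - j : ℕ) : ℤ) • F.v) (s j))
    (if k = 0 then 1 else 0)
  have hz : (F.series s).coeff 0 = solveCoef d φ (X.coeff 0) 0 1 := by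
    have := coeff_series (F := F) s 0
    rw [Nat.cast_zero, zero_smul] at this
    rw [this, hs]
    simp
  refine ⟨F.series s, ord_series s, hz ▸ isUnit_solveCoef h0, ?_, fun h => ?_, fun u hu hXu => ?_⟩
  · refine (hX.mul (ord_series s) (by norm_num)).ext_nat (Supp.trans (ord_series s) d)
      fun k => ?_
    rw [coeff_mul hX (ord_series s), coeff_trans]
    simp only [coeff_series]
    rw [Finset.sum_range_succ, Nat.sub_self, Nat.cast_zero, zero_smul, zero_shift]
    conv_rhs => rw [hs k, shift_solveCoef hφ h0, ← hs k]
    rw [← Fin.sum_univ_eq_sum_range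
      fun j => X.coeff (((k - j : ℕ) : ℤ) • F.v) * shift (((k - j : ℕ) : ℤ) • F.v) (s j), add_comm]
  · rw [hz, h, solveCoef_one]
  · have hXc : ∀ n, shift u (X.coeff n) = X.coeff n := fun n => by rw [← coeff_trans, hXu]
    refine Ord.ext_nat (Supp.trans (ord_series s) u) (ord_series s) fun k => ?_
    rw [coeff_trans, coeff_series]
    induction k using Nat.strong_induction_on with
    | _ k ih =>
      rw [hs k]
      refine shift_solveCoef_eq_self hu (hXc 0) ?_ _
      rw [shift_sum]
      refine Finset.sum_congr rfl fun j _ => ?_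
      rw [shift_mul, hXc, shift_shift, add_comm, ← shift_shift, ih j j.2]

end Frame

/-! ### Dressing a Lax operator together with its intertwiner. -/

namespace BOp

theorem lam_mul_lam_neg (j : ℤ × ℤ) : lam j * lam (-j) = 1 := by
  rw [lam_mul_lam, add_neg_cancel, lam_zero]

theorem lam_neg_mul_lam (j : ℤ × ℤ) : lam (-j) * lam j = 1 := by
  rw [lam_mul_lam, neg_add_cancel, lam_zero]

theorem trans_eq_self_of_commute {j : ℤ × ℤ} {A : BOp} (h : lam j * A = A * lam j) :
    trans j A = A := by
  rw [lam_mul] at h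
  have := congrArg (· * lam (-j)) h
  simpa [mul_assoc, lam_mul_lam_neg] using this

theorem trans_neg_eq_self {j : ℤ × ℤ} {A : BOp} (h : trans j A = A) : trans (-j) A = A := by
  conv_lhs => rw [← h, trans_trans, neg_add_cancel, zero_trans]

theorem commute_of_trans_eq_self {j : ℤ × ℤ} {A : BOp} (h : trans j A = A) :
    lam j * A = A * lam j := by
  rw [lam_mul, h]

end BOp

namespace Frame

open BOp

variable {F : Frame}

/-- A solution of the Lax equation alone is unique only up to right factors commuting with `Λ^v`;
this freedom is spent on meeting the second equation. Compatibility is exactly the hypothesis `X L =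
L(m + w) X`. -/
theorem exists_dressing {L X : BOp} (hL : F.Ord (-1) L) (hL0 : IsUnit (L.coeff (-F.v)))
    (hX : F.Ord 0 X) (hX0 : IsUnit (X.coeff 0)) (hXL : X * L = trans F.w L * X) :
    ∃ S Si, F.Ord 0 S ∧ F.Ord 0 Si ∧ S * Si = 1 ∧ Si * S = 1 ∧ IsUnit (S.coeff 0) ∧
      (L.coeff (-F.v) = 1 → X.coeff 0 = 1 → S.coeff 0 = 1) ∧
      L * S = S * lam (-F.v) ∧ X * S = trans F.w S := by
  -- Moving `Λ^{-v}` through `S₀` turns `L S₀ = S₀ Λ^{-v}` into `Y S₀ = S₀(m + v)`, where `Y` is `L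
  -- Λ^v` translated by `v` and has order `0`.
  have hY : F.Ord 0 (trans F.v (L * lam F.v)) := by
    refine Supp.trans (p := fun n => F.l' n = 0 ∧ 0 ≤ F.l n) ?_ _
    have := ord_lam (F := F) 1
    rw [one_smul] at this
    exact hL.mul this (by norm_num)
  have hY0 : (trans F.v (L * lam F.v)).coeff 0 = shift F.v (L.coeff (-F.v)) := by
    rw [coeff_trans, coeff_mul_lam, zero_sub]
  obtain ⟨S₀, hS₀, hS₀u, hS₀X, hS₀1, -⟩ :=
    exists_mul_eq_trans hY (hY0 ▸ isUnit_shift _ hL0) F.l_v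
  obtain ⟨S₀i, hS₀i, h1, h2⟩ := exists_inverse hS₀ hS₀u
  have hLS : L * S₀ = S₀ * lam (-F.v) := by
    have := congrArg (trans (-F.v)) hS₀X
    rw [map_mul, trans_trans, trans_trans, neg_add_cancel, zero_trans, zero_trans, mul_assoc,
      lam_mul, trans_trans, add_neg_cancel, zero_trans] at this
    conv_rhs => rw [← this]
    rw [mul_assoc, mul_assoc, lam_mul_lam_neg, mul_one]
  have h2' : trans F.w S₀i * trans F.w S₀ = 1 := by rw [← map_mul, h2, map_one]
  have h1' : trans F.w S₀ * trans F.w S₀i = 1 := by rw [← map_mul, h1, map_one]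
  have hLS' : trans F.w L * trans F.w S₀ = trans F.w S₀ * lam (-F.v) := by
    rw [← map_mul, hLS, map_mul, trans_lam]
  have hLSi : trans F.w S₀i * trans F.w L = lam (-F.v) * trans F.w S₀i := by
    calc trans F.w S₀i * trans F.w L
        = trans F.w S₀i * (trans F.w L * trans F.w S₀) * trans F.w S₀i := by
          simp only [mul_assoc, h1', mul_one]
      _ = _ := by rw [hLS', ← mul_assoc, h2', one_mul]
  -- `G` is `X` seen after dressing by `S₀`. It commutes with `Λ^{-v}`, so the solution `T` of `G T
  -- = T(m + w)` can be chosen invariant under `v`.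
  set G := trans F.w S₀i * X * S₀ with hG
  have hGord : F.Ord 0 G :=
    (Ord.mul (k := 0) (Supp.trans hS₀i F.w) hX (by norm_num)).mul hS₀ (by norm_num)
  have hi0 : S₀i.coeff 0 * S₀.coeff 0 = 1 := by
    rw [← coeff_mul_zero hS₀i hS₀, h2, coeff_one, if_pos rfl]
  have hG0 : G.coeff 0 = shift F.w (S₀i.coeff 0) * X.coeff 0 * S₀.coeff 0 := by
    rw [hG, coeff_mul_zero (Ord.mul (k := 0) (Supp.trans hS₀i F.w) hX (by norm_num)) hS₀,
      coeff_mul_zero (F := F) (Supp.trans hS₀i F.w) hX, coeff_trans]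
  have hGu : IsUnit (G.coeff 0) := by
    rw [hG0]
    exact ((isUnit_shift _ (IsUnit.of_mul_eq_one _ hi0)).mul hX0).mul hS₀u
  have hGv : trans F.v G = G := by
    have h : trans (-F.v) G = G := by
      refine trans_eq_self_of_commute ?_
      calc lam (-F.v) * G = lam (-F.v) * trans F.w S₀i * X * S₀ := by simp only [hG, mul_assoc]
        _ = trans F.w S₀i * (trans F.w L * X) * S₀ := by rw [← hLSi]; simp only [mul_assoc]
        _ = trans F.w S₀i * X * (L * S₀) := by rw [← hXL]; simp only [mul_assoc]
        _ = G * lam (-F.v) := by rw [hLS]; simp only [hG, mul_assoc]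
    simpa using trans_neg_eq_self h
  obtain ⟨T, hT, hTu, hTX, hT1, hTv⟩ := exists_mul_eq_trans hGord hGu F.l'_w
  have hTv' := commute_of_trans_eq_self (trans_neg_eq_self (hTv F.v F.l'_v hGv))
  have hS : F.Ord 0 (S₀ * T) := hS₀.mul hT (by norm_num)
  have hSu : IsUnit ((S₀ * T).coeff 0) := by
    rw [coeff_mul_zero hS₀ hT]
    exact hS₀u.mul hTu
  obtain ⟨Si, hSi, h3, h4⟩ := exists_inverse hS hSu
  refine ⟨S₀ * T, Si, hS, hSi, h3, h4, hSu, fun hL1 hX1 => ?_, ?_, ?_⟩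
  · have hs : S₀.coeff 0 = 1 := hS₀1 (by rw [hY0, hL1, shift_one_coef])
    have hsi : S₀i.coeff 0 = 1 := by rwa [hs, mul_one] at hi0
    rw [coeff_mul_zero hS₀ hT, hs, hT1, one_mul]
    rw [hG0, hX1, hs, hsi, shift_one_coef, one_mul, one_mul]
  · rw [← mul_assoc, hLS, mul_assoc, hTv', mul_assoc]
  · have : X * S₀ = trans F.w S₀ * G := by
      rw [hG, ← mul_assoc, ← mul_assoc, h1', one_mul]
    rw [← mul_assoc, this, mul_assoc, hTX, map_mul]

end Frame

/-! ### Closed linear flows in formal power series. -/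

section LinearFlow

open MvPowerSeries Finsupp

variable {σ A : Type*} [CommRing A] [Algebra ℚ A]

theorem exists_degree_rec {α : Type*}
    (G : (n : σ →₀ ℕ) → ((m : σ →₀ ℕ) → m.degree < n.degree → α) → α) :
    ∃ T : (σ →₀ ℕ) → α, ∀ n, T n = G n fun m _ => T m := by
  have wf : WellFounded fun m n : σ →₀ ℕ => m.degree < n.degree :=
    InvImage.wf Finsupp.degree wellFounded_lt
  exact ⟨wf.fix G, fun n => wf.fix_eq G n⟩

/-- Each nonconstant monomial is integrated in a single variable occurring in it; closedness is not
yet needed because the other equations are not claimed. -/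
theorem exists_linear_flow_rec (g : σ → MvPowerSeries σ A) :
    ∃ T : MvPowerSeries σ A, constantCoeff T = 1 ∧ ∀ n : σ →₀ ℕ, n ≠ 0 → ∃ s, ∃ m : σ →₀ ℕ, n = m + single s 1 ∧
      (n s : A) * coeff n T = coeff m (g s * T) := by
  classical
  have hsupp : ∀ n : σ →₀ ℕ, n ≠ 0 → ∃ s, ∃ m : σ →₀ ℕ, n = m + single s 1 := fun n hn => by
    obtain ⟨s, hs⟩ := Finsupp.ne_iff.1 hn
    refine ⟨s, n - single s 1, (tsub_add_cancel_of_le ?_).symm⟩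
    rw [Finsupp.single_le_iff]
    exact Nat.one_le_iff_ne_zero.2 hs
  choose s m hm using hsupp
  -- The default value `0` is never reached: the exponent `m` has degree one less than `n`, so every
  -- `x.2` in the antidiagonal has smaller degree than `n`.
  obtain ⟨T, hT⟩ := exists_degree_rec (σ := σ) (α := A) fun n ih =>
    if hn : n = 0 then 1 else algebraMap ℚ A (n (s n hn))⁻¹ *
      ∑ x ∈ Finset.HasAntidiagonal.antidiagonal (m n hn), coeff x.1 (g (s n hn)) *
        if h : x.2.degree < n.degree then ih x.2 h else 0
  obtain ⟨U, hcoeff⟩ : ∃ U : MvPowerSeries σ A, ∀ n, coeff n U = T n := ⟨T, fun n => rfl⟩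
  refine ⟨U, ?_, fun n hn => ⟨s n hn, m n hn, hm n hn, ?_⟩⟩
  · rw [← coeff_zero_eq_constantCoeff_apply, hcoeff, hT, dif_pos rfl]
  · have h0 : ((n (s n hn) : ℕ) : ℚ) ≠ 0 := by
      have := DFunLike.congr_fun (hm n hn) (s n hn)
      rw [Finsupp.add_apply, single_eq_same] at this
      rw [this]
      positivity
    rw [hcoeff, hT, dif_neg hn, ← mul_assoc, ← map_natCast (algebraMap ℚ A), ← map_mul,
      mul_inv_cancel₀ h0, map_one, one_mul, coeff_mul]
    refine Finset.sum_congr rfl fun x hx => ?_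
    rw [dif_pos, hcoeff]
    rw [hm n hn, ← Finset.HasAntidiagonal.mem_antidiagonal.1 hx]
    simp only [map_add, degree_single]
    omega

/-- Induction on degree: if the recursion integrated the monomial in a variable `s ≠ r`, then `∂_r
(g_s T) = ∂_s (g_r T)` holds at the needed coefficient, by closedness and the lower-degree
equations, and transfers the equation from `s` to `r`. Only commutativity of the coefficients is
used in this exchange. -/
theorem exists_linear_flow [IsDomain A] [CharZero A] (g : σ → MvPowerSeries σ A)
    (hg : ∀ r s, pderiv A s (g r) = pderiv A r (g s)) :
    ∃ T : MvPowerSeries σ A, constantCoeff T = 1 ∧ ∀ r, pderiv A r T = g r * T := by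
  classical
  obtain ⟨T, hT0, hT⟩ := exists_linear_flow_rec g
  refine ⟨T, hT0, fun r => ?_⟩
  ext n
  rw [coeff_pderiv]
  induction hd : n.degree using Nat.strong_induction_on generalizing n r with
  | _ d ih =>
  subst hd
  obtain ⟨s, m, hm, hs⟩ := hT (n + single r 1) (fun h => by
    have := DFunLike.congr_fun h r
    simp at this)
  by_cases hsr : s = r
  · subst hsr
    rw [← add_right_cancel hm] at hs
    rw [← hs, mul_comm]
    simp
  have hns : n s ≠ 0 := fun h => by
    have := DFunLike.congr_fun hm s
    rw [Finsupp.add_apply, Finsupp.add_apply, single_eq_same, single_eq_of_ne hsr, h] at this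
    omega
  obtain ⟨k, rfl⟩ : ∃ k, n = k + single s 1 := ⟨n - single s 1, (tsub_add_cancel_of_le (by
    rw [Finsupp.single_le_iff]
    exact Nat.one_le_iff_ne_zero.2 hns)).symm⟩
  obtain rfl : m = k + single r 1 := by
    rw [add_right_comm] at hm
    exact (add_right_cancel hm).symm
  have hsub : ∀ (a b : σ), coeff k (g a * pderiv A b T) = coeff k (g a * (g b * T)) := fun a b => by
    rw [coeff_mul, coeff_mul]
    refine Finset.sum_congr rfl fun x hx => ?_
    rw [coeff_pderiv, ih x.2.degree ?_ b x.2 rfl]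
    rw [← Finset.HasAntidiagonal.mem_antidiagonal.1 hx]
    simp only [map_add, degree_single]
    omega
  have hswap : coeff k (pderiv A r (g s * T)) = coeff k (pderiv A s (g r * T)) := by
    rw [Derivation.leibniz, Derivation.leibniz]
    simp only [smul_eq_mul, map_add]
    rw [hsub, hsub, hg s r, mul_left_comm]
  rw [coeff_pderiv, coeff_pderiv] at hswap
  -- Both sides are compared after multiplication by the exponent of `s`, which is nonzero in a
  -- domain of characteristic zero.
  refine mul_left_cancel₀ (Nat.cast_ne_zero.2 hns : (((k + single s 1 : σ →₀ ℕ) s : ℕ) : A) ≠ 0) ?_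
  have e1 : (k + single s 1 + single r 1 : σ →₀ ℕ) s = (k + single s 1 : σ →₀ ℕ) s := by
    rw [Finsupp.add_apply, single_eq_of_ne hsr, add_zero]
  have e2 : (k + single s 1 : σ →₀ ℕ) r = k r := by
    rw [Finsupp.add_apply, single_eq_of_ne (Ne.symm hsr), add_zero]
  have e3 : (((k + single s 1 : σ →₀ ℕ) s : ℕ) : A) = k s + 1 := by
    rw [Finsupp.add_apply, single_eq_same, Nat.cast_add, Nat.cast_one]
  rw [e1] at hs
  rw [← mul_assoc, hs, e2, hswap, e3, mul_comm]

end LinearFlow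

-- Taking `PowerSeries ℂ` as the coefficient ring packs the grading into one extra variable: the
-- convolution over `k` is then an ordinary product, and `exists_linear_flow` applies.
open MvPowerSeries in
theorem exists_graded_flow {σ : Type*} (g : σ → ℕ → MvPowerSeries σ ℂ)
    (hg : ∀ r s k, pderiv ℂ s (g r k) = pderiv ℂ r (g s k)) :
    ∃ T : ℕ → MvPowerSeries σ ℂ, constantCoeff (T 0) = 1 ∧ ∀ r k, pderiv ℂ r (T k) =
      ∑ j ∈ Finset.range (k + 1), g r (k - j) * T j := by
  classical
  have : CharZero (PowerSeries ℂ) := algebraRat.charZero _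
  let G : σ → MvPowerSeries σ (PowerSeries ℂ) := fun r n => PowerSeries.mk fun k => coeff n (g r k)
  have hG : ∀ r n k, PowerSeries.coeff k (coeff n (G r)) = coeff n (g r k) := fun r n k =>
    PowerSeries.coeff_mk k fun k => coeff n (g r k)
  have hnat : ∀ (a : PowerSeries ℂ) (m k : ℕ), PowerSeries.coeff k (a * ((m : PowerSeries ℂ) + 1)) =
      PowerSeries.coeff k a * ((m : ℂ) + 1) := fun a m k => by
    have : ((m : PowerSeries ℂ) + 1) = PowerSeries.C ((m : ℂ) + 1) := by simp
    rw [this, PowerSeries.coeff_mul_C]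
  obtain ⟨T, hT0, hT⟩ := exists_linear_flow G fun r s => by
    ext n k
    rw [coeff_pderiv, coeff_pderiv, hnat, hnat, hG, hG, ← coeff_pderiv, ← coeff_pderiv, hg]
  let T' : ℕ → MvPowerSeries σ ℂ := fun k n => PowerSeries.coeff k (coeff n T)
  have hT' : ∀ n k, coeff n (T' k) = PowerSeries.coeff k (coeff n T) := fun n k => rfl
  refine ⟨T', ?_, fun r k => ?_⟩
  · rw [← coeff_zero_eq_constantCoeff_apply, hT', coeff_zero_eq_constantCoeff_apply, hT0]
    simp
  · ext n
    have := congrArg (fun f => PowerSeries.coeff k (coeff n f)) (hT r)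
    simp only [coeff_pderiv, hnat, coeff_mul, map_sum, PowerSeries.coeff_mul, hG] at this
    rw [coeff_pderiv, hT', this, map_sum, Finset.sum_comm]
    simp only [coeff_mul, ← hT']
    rw [Finset.sum_comm]
    conv_rhs => rw [Finset.sum_comm]
    refine Finset.sum_congr rfl fun x _ => ?_
    rw [← Finset.Nat.sum_antidiagonal_swap, Finset.Nat.sum_antidiagonal_eq_sum_range_succ_mk]
    rfl

/-! ### Correcting a dressing operator so that it obeys the time flows. -/

namespace Frame

open BOp

variable {F : Frame} {A B : BOp}

theorem trans_nat_smul {j : ℤ × ℤ} (h : trans j A = A) (n : ℕ) : trans ((n : ℤ) • j) A = A := by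
  induction n with
  | zero => rw [Nat.cast_zero, zero_smul, zero_trans]
  | succ n ih =>
    rw [Nat.cast_succ, add_smul, one_smul, ← trans_trans, h, ih]

/-- Coefficients invariant under `v` commute with `Λ^v`, so the product is the convolution product
of series over a commutative ring. -/
theorem mul_comm_of_trans_eq_self (hA : F.Ord 0 A) (hB : F.Ord 0 B) (hA' : trans F.v A = A)
    (hB' : trans F.v B = B) : A * B = B * A := by
  refine (hA.mul (k := 0) hB (by norm_num)).ext_nat (hB.mul hA (by norm_num)) fun k => ?_
  rw [coeff_mul hA hB, coeff_mul hB hA, ← Finset.sum_range_reflect]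
  refine Finset.sum_congr rfl fun j hj => ?_
  have hj' : j ≤ k := Nat.lt_succ_iff.1 (Finset.mem_range.1 hj)
  simp only [← coeff_trans, trans_nat_smul hA', trans_nat_smul hB']
  rw [mul_comm]
  congr 3; all_goals congr 2; omega

/-- The vectors `v` and `w` generate the lattice, so invariance under both leaves no dependence on
`m`. -/
theorem coeff_const (hv : trans F.v A = A) (hw : trans F.w A = A) (n m : ℤ × ℤ) :
    A.coeff n m = A.coeff n 0 := by
  have h1 : Function.Periodic (A.coeff n) F.v := fun x => by
    conv_rhs => rw [← hv]
    rfl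
  have h2 : Function.Periodic (A.coeff n) F.w := fun x => by
    conv_rhs => rw [← hw]
    rfl
  have h3 := ((h1.zsmul (F.l m)).add_period (h2.zsmul (F.l' m))) 0
  rwa [zero_add, ← F.decomp m] at h3

/-- The wave operator data of a pair `L = S Λ^{-v} S⁻¹`, `X = S(m + w) S⁻¹` with flows
`∂_r L = [Q_r, L]`, `∂_r X = Q_r(m + w) X - X Q_r`, where `Q_r - S K_r S⁻¹` has order at least
`ε`. -/
structure Flow (F : Frame) (ε : ℤ) (L X S Si : BOp) (Q K : Time → BOp) : Prop where
  ord : F.Ord 0 S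
  ord_inv : F.Ord 0 Si
  mul_inv : S * Si = 1
  inv_mul : Si * S = 1
  isUnit : IsUnit (S.coeff 0)
  lax : L * S = S * lam (-F.v)
  shiftEq : X * S = trans F.w S
  flowL : ∀ r, D r L = Q r * L - L * Q r
  flowX : ∀ r, D r X = trans F.w (Q r) * X - X * Q r
  vac : ∀ r, K r = 0 ∨ ∃ k : ℤ, K r = lam (k • F.v)
  ord_sub : ∀ r, F.Ord ε (Q r - S * K r * Si)
  ord_D : ∀ r, F.Ord ε (D r S)

namespace Flow

variable {ε : ℤ} {L X S Si : BOp} {Q K : Time → BOp}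

theorem D_vac (h : F.Flow ε L X S Si Q K) (r s : Time) : D r (K s) = 0 := by
  rcases h.vac s with h | ⟨k, h⟩ <;> rw [h]
  · exact map_zero _
  · exact D_lam _ _

theorem trans_vac (h : F.Flow ε L X S Si Q K) (j : ℤ × ℤ) (s : Time) : trans j (K s) = K s := by
  rcases h.vac s with h | ⟨k, h⟩ <;> rw [h]
  · exact map_zero _
  · exact trans_lam _ _

theorem vac_commute (h : F.Flow ε L X S Si Q K) (r : Time) (hA : trans F.v A = A) :
    K r * A = A * K r := by
  rcases h.vac r with h | ⟨k, h⟩ <;> rw [h]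
  · rw [mul_zero, zero_mul]
  · refine commute_of_trans_eq_self ?_
    obtain ⟨n, rfl | rfl⟩ := k.eq_nat_or_neg
    · exact trans_nat_smul hA n
    · rw [neg_smul]
      exact trans_neg_eq_self (trans_nat_smul hA n)

/-- The deviation of the flow from the vacuum flow. -/
def dev (S Si : BOp) (Q K : Time → BOp) (r : Time) : BOp := Si * (Q r * S - D r S) - K r

theorem D_wave (h : F.Flow ε L X S Si Q K) (r : Time) :
    D r S = Q r * S - S * (dev S Si Q K r + K r) := by
  rw [dev, sub_add_cancel, ← mul_assoc, h.mul_inv, one_mul, sub_sub_cancel]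

/-- Writing `dev` as `S⁻¹ ((Q - S K S⁻¹) S - ∂S)` exhibits the cancellation of the vacuum term,
after which both summands have order at least `ε`. -/
theorem ord_dev (h : F.Flow ε L X S Si Q K) (r : Time) : F.Ord ε (dev S Si Q K r) := by
  have : dev S Si Q K r = Si * ((Q r - S * K r * Si) * S - D r S) := by
    have e : Si * (S * K r * Si * S) = K r := by
      rw [mul_assoc _ Si, h.inv_mul, mul_one, ← mul_assoc, h.inv_mul, one_mul]
    rw [dev, sub_mul, sub_right_comm, mul_sub _ _ (_ * S), e]
  rw [this]
  exact h.ord_inv.mul (((h.ord_sub r).mul h.ord (add_zero ε).ge).sub (h.ord_D r)) (zero_add ε).ge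

theorem cancel_left (h : F.Flow ε L X S Si Q K) (hAB : S * A = S * B) : A = B := by
  have := congrArg (Si * ·) hAB
  simpa only [← mul_assoc, h.inv_mul, one_mul] using this

/-- Differentiating `L S = S Λ^{-v}` and using the flow of `L` leaves only the commutator of `dev +
K` with `Λ^{-v}`. -/
theorem trans_v_dev (h : F.Flow ε L X S Si Q K) (r : Time) :
    trans F.v (dev S Si Q K r) = dev S Si Q K r := by
  set W := dev S Si Q K r + K r with hW
  have hL := congrArg (D r) h.lax
  rw [D_mul, D_mul, D_lam, mul_zero, add_zero, h.flowL, h.D_wave r, ← hW] at hL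
  have e : S * (lam (-F.v) * W) = S * (W * lam (-F.v)) := by
    have h1 : Q r * L * S = Q r * S * lam (-F.v) := by rw [mul_assoc, h.lax, mul_assoc]
    have h2 : L * (S * W) = S * (lam (-F.v) * W) := by rw [← mul_assoc, h.lax, mul_assoc]
    rw [← h2, ← mul_assoc S W]
    rw [sub_mul, sub_mul, mul_sub, h1, mul_assoc L (Q r) S, sub_add_sub_cancel] at hL
    exact sub_right_injective hL
  have h3 := trans_neg_eq_self (trans_eq_self_of_commute (h.cancel_left e))
  rw [neg_neg, hW, map_add, h.trans_vac] at h3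
  exact add_right_cancel h3

/-- Differentiating `X S = S(m + w)` and using the flow of `X` leaves `S(m + w) W = S(m + w) W(m +
w)` for `W = dev + K`. -/
theorem trans_w_dev (h : F.Flow ε L X S Si Q K) (r : Time) :
    trans F.w (dev S Si Q K r) = dev S Si Q K r := by
  set W := dev S Si Q K r + K r with hW
  have hX := congrArg (D r) h.shiftEq
  rw [D_mul, D_trans, h.flowX, h.D_wave r, ← hW, map_sub, map_mul, map_mul, ← h.shiftEq] at hX
  have e : X * (S * W) = X * (S * trans F.w W) := by
    rw [sub_mul, mul_sub, mul_assoc X (Q r) S, sub_add_sub_cancel, mul_assoc _ X S] at hX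
    rw [sub_right_injective hX, mul_assoc]
  rw [← mul_assoc, ← mul_assoc, h.shiftEq] at e
  have h1 : trans F.w Si * trans F.w S = 1 := by rw [← map_mul, h.inv_mul, map_one]
  have h3 := congrArg (trans F.w Si * ·) e
  simp only [← mul_assoc, h1, one_mul] at h3
  rw [hW, map_add, h.trans_vac] at h3
  exact (add_right_cancel h3).symm

/-- This is the gauge transformation of curvature: `∂_r S = Q_r S - S W_r` with `W_r = dev + K_r`,
and equality of mixed derivatives carries the curvature of `Q` to that of `W`. The latter has no
commutator term since the `W_r` commute, and no contribution from the time-independent `K_r`. -/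
theorem curvature (h : F.Flow ε L X S Si Q K) (hε : 0 ≤ ε) (r s : Time) :
    (D s (Q r) - D r (Q s) + (Q r * Q s - Q s * Q r)) * S =
      S * (D s (dev S Si Q K r) - D r (dev S Si Q K s)) := by
  have hc : (dev S Si Q K s + K s) * (dev S Si Q K r + K r) =
      (dev S Si Q K r + K r) * (dev S Si Q K s + K s) := by
    have h1 := mul_comm_of_trans_eq_self ((h.ord_dev s).mono hε) ((h.ord_dev r).mono hε)
      (h.trans_v_dev s) (h.trans_v_dev r)
    have h2 := h.vac_commute s (h.trans_v_dev r)
    have h3 := h.vac_commute r (h.trans_v_dev s)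
    have h4 := h.vac_commute s (h.trans_vac F.v r)
    rw [add_mul, mul_add, mul_add, h1, h2, ← h3, h4, add_mul, mul_add, mul_add]
    abel
  have hd : ∀ r s, D s (dev S Si Q K r + K r) = D s (dev S Si Q K r) := fun r s => by
    rw [map_add, h.D_vac, add_zero]
  have hrs : ∀ r s, D s (D r S) = D s (Q r) * S + Q r * (Q s * S - S * (dev S Si Q K s + K s)) -
      ((Q s * S - S * (dev S Si Q K s + K s)) * (dev S Si Q K r + K r) +
        S * D s (dev S Si Q K r)) := fun r s => by
    conv_lhs => rw [h.D_wave r, map_sub, D_mul, D_mul, h.D_wave s, hd]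
  have := D_comm s r S
  rw [hrs r s, hrs s r] at this
  have h5 := sub_eq_zero.2 this
  rw [← sub_eq_zero, ← h5]
  simp only [sub_mul, mul_sub, mul_assoc, hc, add_mul]
  abel

/-- This bound is obtained before the curvature is known to vanish; it is what makes the support
argument in `both_projections_eq_zero` possible. -/
theorem ord_curvature (h : F.Flow ε L X S Si Q K) (hε : 0 ≤ ε) (r s : Time) :
    F.Ord ε (D s (Q r) - D r (Q s) + (Q r * Q s - Q s * Q r)) := by
  have := congrArg (· * Si) (h.curvature hε r s)
  simp only [mul_assoc, h.mul_inv, mul_one] at this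
  rw [this]
  have h1 : F.Ord ε (D s (dev S Si Q K r) - D r (dev S Si Q K s)) :=
    ((h.ord_dev r).D s).sub ((h.ord_dev s).D r)
  exact h.ord.mul (h1.mul h.ord_inv (add_zero ε).ge) (zero_add ε).ge

/-- With zero curvature the `dev` form is closed. Its coefficients depend on the times only, so `∂_r
U = dev_r U` has a solution `U` constant in `m`, which commutes with `Λ^v` and keeps both stationary
equations for `S U`. -/
theorem exists_wave (h : F.Flow ε L X S Si Q K) (hε : 0 ≤ ε)
    (hZ : ∀ r s, D s (Q r) - D r (Q s) + (Q r * Q s - Q s * Q r) = 0) :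
    ∃ T Ti, F.Ord 0 T ∧ F.Ord 0 Ti ∧ T * Ti = 1 ∧ Ti * T = 1 ∧ IsUnit (T.coeff 0) ∧
      (1 ≤ ε → S.coeff 0 = 1 → T.coeff 0 = 1) ∧
      L * T = T * lam (-F.v) ∧ X * T = trans F.w T ∧ ∀ r, D r T = Q r * T - T * K r := by
  set N := dev S Si Q K with hN
  have hNord : ∀ r, F.Ord 0 (N r) := fun r => (h.ord_dev r).mono hε
  have hclosed : ∀ r s, D s (N r) = D r (N s) := fun r s => by
    have := h.curvature hε r s
    rw [hZ, zero_mul, ← mul_zero S] at this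
    exact (sub_eq_zero.1 (h.cancel_left this).symm)
  have hconst : ∀ r n m, (N r).coeff n m = (N r).coeff n 0 := fun r n m =>
    coeff_const (h.trans_v_dev r) (h.trans_w_dev r) n m
  obtain ⟨t, ht0, ht⟩ := exists_graded_flow (fun r k => (N r).coeff ((k : ℤ) • F.v) 0)
    fun r s k => congrFun (congrArg (fun A => A.coeff ((k : ℤ) • F.v)) (hclosed r s)) 0
  set U := F.series fun k _ => t k with hU
  have hUord : F.Ord 0 U := ord_series _
  have hUc : ∀ k : ℕ, U.coeff ((k : ℤ) • F.v) = fun _ => t k := coeff_series _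
  have hU0 : U.coeff 0 = fun _ => t 0 := by simpa using hUc 0
  have hUt : ∀ j, trans j U = U := fun j =>
    Ord.ext_nat (Supp.trans hUord j) hUord fun k => by
      rw [coeff_trans, hUc]
      rfl
  have hUD : ∀ r, D r U = N r * U := fun r => by
    refine Ord.ext_nat (Supp.D hUord r) ((hNord r).mul hUord (by norm_num)) fun k => ?_
    rw [coeff_D, coeff_mul (hNord r) hUord, hUc]
    funext m
    change MvPowerSeries.pderiv ℂ r (t k) = _
    rw [ht, Finset.sum_apply]
    refine Finset.sum_congr rfl fun j _ => ?_
    rw [hUc, Pi.mul_apply, hconst r _ m]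
    rfl
  have hT0 : (S * U).coeff 0 = S.coeff 0 * U.coeff 0 := coeff_mul_zero h.ord hUord
  have hTu : IsUnit ((S * U).coeff 0) := by
    rw [hT0, hU0]
    refine h.isUnit.mul (Pi.isUnit_iff.2 fun _ => ?_)
    rw [MvPowerSeries.isUnit_iff_constantCoeff, ht0]
    exact isUnit_one
  have hTord : F.Ord 0 (S * U) := h.ord.mul hUord (by norm_num)
  obtain ⟨Ti, hTi, h1, h2⟩ := exists_inverse hTord hTu
  refine ⟨S * U, Ti, hTord, hTi, h1, h2, hTu, fun h1 hS => ?_, ?_, ?_, fun r => ?_⟩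
  · rw [hT0, hS, one_mul, hU0]
    -- For `ε ≥ 1` the deviation has no order-zero term, so `t 0` is independent of the times and
    -- keeps its initial value.
    have : t 0 = 1 := by
      refine MvPowerSeries.pderiv.ext (fun r => ?_) (by rw [ht0, map_one])
      rw [ht, Derivation.map_one_eq_zero, Finset.sum_range_one, Nat.sub_self, Nat.cast_zero,
        zero_smul, (h.ord_dev r).coeff_eq_zero, Pi.zero_apply, zero_mul]
      rw [map_zero, map_zero]
      omega
    rw [this]
    rfl
  · rw [← mul_assoc, h.lax, mul_assoc, mul_assoc, commute_of_trans_eq_self (hUt _)]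
  · rw [← mul_assoc, h.shiftEq, map_mul, hUt]
  · rw [D_mul, hUD, h.D_wave, ← hN, mul_assoc S U, ← h.vac_commute r (hUt _)]
    simp only [sub_mul, mul_add, add_mul, mul_assoc]
    abel

end Flow

end Frame

/-! ### Uniqueness of decompositions modulo the left ideal of `H`. -/

open BOp

theorem opH_apply (ρ : Coef) (n : ℤ × ℤ) : opH ρ n =
    if n = (1, 1) then 1 else if n = (1, 0) then -1 else if n = 0 then ρ else 0 := by
  have : opH ρ n = (lam (1, 0) * (lam (0, 1) - 1) + func ρ).coeff n := rfl
  rw [this, mul_sub, lam_mul_lam, mul_one, coeff_add, coeff_sub, coeff_lam, coeff_lam, coeff_func]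
  obtain ⟨a, b⟩ := n
  simp only [Prod.mk.injEq, Prod.mk_eq_zero, Prod.mk_add_mk]
  split_ifs <;> first | omega | simp

theorem mul_opH_apply (P : Op) (ρ : Coef) (n : ℤ × ℤ) :
    (P * opH ρ) n = P (n - (1, 1)) - P (n - (1, 0)) + P n * shift n ρ := by
  rw [Op.mul_apply_eq_sum {n - (1, 1), n - (1, 0), n}]
  · obtain ⟨a, b⟩ := n
    rw [Finset.sum_insert, Finset.sum_insert, Finset.sum_singleton, sub_sub_cancel, sub_sub_cancel,
      sub_self, show opH ρ (1, 1) = 1 by rw [opH_apply]; simp,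
      show opH ρ (1, 0) = -1 by rw [opH_apply]; simp, show opH ρ 0 = ρ by rw [opH_apply]; simp [Prod.ext_iff],
      shift_one_coef, shift_neg, shift_one_coef, mul_one, mul_neg, mul_one]
    · abel
    · simp
    · simp
  · intro i _ hi
    rw [opH_apply] at hi
    rw [Finset.mem_insert, Finset.mem_insert, Finset.mem_singleton]
    by_contra! h
    refine hi ?_
    rw [if_neg, if_neg, if_neg]
    · exact fun h' => h.2.2 (by rw [sub_eq_zero.1 h'])
    · exact fun h' => h.2.1 (by rw [← h', sub_sub_cancel])
    · exact fun h' => h.1 (by rw [← h', sub_sub_cancel])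

/-- Zeros propagate from the far right down to `0` and from the far left up to `-1`; no link between
`-1` and `0` is required. -/
theorem eq_zero_of_iff_pred {α : Type*} [Zero α] {f : ℤ → α} (hf : {j | f j ≠ 0}.Finite)
    (h : ∀ j ≠ 0, f (j - 1) = 0 ↔ f j = 0) (j : ℤ) : f j = 0 := by
  obtain ⟨M, hM⟩ := hf.bddAbove
  obtain ⟨N, hN⟩ := hf.bddBelow
  have hM' : ∀ j, M < j → f j = 0 := fun j hj => not_not.1 fun h => not_lt.2 (hM h) hj
  have hN' : ∀ j, j < N → f j = 0 := fun j hj => not_not.1 fun h => not_lt.2 (hN h) hj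
  have hup : ∀ k : ℕ, ∀ j : ℤ, 0 ≤ j → M - j < k → f j = 0 := fun k => by
    induction k with
    | zero => exact fun j _ hj => hM' j (by simpa using hj)
    | succ k ih =>
      intro j hj hk
      have := (h (j + 1) (by omega)).2 (ih (j + 1) (by omega) (by push_cast at hk; omega))
      rwa [add_sub_cancel_right] at this
  have hdown : ∀ k : ℕ, ∀ j : ℤ, j < 0 → j - N < k → f j = 0 := fun k => by
    induction k with
    | zero => exact fun j _ hj => hN' j (by simpa using hj)
    | succ k ih =>
      intro j hj hk
      exact (h j (by omega)).1 (ih (j - 1) (by omega) (by push_cast at hk; omega))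
  rcases le_or_gt 0 j with hj | hj
  · exact hup (M - j + 1).toNat j hj (by omega)
  · exact hdown (j - N + 1).toNat j hj (by omega)

/-- Descending induction on `i`: once row `i + 1` of `P` vanishes, the condition says `P (i, j - 1)
= P (i, j)` for `j ≠ 0`, and the finite row must vanish. The bound `i₀` allows the conclusion for
upper rows only, as `both_projections_eq_zero` needs. -/
theorem rows_eq_zero {P : Op} {ρ : Coef} (hP : InE1 P) {i₀ : ℤ}
    (h : ∀ i, i₀ ≤ i → ∀ j ≠ 0, (P * opH ρ) (i + 1, j) = 0) (i : ℤ) (hi : i₀ ≤ i) (j : ℤ) :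
    P (i, j) = 0 := by
  obtain ⟨hfin, M, hM⟩ := hP
  have key : ∀ k : ℕ, ∀ i, i₀ ≤ i → M - i < k → ∀ j, P (i, j) = 0 := fun k => by
    induction k with
    | zero =>
      intro i _ hi j
      by_contra hn
      have := hM _ hn
      simp only [Nat.cast_zero] at this hi
      omega
    | succ k ih =>
      intro i hi hk
      refine eq_zero_of_iff_pred (hfin i) fun j hj => ?_
      have := h i hi j hj
      rw [mul_opH_apply, ih (i + 1) (by omega) (by push_cast at hk; omega), zero_mul, add_zero,
        Prod.mk_sub_mk, Prod.mk_sub_mk, add_sub_cancel_right, sub_zero] at this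
      rw [sub_eq_zero.1 this]
  exact key (M - i + 1).toNat i hi (by omega) j

/-- Ascending induction on `j`: with column `j - 1` zero, the condition is `P (i - 1, j) = P (i, j)
· shift ρ` for `i ≠ 0`. Invertibility of `ρ` lets zeros propagate both ways. -/
theorem columns_eq_zero {P : Op} {ρ : Coef} (hρ : IsUnit ρ) (hP : InE2 P)
    (h : ∀ i ≠ 0, ∀ j, (P * opH ρ) (i, j) = 0) (i j : ℤ) : P (i, j) = 0 := by
  obtain ⟨hfin, N, hN⟩ := hP
  have key : ∀ k : ℕ, ∀ j, j - N < k → ∀ i, P (i, j) = 0 := fun k => by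
    induction k with
    | zero =>
      intro j hj i
      by_contra hn
      have := hN _ hn
      simp only [Nat.cast_zero] at this hj
      omega
    | succ k ih =>
      intro j hk
      refine eq_zero_of_iff_pred (f := fun i => P (i, j)) (hfin j) fun i hi => ?_
      have := h i hi j
      rw [mul_opH_apply, Prod.mk_sub_mk, Prod.mk_sub_mk, sub_zero,
        ih (j - 1) (by push_cast at hk; omega), zero_sub, neg_add_eq_zero] at this
      rw [this, (isUnit_shift _ hρ).mul_left_eq_zero]
  exact key (j - N + 1).toNat j (by omega) i

theorem mul_opH_sub (P Q : Op) (ρ : Coef) : (P - Q) * opH ρ = P * opH ρ - Q * opH ρ := by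
  refine Op.ext fun n => ?_
  rw [Op.sub_apply, mul_opH_apply, mul_opH_apply, mul_opH_apply, Op.sub_apply, Op.sub_apply,
    Op.sub_apply]
  ring

theorem InE1.sub {P Q : Op} (hP : InE1 P) (hQ : InE1 Q) : InE1 (P - Q) := by
  obtain ⟨h1, M, hM⟩ := hP
  obtain ⟨h2, N, hN⟩ := hQ
  have key : ∀ n, (P - Q) n ≠ 0 → P n ≠ 0 ∨ Q n ≠ 0 := fun n hn => by
    by_contra! h
    exact hn (by rw [Op.sub_apply, h.1, h.2, sub_zero])
  refine ⟨fun i => ((h1 i).union (h2 i)).subset fun j hj => key _ hj, max M N, fun n hn => ?_⟩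
  exact le_max_iff.2 ((key n hn).imp (hM n) (hN n))

theorem InE2.sub {P Q : Op} (hP : InE2 P) (hQ : InE2 Q) : InE2 (P - Q) := by
  obtain ⟨h1, M, hM⟩ := hP
  obtain ⟨h2, N, hN⟩ := hQ
  have key : ∀ n, (P - Q) n ≠ 0 → P n ≠ 0 ∨ Q n ≠ 0 := fun n hn => by
    by_contra! h
    exact hn (by rw [Op.sub_apply, h.1, h.2, sub_zero])
  refine ⟨fun i => ((h1 i).union (h2 i)).subset fun j hj => key _ hj, min M N, fun n hn => ?_⟩
  exact min_le_iff.2 ((key n hn).imp (hM n) (hN n))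

/-- The projection is defined by a choice, so it can be computed only through uniqueness: two
decompositions differ by a multiple of `H` supported on `Λ₂^0`, and `rows_eq_zero` kills its factor.
-/
theorem proj1_eq {ρ : Coef} {A A₀ P : Op} (h₀ : InE1Zero A₀) (hP : InE1 P)
    (h : A = A₀ + P * opH ρ) : proj1 ρ A = A₀ := by
  have hex : ∃ A₀, InE1Zero A₀ ∧ ∃ P, InE1 P ∧ A = A₀ + P * opH ρ := ⟨A₀, h₀, P, hP, h⟩
  rw [proj1, dif_pos hex]
  obtain ⟨h₁, P', hP', h'⟩ := hex.choose_spec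
  set A₁ := hex.choose
  have hsub : A₁ - A₀ = (P - P') * opH ρ := by
    rw [mul_opH_sub, sub_eq_sub_iff_add_eq_add, ← h', h, add_comm]
  have hz : P - P' = 0 := by
    refine Op.ext fun n => rows_eq_zero (ρ := ρ) (hP.sub hP') (i₀ := n.1) ?_ n.1 le_rfl n.2
    intro i _ j hj
    rw [← hsub, Op.sub_apply, not_not.1 fun h => hj (h₀.1 _ h), not_not.1 fun h => hj (h₁.1 _ h),
      sub_zero]
  rw [sub_eq_zero.1 hz] at h
  rw [h] at h'
  exact (add_right_cancel h').symm

theorem proj2_eq {ρ : Coef} (hρ : IsUnit ρ) {A A₀ P : Op} (h₀ : InE2Zero A₀) (hP : InE2 P)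
    (h : A = A₀ + P * opH ρ) : proj2 ρ A = A₀ := by
  have hex : ∃ A₀, InE2Zero A₀ ∧ ∃ P, InE2 P ∧ A = A₀ + P * opH ρ := ⟨A₀, h₀, P, hP, h⟩
  rw [proj2, dif_pos hex]
  obtain ⟨h₁, P', hP', h'⟩ := hex.choose_spec
  set A₁ := hex.choose
  have hsub : A₁ - A₀ = (P - P') * opH ρ := by
    rw [mul_opH_sub, sub_eq_sub_iff_add_eq_add, ← h', h, add_comm]
  have hz : P - P' = 0 := by
    refine Op.ext fun n => columns_eq_zero (ρ := ρ) hρ (hP.sub hP') ?_ n.1 n.2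
    intro i hi j
    rw [← hsub, Op.sub_apply, not_not.1 fun h => hi (h₀.1 _ h), not_not.1 fun h => hi (h₁.1 _ h),
      sub_zero]
  rw [sub_eq_zero.1 hz] at h
  rw [h] at h'
  exact (add_right_cancel h').symm

/-! ### Supports modulo `H` and the vanishing of both projections. -/

namespace BOp

/-- `H` as a bounded operator. -/
def H (ρ : Coef) : BOp := lam (1, 0) * (lam (0, 1) - 1) + func ρ

theorem coeff_mul_H (P : BOp) (ρ : Coef) (n : ℤ × ℤ) : (P * H ρ).coeff n =
    P.coeff (n - (1, 1)) - P.coeff (n - (1, 0)) + P.coeff n * shift n ρ :=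
  mul_opH_apply P.1 ρ n

theorem supp_H (ρ : Coef) : Supp (fun n => 0 ≤ n.1 ∧ n.1 ≤ 1 ∧ 0 ≤ n.2 ∧ n.2 ≤ 1) (H ρ) := by
  intro n hn
  have h : opH ρ n ≠ 0 := hn
  rw [opH_apply] at h
  by_contra hc
  refine h ?_
  rw [if_neg, if_neg, if_neg] <;> (rintro rfl; simp at hc)

theorem Supp.inE1 {P : BOp} {N : ℤ} (hP : Supp (fun n => n.2 ≤ N) P) : InE1 P.1 := by
  obtain ⟨M, N', h⟩ := P.2
  exact ⟨fun i => (Set.finite_Icc N' N).subset fun j hj => ⟨(h _ hj).2, hP _ hj⟩, M,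
    fun n hn => (h n hn).1⟩

theorem Supp.inE2 {P : BOp} {M : ℤ} (hP : Supp (fun n => M ≤ n.1) P) : InE2 P.1 := by
  obtain ⟨M', N, h⟩ := P.2
  exact ⟨fun i => (Set.finite_Icc M M').subset fun j hj => ⟨hP _ hj, (h _ hj).1⟩, N,
    fun n hn => (h n hn).2⟩

theorem Supp.inE1Zero {A : BOp} (hA : Supp (fun n => n.2 = 0) A) : InE1Zero A.1 := by
  obtain ⟨M, N, h⟩ := A.2
  exact ⟨hA, M, fun n hn => (h n hn).1⟩

theorem Supp.inE2Zero {A : BOp} (hA : Supp (fun n => n.1 = 0) A) : InE2Zero A.1 := by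
  obtain ⟨M, N, h⟩ := A.2
  exact ⟨hA, N, fun n hn => (h n hn).2⟩

theorem eq_zero_of_eq_mul_H₁ {ρ : Coef} {A P : BOp} {N : ℤ} (hA : Supp (fun n => n.2 = 0) A)
    (hP : Supp (fun n => n.2 ≤ N) P) (h : A = P * H ρ) : A = 0 := by
  have hz : P = 0 := by
    refine ext_coeff fun n => rows_eq_zero (ρ := ρ) hP.inE1 (i₀ := n.1) ?_ n.1 le_rfl n.2
    intro i _ j hj
    have : (P * H ρ).coeff (i + 1, j) = 0 := by
      rw [← h]
      exact hA.coeff_eq_zero hj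
    exact this
  rw [h, hz, zero_mul]

theorem eq_zero_of_eq_mul_H₂ {ρ : Coef} (hρ : IsUnit ρ) {A P : BOp} {M : ℤ}
    (hA : Supp (fun n => n.1 = 0) A) (hP : Supp (fun n => M ≤ n.1) P) (h : A = P * H ρ) :
    A = 0 := by
  have hz : P = 0 := by
    refine ext_coeff fun n => columns_eq_zero (ρ := ρ) hρ hP.inE2 ?_ n.1 n.2
    intro i hi j
    have : (P * H ρ).coeff (i, j) = 0 := by
      rw [← h]
      exact hA.coeff_eq_zero hi
    exact this
  rw [h, hz, zero_mul]

/-- Subtracting a multiple of `H` reduces `E` to `X`, supported on two half-axes. Comparison with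
`A₁` removes the `Λ₁` axis beyond the origin, comparison with `A₂` removes the `Λ₂` axis, and the
remaining coefficient at the origin is a difference of neighbours in a finite row which is forced to
be zero. -/
theorem both_projections_eq_zero {ρ : Coef} (hρ : IsUnit ρ) {Hi E A₁ A₂ P₁ P₂ : BOp} {N M : ℤ}
    (hHi : Hi * H ρ = 1)
    (hE : Supp (fun n => 0 ≤ n.1 ∧ n.2 ≤ 0) E)
    (hA₁ : Supp (fun n => n.2 = 0 ∧ n.1 ≤ -1) A₁) (hA₂ : Supp (fun n => n.1 = 0 ∧ 0 ≤ n.2) A₂)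
    (hP₁ : Supp (fun n => n.2 ≤ N) P₁) (hP₂ : Supp (fun n => M ≤ n.1) P₂)
    (h₁ : E = A₁ + P₁ * H ρ) (h₂ : E = A₂ + P₂ * H ρ) : A₁ = 0 ∧ A₂ = 0 := by
  set V := E * Hi with hV
  have hVH : V * H ρ = E := by rw [hV, mul_assoc, hHi, mul_one]
  -- Multiplication by `H` moves exponents by at most one in each direction. Removing this quadrant
  -- of `E H⁻¹` therefore clears `X` where `i ≥ 1` and `j ≤ -1` without leaving the quadrant of `E`.
  set P := restrict (fun n => 0 ≤ n.1 ∧ n.2 ≤ -1) V with hP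
  have hPs : Supp (fun n => 0 ≤ n.1 ∧ n.2 ≤ -1) P := restrict_supp _ _
  set X := E - P * H ρ with hX
  have hXV : X = (V - P) * H ρ := by rw [sub_mul, hVH]
  have hXs : Supp (fun n => 0 ≤ n.1 ∧ n.2 ≤ 0) X :=
    hE.sub (hPs.mul (supp_H ρ) fun a b ha hb => by
      simp only [Prod.fst_add, Prod.snd_add]; omega)
  have hXq : ∀ i j : ℤ, 1 ≤ i → j ≤ -1 → X.coeff (i, j) = 0 := fun i j hi hj => by
    have hz : ∀ i j : ℤ, 0 ≤ i → j ≤ -1 → (V - P).coeff (i, j) = 0 := fun i j hi hj =>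
      (sub_restrict_supp (fun n : ℤ × ℤ => 0 ≤ n.1 ∧ n.2 ≤ -1) V).coeff_eq_zero
        (not_not.2 ⟨hi, hj⟩)
    rw [hXV, coeff_mul_H, Prod.mk_sub_mk, Prod.mk_sub_mk, hz _ _ (by omega) (by omega),
      hz _ _ (by omega) (by omega), hz _ _ (by omega) (by omega), zero_mul, sub_zero, add_zero]
  set J := P₁ - P with hJ
  have hJs : Supp (fun n => n.2 ≤ max N (-1)) J :=
    (hP₁.mono fun _ h => le_max_of_le_left h).sub (hPs.mono fun _ h => le_max_of_le_right h.2)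
  have hXJ : X = A₁ + J * H ρ := by rw [hX, hJ, h₁, sub_mul]; abel
  -- In rows `i ≥ 1` the operator `A₁` is absent and `X` lives at `j = 0`, so the off-axis
  -- coefficients of `J H` vanish there.
  have hJ0 : ∀ i : ℤ, 0 ≤ i → ∀ j, J.coeff (i, j) = 0 := by
    refine rows_eq_zero (ρ := ρ) hJs.inE1 fun i hi j hj => ?_
    have e : (J * H ρ).coeff (i + 1, j) = X.coeff (i + 1, j) - A₁.coeff (i + 1, j) := by
      rw [hXJ, coeff_add, add_sub_cancel_left]
    refine Eq.trans e ?_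
    rw [hA₁.coeff_eq_zero (by simp only; omega), sub_zero]
    rcases lt_or_gt_of_ne hj with h | h
    · exact hXq _ _ (by omega) (by omega)
    · exact hXs.coeff_eq_zero (by simp only; omega)
  have hX1 : Supp (fun n => n.1 = 0) X := by
    rintro ⟨i, j⟩ hn
    by_contra h
    have := (hXs _ hn).1
    simp only at h this
    refine hn ?_
    rw [hXJ, coeff_add, coeff_mul_H, Prod.mk_sub_mk, Prod.mk_sub_mk, hJ0 _ (by omega),
      hJ0 _ (by omega), hJ0 _ (by omega), hA₁.coeff_eq_zero (by simp only; omega), zero_mul,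
      sub_zero, add_zero, add_zero]
  have hXA : X - A₂ = 0 := by
    refine eq_zero_of_eq_mul_H₂ (P := P₂ - P) (ρ := ρ) (M := min M 0) hρ
      (hX1.sub (hA₂.mono fun _ h => h.1)) ?_ ?_
    · exact (hP₂.mono fun _ h => min_le_of_left_le h).sub
        (hPs.mono fun _ h => min_le_of_right_le h.1)
    · rw [hX, sub_mul, h₂]; abel
  have hX0 : ∀ j ≠ 0, X.coeff (0, j) = 0 := fun j hj => by
    rcases lt_or_gt_of_ne hj with h | h
    · rw [sub_eq_zero.1 hXA]
      exact hA₂.coeff_eq_zero (by simp only; omega)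
    · exact hXs.coeff_eq_zero (by simp only; omega)
  have hXrow : ∀ j, X.coeff (0, j) = J.coeff (-1, j - 1) - J.coeff (-1, j) := fun j => by
    rw [hXJ, coeff_add, coeff_mul_H, Prod.mk_sub_mk, Prod.mk_sub_mk, hJ0 0 le_rfl,
      hA₁.coeff_eq_zero (by simp only; omega), zero_mul, zero_add, add_zero, zero_sub, sub_zero]
  -- Only the coefficient at the origin remains in `X`, so row `-1` of `J` is constant on either
  -- side of the gap between `-1` and `0`, hence zero by finiteness.
  have hJrow : ∀ j, J.coeff (-1, j) = 0 := by
    refine eq_zero_of_iff_pred (hJs.inE1.1 (-1)) fun j hj => ?_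
    rw [sub_eq_zero.1 ((hXrow j).symm.trans (hX0 j hj))]
  have hXz : X = 0 := by
    refine ext_coeff fun n => ?_
    by_cases hn : n.1 = 0
    · rw [show n = (0, n.2) from Prod.ext hn rfl, hXrow, hJrow, hJrow, sub_zero, coeff_zero]
    · exact hX1.coeff_eq_zero hn
  rw [hXz, zero_sub, neg_eq_zero] at hXA
  refine ⟨?_, hXA⟩
  refine eq_zero_of_eq_mul_H₁ (P := -J) (ρ := ρ) (N := max N (-1)) (hA₁.mono fun _ h => h.1)
    hJs.neg ?_
  rw [hXz] at hXJ
  rw [neg_mul]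
  exact eq_neg_of_add_eq_zero_left hXJ.symm

theorem coe_pow (A : BOp) (k : ℕ) : ((A ^ k : BOp) : Op) = A.1 ^ k := by
  induction k with
  | zero => rfl
  | succ k ih =>
    rw [pow_succ, coe_mul, ih]
    rfl

theorem coeff_sum {ι : Type*} (s : Finset ι) (A : ι → BOp) (n : ℤ × ℤ) :
    (∑ i ∈ s, A i).coeff n = ∑ i ∈ s, (A i).coeff n := by
  classical
  induction s using Finset.induction_on with
  | empty => rfl
  | insert a s ha ih => rw [Finset.sum_insert ha, Finset.sum_insert ha, coeff_add, ih]

theorem func_sum {ι : Type*} (s : Finset ι) (f : ι → Coef) :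
    func (∑ i ∈ s, f i) = ∑ i ∈ s, func (f i) := by
  refine ext_coeff fun n => ?_
  simp only [coeff_sum, coeff_func]
  split_ifs <;> simp

theorem Supp.sum {ι : Type*} {p : ℤ × ℤ → Prop} {s : Finset ι} {A : ι → BOp}
    (h : ∀ i ∈ s, Supp p (A i)) : Supp p (∑ i ∈ s, A i) := fun n hn => by
  rw [coeff_sum] at hn
  obtain ⟨i, hi, hi'⟩ := Finset.exists_ne_zero_of_sum_ne_zero hn
  exact h i hi n hi'

theorem coe_restrict_nonneg (A : BOp) : (restrict (fun n => 0 ≤ n.1) A).1 = nonneg1 A.1 :=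
  Op.ext fun n => by
    by_cases h : 0 ≤ n.1
    · exact (if_pos h).trans (if_pos h).symm
    · exact (if_neg h).trans (if_neg h).symm

theorem coe_restrict_zero₁ (A : BOp) : (restrict (fun n => n.1 = 0) A).1 = zeroPart1 A.1 :=
  Op.ext fun n => by
    by_cases h : n.1 = 0
    · exact (if_pos h).trans (if_pos h).symm
    · exact (if_neg h).trans (if_neg h).symm

theorem coe_restrict_zero₂ (A : BOp) : (restrict (fun n => n.2 = 0) A).1 = zeroPart2 A.1 :=
  Op.ext fun n => by
    by_cases h : n.2 = 0
    · exact (if_pos h).trans (if_pos h).symm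
    · exact (if_neg h).trans (if_neg h).symm

/-- `Δ₂^{*-1}` as a bounded operator. -/
def dsInv : BOp := ⟨Delta2StarInv, 0, 0, fun n hn => by
  have : n.1 = 0 ∧ 1 ≤ n.2 := not_not.1 fun h => hn (if_neg h)
  omega⟩

theorem coeff_dsInv (n : ℤ × ℤ) : dsInv.coeff n = if n.1 = 0 ∧ 1 ≤ n.2 then 1 else 0 := rfl

theorem supp_dsInv : Supp (fun n => n.1 = 0 ∧ 1 ≤ n.2) dsInv := fun _ hn =>
  not_not.1 fun h => hn (if_neg h)

theorem trans_dsInv (j : ℤ × ℤ) : trans j dsInv = dsInv := by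
  refine ext_coeff fun n => ?_
  rw [coeff_trans, coeff_dsInv]
  split_ifs <;> rfl

theorem dsInv_mul : dsInv * (lam (0, -1) - 1) = 1 := by
  refine ext_coeff fun ⟨a, b⟩ => ?_
  rw [mul_sub, mul_one, coeff_sub, coeff_mul_lam, coeff_dsInv, coeff_dsInv, coeff_one]
  simp only [Prod.mk_sub_mk, Prod.mk_eq_zero]
  split_ifs <;> first | omega | simp

theorem mul_dsInv : (lam (0, -1) - 1) * dsInv = 1 := by
  have h := dsInv_mul
  rw [mul_sub, mul_one] at h
  rw [sub_mul, lam_mul, trans_dsInv, one_mul, h]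

/-- `Δ₁⁻¹` as a bounded operator. -/
def d1Inv : BOp := ⟨Delta1Inv, 0, 0, fun n hn => by
  have : n.2 = 0 ∧ n.1 ≤ -1 := not_not.1 fun h => hn (if_neg h)
  omega⟩

theorem coeff_d1Inv (n : ℤ × ℤ) : d1Inv.coeff n = if n.2 = 0 ∧ n.1 ≤ -1 then 1 else 0 := rfl

theorem d1Inv_mul : d1Inv * (lam (1, 0) - 1) = 1 := by
  refine ext_coeff fun ⟨a, b⟩ => ?_
  rw [mul_sub, mul_one, coeff_sub, coeff_mul_lam, coeff_d1Inv, coeff_d1Inv, coeff_one]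
  simp only [Prod.mk_sub_mk, Prod.mk_eq_zero]
  split_ifs <;> first | omega | simp

/-! ### The projections expressed through the inverse of `H`. -/

section Projection

variable {ρ : Coef} {B B' Hi : BOp}

/-- Split `V = B H⁻¹` by the sign of the `Λ₁` exponent. The remainder `(V - P) H` equals `B - P H`;
these two forms bound its `Λ₁` exponents from above and below by `0`, so only row `-1` of `V`
contributes, as a difference in `Λ₂`. -/
theorem exists_proj2 (hHi : Hi * H ρ = 1) (hHs : Supp (fun n => n.1 ≤ -1 ∧ 0 ≤ n.2) Hi)
    (hB : Supp (fun n => 0 ≤ n.1 ∧ n.2 = 0) B) :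
    ∃ A P, B = A + P * H ρ ∧ Supp (fun n => n.1 = 0 ∧ 0 ≤ n.2) A ∧ Supp (fun n => 0 ≤ n.1) P ∧
      A = restrict (fun n => n.1 = 0) (-(B * Hi * lam (1, 1))) * (lam (0, -1) - 1) := by
  set V := B * Hi with hV
  set P := restrict (fun n => 0 ≤ n.1) V with hP
  have hVs : Supp (fun n => 0 ≤ n.2) V := hB.mul hHs fun a b ha hb => by
    simp only [Prod.snd_add]; omega
  have hPs : Supp (fun n => 0 ≤ n.1) P := restrict_supp _ _
  have hPV : Supp (fun n => 0 ≤ n.2) P := hVs.restrict _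
  have hN : Supp (fun n => ¬ 0 ≤ n.1) (V - P) := sub_restrict_supp _ _
  have hA : (V - P) * H ρ = B - P * H ρ := by rw [sub_mul, hV, mul_assoc, hHi, mul_one]
  have h1 : Supp (fun n => n.1 ≤ 0) ((V - P) * H ρ) :=
    hN.mul (supp_H ρ) fun a b ha hb => by simp only [Prod.fst_add]; omega
  have h2 : Supp (fun n => 0 ≤ n.1) ((V - P) * H ρ) := by
    rw [hA]
    exact (hB.mono fun _ h => h.1).sub (hPs.mul (supp_H ρ) fun a b ha hb => by
      simp only [Prod.fst_add]; omega)
  have h3 : Supp (fun n => 0 ≤ n.2) ((V - P) * H ρ) :=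
    (hVs.sub hPV).mul (supp_H ρ) fun a b ha hb => by simp only [Prod.snd_add]; omega
  have h4 : Supp (fun n => n.1 = 0 ∧ 0 ≤ n.2) ((V - P) * H ρ) := fun n hn =>
    ⟨le_antisymm (h1 n hn) (h2 n hn), h3 n hn⟩
  refine ⟨(V - P) * H ρ, P, by rw [hA, sub_add_cancel], h4, hPs, ext_coeff fun ⟨i, j⟩ => ?_⟩
  rw [mul_sub, mul_one, coeff_sub, coeff_mul_lam]
  by_cases hi : i = 0
  · subst hi
    rw [coeff_mul_H]
    simp only [Prod.mk_sub_mk]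
    rw [coeff_restrict_of _ (by norm_num), coeff_restrict_of _ (by norm_num), coeff_neg, coeff_neg,
      coeff_mul_lam, coeff_mul_lam, hN.coeff_eq_zero (n := (0, j)) (by simp), zero_mul, coeff_sub,
      coeff_sub, hPs.coeff_eq_zero (by norm_num), hPs.coeff_eq_zero (by norm_num)]
    simp only [Prod.mk_sub_mk]
    rw [show j - -1 - 1 = j by ring]
    simp only [sub_zero, add_zero]
    abel
  · rw [h4.coeff_eq_zero (fun h => hi h.1), coeff_restrict_of_not, coeff_restrict_of_not, sub_zero]
    · exact hi
    · simpa using hi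

/-- Now `V = B H⁻¹` is split by the `Λ₂` exponent. The right factor `Δ₂^*` of `B` is what puts the
projection in strictly negative powers of `Λ₁`. -/
theorem exists_proj1 (hHi : Hi * H ρ = 1) (hHs : Supp (fun n => n.1 ≤ -1 ∧ 0 ≤ n.2) Hi)
    (hB : B = B' * (lam (0, -1) - 1)) (hB' : Supp (fun n => n.1 = 0 ∧ n.2 ≤ 0) B') :
    ∃ A P, B = A + P * H ρ ∧ Supp (fun n => n.2 = 0 ∧ n.1 ≤ -1) A ∧ Supp (fun n => n.2 ≤ -1) P ∧
      A = restrict (fun n => n.2 = 0) (-(B * Hi * func ρ * dsInv)) := by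
  set V := B * Hi with hV
  have hBs : Supp (fun n => n.1 = 0 ∧ n.2 ≤ 0) B := by
    rw [hB]
    refine hB'.mul (q := fun n => n.1 = 0 ∧ n.2 ≤ 0) (Supp.sub (Supp.lam ?_) (Supp.one ?_))
      fun a b ha hb => ?_
    · simp
    · simp
    · simp only [Prod.fst_add, Prod.snd_add]; omega
  have hVs : Supp (fun n => n.1 ≤ -1) V := hBs.mul hHs fun a b ha hb => by
    simp only [Prod.fst_add]; omega
  set P := restrict (fun n => n.2 ≤ -1) V with hP
  have hPs : Supp (fun n => n.2 ≤ -1) P := restrict_supp _ _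
  have hPV : Supp (fun n => n.1 ≤ -1) P := hVs.restrict _
  have hN : Supp (fun n => ¬ n.2 ≤ -1) (V - P) := sub_restrict_supp _ _
  have hVH : V * H ρ = B := by rw [hV, mul_assoc, hHi, mul_one]
  have hA : (V - P) * H ρ = B - P * H ρ := by rw [sub_mul, hVH]
  have hBc : ∀ n, B.coeff n = B'.coeff (n - (0, -1)) - B'.coeff n := fun n => by
    rw [hB, mul_sub, mul_one, coeff_sub, coeff_mul_lam]
  have h1 : Supp (fun n => 0 ≤ n.2) ((V - P) * H ρ) :=
    hN.mul (supp_H ρ) fun a b ha hb => by simp only [Prod.snd_add]; omega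
  have h2 : Supp (fun n => n.2 ≤ 0) ((V - P) * H ρ) := by
    rw [hA]
    exact (hBs.mono fun _ h => h.2).sub (hPs.mul (supp_H ρ) fun a b ha hb => by
      simp only [Prod.snd_add]; omega)
  have h3 : Supp (fun n => n.1 ≤ 0) ((V - P) * H ρ) :=
    (hVs.sub hPV).mul (supp_H ρ) fun a b ha hb => by simp only [Prod.fst_add]; omega
  -- Reading `V H = B' Δ₂^*` in row `0` shows that `V (-1, j) + B' (0, j + 1)` is independent of
  -- `j`. It vanishes for `j` very negative, hence also at `j = 0`, where `B' (0, 1) = 0`.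
  have hrow : V.coeff (-1, 0) = 0 := by
    obtain ⟨_, N, hVN⟩ := V.2
    obtain ⟨_, N', hBN⟩ := B'.2
    have hc : ∀ j : ℤ, V.coeff (-1, j) + B'.coeff (0, j + 1) =
        V.coeff (-1, j - 1) + B'.coeff (0, j) := fun j => by
      have := hBc (0, j)
      rw [← hVH, coeff_mul_H, hVs.coeff_eq_zero (n := (0, j)) (by simp), zero_mul, add_zero] at this
      simp only [Prod.mk_sub_mk, zero_sub, sub_zero, sub_neg_eq_add] at this
      rw [sub_eq_sub_iff_add_eq_add, add_comm] at this
      rw [add_comm, ← this, add_comm]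
    have hk : ∀ k : ℕ, ∀ j : ℤ, j < min N (N' - 1) + k →
        V.coeff (-1, j) + B'.coeff (0, j + 1) = 0 := fun k => by
      induction k with
      | zero =>
        intro j hj
        have e1 : V.coeff (-1, j) = 0 := by
          by_contra h
          have := (hVN _ h).2
          simp only at this
          omega
        have e2 : B'.coeff (0, j + 1) = 0 := by
          by_contra h
          have := (hBN _ h).2
          simp only at this
          omega
        rw [e1, e2, add_zero]
      | succ k ih =>
        intro j hj
        have := ih (j - 1) (by push_cast at hj; omega)
        rw [hc, ← this, sub_add_cancel]
    have := hk (1 - min N (N' - 1)).toNat 0 (by omega)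
    rwa [hB'.coeff_eq_zero (n := (0, 0 + 1)) (by simp), add_zero] at this
  have h4 : Supp (fun n => n.2 = 0 ∧ n.1 ≤ -1) ((V - P) * H ρ) := by
    rintro ⟨i, j⟩ hn
    have e1 := h1 _ hn
    have e2 := h2 _ hn
    have e3 := h3 _ hn
    simp only at e1 e2 e3 ⊢
    obtain rfl : j = 0 := by omega
    refine ⟨rfl, ?_⟩
    by_contra hi
    obtain rfl : i = 0 := by omega
    refine hn ?_
    rw [coeff_mul_H]
    simp only [Prod.mk_sub_mk]
    rw [hN.coeff_eq_zero (by simp), coeff_sub, coeff_sub, hVs.coeff_eq_zero (n := (0, 0)) (by simp),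
      hPV.coeff_eq_zero (n := (0, 0)) (by simp), hPs.coeff_eq_zero (by simp)]
    simp [hrow]
  -- Substituting `ρ = H - Λ₁ Δ₂` and `Δ₂ Δ₂^{*-1} = -Λ₂` turns the claimed formula into
  -- coefficients of `B'` and `V` alone.
  have h5 : V * func ρ * dsInv = B' + V * lam (1, 1) := by
    have e1 : func ρ = H ρ - lam (1, 0) * (lam (0, 1) - 1) := by rw [H, add_sub_cancel_left]
    have e2 : lam (0, 1) - 1 = -(lam (0, 1) * (lam (0, -1) - 1)) := by
      rw [mul_sub, lam_mul_lam, mul_one]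
      simp [lam_zero, show ((0 : ℤ), (0 : ℤ)) = 0 from rfl]
    have e3 : (lam (0, 1) - 1) * dsInv = -lam (0, 1) := by
      rw [e2, neg_mul, mul_assoc, mul_dsInv, mul_one]
    have e4 : B * dsInv = B' := by rw [hB, mul_assoc, mul_dsInv, mul_one]
    rw [e1, mul_sub, hVH, sub_mul, e4, mul_assoc V, mul_assoc (lam (1, 0)), e3, mul_neg, mul_neg,
      sub_neg_eq_add, lam_mul_lam]
    rfl
  refine ⟨(V - P) * H ρ, P, by rw [hA, sub_add_cancel], h4, hPs, ext_coeff fun ⟨i, j⟩ => ?_⟩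
  by_cases hj : j = 0
  · subst hj
    rw [coeff_restrict_of (p := fun n : ℤ × ℤ => n.2 = 0) _ rfl, h5, coeff_neg, coeff_add, coeff_mul_lam, hA, coeff_sub, hBc,
      coeff_mul_H]
    simp only [Prod.mk_sub_mk]
    rw [hPs.coeff_eq_zero (n := (i - 1, 0 - 0)) (by simp),
      hPs.coeff_eq_zero (n := (i, 0)) (by simp), coeff_restrict_of _ (by simp),
      hB'.coeff_eq_zero (n := (i - 0, 0 - -1)) (by simp)]
    simp only [zero_mul, sub_zero, add_zero, zero_sub]
    abel
  · rw [h4.coeff_eq_zero (fun h => hj h.1), coeff_restrict_of_not _ hj]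

end Projection

/-! ### Re-expansion in powers of `Δ₂^*`. -/

section DeltaExpansion

variable {A : BOp} {k : ℕ}

theorem dstarCoeff_eq_sum (hA : Supp (fun n => n.1 = 0 ∧ -(k : ℤ) ≤ n.2) A) (p : ℕ) :
    dstarCoeff A.1 p = ∑ i ∈ Finset.range (k + 1), (i.choose p : Coef) * A.coeff (0, -(i : ℤ)) := by
  refine finsum_eq_sum_of_support_subset _ fun i hi => ?_
  rw [Finset.coe_range, Set.mem_Iio]
  by_contra h
  refine hi ?_
  have : A.coeff (0, -(i : ℤ)) = 0 := hA.coeff_eq_zero (by simp only; omega)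
  exact (congrArg _ this).trans (mul_zero _)

theorem dstarPos_eq (hA : Supp (fun n => n.1 = 0 ∧ -(k : ℤ) ≤ n.2) A) :
    dstarPos A.1 = (∑ p ∈ Finset.range k,
      func (dstarCoeff A.1 (p + 1)) * (lam (0, -1) - 1) ^ (p + 1) : BOp).1 := by
  refine Op.ext fun n => ?_
  refine Eq.trans ?_ (coeff_sum (Finset.range k)
    (fun p => func (dstarCoeff A.1 (p + 1)) * (lam (0, -1) - 1) ^ (p + 1)) n).symm
  simp only [coeff_func_mul]
  have hD : ∀ p, ((lam (0, -1) - 1 : BOp) ^ p).coeff n = (Delta2Star ^ p) n := fun p =>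
    congrFun (coe_pow (lam (0, -1) - 1) p) n
  simp only [hD]
  refine finsum_eq_sum_of_support_subset _ fun p hp => ?_
  rw [Finset.coe_range, Set.mem_Iio]
  by_contra h
  refine hp ?_
  have : dstarCoeff A.1 (p + 1) = 0 := by
    rw [dstarCoeff_eq_sum hA]
    refine Finset.sum_eq_zero fun i hi => ?_
    rw [Nat.choose_eq_zero_of_lt, Nat.cast_zero, zero_mul]
    rw [Finset.mem_range] at hi
    omega
  change dstarCoeff A.1 (p + 1) * (Delta2Star ^ (p + 1)) n = 0
  rw [this, zero_mul]

/-- Two features of the truncation are used later: it is right-divisible by `Δ₂^*`, and it differs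
from `A` only in nonnegative powers of `Λ₂`. The second holds because the binomial expansion
recovers the negative powers exactly, and the dropped term `p = 0` is a function. -/
theorem exists_dstarPos (hA : Supp (fun n => n.1 = 0 ∧ -(k : ℤ) ≤ n.2) A) :
    ∃ B B' : BOp, B.1 = dstarPos A.1 ∧ B = B' * (lam (0, -1) - 1) ∧
      Supp (fun n => n.1 = 0 ∧ n.2 ≤ 0) B' ∧ Supp (fun n => n.1 = 0 ∧ 0 ≤ n.2) (B - A) := by
  set δ : BOp := lam (0, -1) - 1 with hδ
  have hδs : Supp (fun n => n.1 = 0 ∧ n.2 ≤ 0) δ :=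
    Supp.sub (Supp.lam (by simp)) (Supp.one (by simp))
  set c : ℕ → BOp := fun p => func (dstarCoeff A.1 p) with hc
  have hlam : ∀ i ∈ Finset.range (k + 1), lam (0, -(i : ℤ)) =
      ∑ p ∈ Finset.range (k + 1), func (i.choose p : Coef) * δ ^ p := fun i hi => by
    have h1 : lam (0, -(i : ℤ)) = (δ + 1) ^ i := by
      rw [hδ, sub_add_cancel, lam_pow]
      congr 1
      simp
    rw [h1, (Commute.one_right δ).add_pow]
    refine Eq.trans ?_ (Finset.sum_subset (s₁ := Finset.range (i + 1)) ?_ ?_)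
    · refine Finset.sum_congr rfl fun p _ => ?_
      rw [one_pow, mul_one, (Nat.cast_commute (i.choose p) (δ ^ p)).eq.symm]
      congr 1
      generalize i.choose p = m
      induction m with
      | zero => exact ext_coeff fun n => by rw [coeff_func]; simp
      | succ m ih =>
        rw [Nat.cast_succ, ih, Nat.cast_succ, ← func_one]
        exact ext_coeff fun n => by
          rw [coeff_add, coeff_func, coeff_func, coeff_func]
          split_ifs <;> simp
    · intro p hp
      rw [Finset.mem_range] at *
      omega
    · intro p _ hp
      rw [Finset.mem_range] at hp
      rw [Nat.choose_eq_zero_of_lt (by omega), Nat.cast_zero]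
      refine ext_coeff fun n => ?_
      rw [coeff_func_mul, zero_mul, coeff_zero]
  have hsum : ∑ p ∈ Finset.range (k + 1), c p * δ ^ p =
      ∑ i ∈ Finset.range (k + 1), func (A.coeff (0, -(i : ℤ))) * lam (0, -(i : ℤ)) := by
    rw [Finset.sum_congr rfl fun i hi => congrArg _ (hlam i hi)]
    simp only [Finset.mul_sum]
    rw [Finset.sum_comm]
    refine Finset.sum_congr rfl fun p _ => ?_
    rw [hc]
    simp only [dstarCoeff_eq_sum hA, func_sum, Finset.sum_mul]
    refine Finset.sum_congr rfl fun i _ => ?_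
    rw [← mul_assoc, func_mul_func, mul_comm (i.choose p : Coef)]
  refine ⟨∑ p ∈ Finset.range k, c (p + 1) * δ ^ (p + 1), ∑ p ∈ Finset.range k, c (p + 1) * δ ^ p,
    (dstarPos_eq hA).symm, ?_, ?_, ?_⟩
  · rw [Finset.sum_mul]
    exact Finset.sum_congr rfl fun p _ => by rw [pow_succ, mul_assoc]
  · refine Supp.sum fun p _ => ?_
    refine Supp.mul (p := fun n => n.1 = 0 ∧ n.2 ≤ 0) (Supp.func (by simp)) (hδs.pow (by simp) ?_ p)
      ?_ <;> (intro a b ha hb; simp only [Prod.fst_add, Prod.snd_add]; omega)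
  · have e : ∑ p ∈ Finset.range k, c (p + 1) * δ ^ (p + 1) =
        ∑ i ∈ Finset.range (k + 1), func (A.coeff (0, -(i : ℤ))) * lam (0, -(i : ℤ)) - c 0 := by
      rw [← hsum, Finset.sum_range_succ', pow_zero, mul_one, add_sub_cancel_right]
    rw [e, sub_right_comm]
    refine Supp.sub ?_ (Supp.func (by simp))
    rintro ⟨a, b⟩ hn
    rw [coeff_sub, coeff_sum] at hn
    simp only [coeff_func_mul, coeff_lam] at hn
    by_cases ha : a = 0
    · subst ha
      refine ⟨rfl, ?_⟩
      by_contra hb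
      simp only [not_le] at hb
      refine hn ?_
      by_cases hbk : -(k : ℤ) ≤ b
      · rw [Finset.sum_eq_single (-b).toNat]
        · rw [Int.toNat_of_nonneg (by omega), neg_neg, if_pos rfl, mul_one, sub_self]
        · intro i _ hi
          rw [if_neg, mul_zero]
          intro h
          rw [Prod.mk.injEq] at h
          omega
        · intro h
          rw [Finset.mem_range] at h
          omega
      · rw [hA.coeff_eq_zero (fun h => hbk h.2), Finset.sum_eq_zero, sub_zero]
        intro i hi
        rw [if_neg, mul_zero]
        rw [Finset.mem_range] at hi
        intro h
        rw [Prod.mk.injEq] at h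
        omega
    · refine absurd ?_ hn
      rw [hA.coeff_eq_zero (fun h => ha h.1), Finset.sum_eq_zero, sub_zero]
      intro i _
      rw [if_neg (fun h => ha (Prod.mk.inj h).1), mul_zero]

end DeltaExpansion

end BOp

/-! ### The two directions and the two factorizations of `H`. -/

/-- Series in `Λ₁⁻¹`. -/
def frame1 : Frame where
  v := (-1, 0)
  w := (0, 1)
  l := -AddMonoidHom.fst ℤ ℤ
  l' := AddMonoidHom.snd ℤ ℤ
  l_v := rfl
  l_w := rfl
  l'_v := rfl
  l'_w := rfl
  decomp n := by ext <;> simp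
  fst_nonpos := by norm_num
  snd_nonneg := le_rfl

/-- Series in `Λ₂`. -/
def frame2 : Frame where
  v := (0, 1)
  w := (1, 0)
  l := AddMonoidHom.snd ℤ ℤ
  l' := AddMonoidHom.fst ℤ ℤ
  l_v := rfl
  l_w := rfl
  l'_v := rfl
  l'_w := rfl
  decomp n := by ext <;> simp
  fst_nonpos := le_rfl
  snd_nonneg := by norm_num

theorem ord_frame1 {k : ℤ} {A : BOp} :
    frame1.Ord k A ↔ Supp (fun n => n.2 = 0 ∧ k ≤ -n.1) A := Iff.rfl

theorem ord_frame2 {k : ℤ} {A : BOp} :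
    frame2.Ord k A ↔ Supp (fun n => n.1 = 0 ∧ k ≤ n.2) A := Iff.rfl

namespace BOp

/-- The operator `X` with `H = -Λ₁ (X - Λ₂)`. -/
def X1 (ρ : Coef) : BOp := 1 - lam (-1, 0) * func ρ

/-- The operator `X` with `H = (1 - Λ₂) (X - Λ₁)`. -/
def X2 (ρ : Coef) : BOp := (1 + dsInv) * func ρ

variable {ρ : Coef}

theorem neg_lam_mul' : -lam (-1, 0) * -lam (1, 0) = 1 := by
  rw [neg_mul_neg]
  exact lam_mul_lam_neg (-1, 0)

theorem one_sub_lam_mul : (1 - lam (0, 1)) * (1 + dsInv) = 1 := by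
  refine ext_coeff fun ⟨a, b⟩ => ?_
  rw [sub_mul, one_mul, coeff_sub, coeff_lam_mul, coeff_add, coeff_add, coeff_dsInv, coeff_dsInv,
    coeff_one, coeff_one]
  simp only [Prod.mk_sub_mk, Prod.mk_eq_zero]
  split_ifs <;> first | omega | simp

theorem mul_one_sub_lam : (1 + dsInv) * (1 - lam (0, 1)) = 1 := by
  have h := one_sub_lam_mul
  rw [sub_mul, one_mul, lam_mul, map_add, map_one, trans_dsInv] at h
  rwa [mul_sub, mul_one]

theorem H_eq₁ (ρ : Coef) : H ρ = -lam (1, 0) * (X1 ρ - lam (0, 1)) := by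
  have h := lam_mul_lam_neg (1, 0)
  rw [H, X1, neg_mul, mul_sub, mul_sub, mul_sub, ← mul_assoc (lam (1, 0)) _ (func ρ),
    show lam (1, 0) * lam (-1, 0) = 1 from h, one_mul]
  abel

theorem H_eq₂ (ρ : Coef) : H ρ = (1 - lam (0, 1)) * (X2 ρ - lam (1, 0)) := by
  rw [H, X2, mul_sub (lam (1, 0)), mul_sub (1 - lam (0, 1)), ← mul_assoc (1 - lam (0, 1)),
    one_sub_lam_mul, one_mul, sub_mul, lam_mul_lam,
    lam_mul_lam, add_comm (1, 0) (0, 1), mul_one, one_mul]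
  abel

theorem ord_X1 : frame1.Ord 0 (X1 ρ) := by
  refine Supp.sub (Supp.one (by simp)) (Supp.mul (p := fun n => n = (-1, 0))
    (q := fun n => n = 0) (Supp.lam rfl) (Supp.func rfl) ?_)
  rintro _ _ rfl rfl
  exact ⟨rfl, by decide⟩

theorem X1_coeff_zero : (X1 ρ).coeff 0 = 1 := by
  rw [X1, coeff_sub, coeff_one, if_pos rfl, coeff_lam_mul, coeff_func, if_neg (by decide),
    shift_zero_coef, sub_zero]

theorem supp_one_add_dsInv : Supp (fun n => n.1 = 0 ∧ 0 ≤ n.2) (1 + dsInv) :=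
  Supp.add (Supp.one (by simp)) (supp_dsInv.mono fun n h => by omega)

theorem ord_X2 : frame2.Ord 0 (X2 ρ) :=
  Supp.mul (q := fun n => n = 0) supp_one_add_dsInv (Supp.func rfl) (by
    rintro a _ ha rfl
    rw [add_zero]
    exact ha)

theorem X2_coeff_zero : (X2 ρ).coeff 0 = ρ := by
  rw [X2, coeff_mul_func, coeff_add, coeff_one, if_pos rfl, coeff_dsInv, if_neg (by simp),
    zero_shift, add_zero, one_mul]

/-- After cancelling the factor `-Λ₁`, the relation holds for `X1 - Λ₂`; the part with `Λ₂` drops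
out since `Λ₂ L = L(m + e₂) Λ₂`. -/
theorem X1_intertwine {L : BOp} (h : H ρ * L = trans (1, 1) L * H ρ) :
    X1 ρ * L = trans (0, 1) L * X1 ρ := by
  have h1 : (X1 ρ - lam (0, 1)) * L = trans (0, 1) L * (X1 ρ - lam (0, 1)) := by
    have h2 := congrArg (-lam (-1, 0) * ·) h
    simp only [H_eq₁] at h2
    rw [← mul_assoc, ← mul_assoc, neg_lam_mul', one_mul, neg_mul, ← mul_assoc, lam_mul, trans_trans,
      mul_assoc, neg_mul, mul_neg, ← mul_assoc (lam (-1, 0)),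
      show lam (-1, 0) * lam (1, 0) = 1 from lam_neg_mul_lam (1, 0), one_mul, mul_neg, neg_neg] at h2
    exact h2
  rw [sub_mul, mul_sub, lam_mul] at h1
  exact sub_left_injective h1

/-- The conjugation by `Δ₂^*` in the hypothesis is absorbed by the factor `1 - Λ₂ = Δ₂^* Λ₂` of `H`.
-/
theorem X2_intertwine {L : BOp}
    (h : H ρ * L = (lam (0, -1) - 1) * trans (1, 1) L * dsInv * H ρ) :
    X2 ρ * L = trans (1, 0) L * X2 ρ := by
  have e1 : 1 - lam (0, 1) = (lam (0, -1) - 1) * lam (0, 1) := by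
    rw [sub_mul, one_mul, show lam (0, -1) * lam (0, 1) = 1 from lam_neg_mul_lam (0, 1)]
  have e2 : dsInv * (1 - lam (0, 1)) = lam (0, 1) := by
    rw [e1, ← mul_assoc, dsInv_mul, one_mul]
  have h1 : (X2 ρ - lam (1, 0)) * L = trans (1, 0) L * (X2 ρ - lam (1, 0)) := by
    have h2 := congrArg ((1 + dsInv) * ·) h
    simp only [H_eq₂] at h2
    rw [mul_assoc (1 - lam (0, 1)), ← mul_assoc (1 + dsInv), mul_one_sub_lam, one_mul,
      mul_assoc _ dsInv, ← mul_assoc dsInv, e2, mul_assoc (lam (0, -1) - 1), ← mul_assoc (trans _ L),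
      show (1, 1) = ((0, 1) : ℤ × ℤ) + (1, 0) from rfl, ← trans_trans, ← lam_mul, mul_assoc,
      ← mul_assoc (lam (0, -1) - 1), ← e1, ← mul_assoc (1 + dsInv), mul_one_sub_lam, one_mul] at h2
    exact h2
  rw [sub_mul, mul_sub, lam_mul] at h1
  exact sub_left_injective h1

theorem H_dressing₁ {S Si : BOp} (hS : S * Si = 1) (hX : X1 ρ * S = trans (0, 1) S) :
    H ρ = -(lam (1, 0) * lam (0, 1) * S * (lam (0, -1) - 1) * Si) := by
  have h1 : lam (0, 1) * S * (lam (0, -1) - 1) * Si = X1 ρ - lam (0, 1) := by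
    rw [mul_sub, mul_one, sub_mul, mul_assoc _ S Si, hS, mul_one, lam_mul, mul_assoc _ _ (lam _),
      show lam (0, 1) * lam (0, -1) = 1 from lam_mul_lam_neg (0, 1), mul_one, ← hX, mul_assoc, hS,
      mul_one]
  rw [H_eq₁, ← h1]
  simp only [mul_assoc, neg_mul]

theorem H_dressing₂ {S Si : BOp} (hS : S * Si = 1) (hX : X2 ρ * S = trans (1, 0) S) :
    H ρ = -(lam (1, 0) * (lam (0, 1) - 1) * S * (lam (-1, 0) - 1) * Si) := by
  have h1 : lam (1, 0) * S * (lam (-1, 0) - 1) * Si = X2 ρ - lam (1, 0) := by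
    rw [mul_sub, mul_one, sub_mul, mul_assoc _ S Si, hS, mul_one, lam_mul, mul_assoc _ _ (lam _),
      show lam (1, 0) * lam (-1, 0) = 1 from lam_mul_lam_neg (1, 0), mul_one, ← hX, mul_assoc, hS,
      mul_one]
  have h2 : lam (1, 0) * (lam (0, 1) - 1) = -(1 - lam (0, 1)) * lam (1, 0) := by
    rw [neg_sub, mul_sub, sub_mul, lam_mul_lam, lam_mul_lam, add_comm, mul_one, one_mul]
  rw [H_eq₂, ← h1, h2]
  simp only [mul_assoc, neg_mul, neg_neg]

theorem lam_one_mul_lam : lam (1, 0) * lam (0, 1) = lam (1, 1) := lam_mul_lam _ _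

theorem H_inv_mul {S Si : BOp} (hS : S * Si = 1) (hS' : Si * S = 1)
    (hX : X1 ρ * S = trans (0, 1) S) : -(S * dsInv * Si * lam (-1, -1)) * H ρ = 1 := by
  rw [H_dressing₁ hS hX, neg_mul_neg, lam_one_mul_lam]
  calc S * dsInv * Si * lam (-1, -1) * (lam (1, 1) * S * (lam (0, -1) - 1) * Si)
      = S * dsInv * Si * (lam (-1, -1) * lam (1, 1)) * S * (lam (0, -1) - 1) * Si := by
        simp only [mul_assoc]
    _ = S * dsInv * (Si * S) * (lam (0, -1) - 1) * Si := by
        rw [show lam (-1, -1) * lam (1, 1) = 1 from lam_neg_mul_lam (1, 1)]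
        simp only [mul_assoc, one_mul]
    _ = S * (dsInv * (lam (0, -1) - 1)) * Si := by rw [hS', mul_one, mul_assoc S]
    _ = 1 := by rw [dsInv_mul, mul_one, hS]

theorem H_mul_inv {S Si : BOp} (hS : S * Si = 1) (hS' : Si * S = 1)
    (hX : X1 ρ * S = trans (0, 1) S) : H ρ * -(S * dsInv * Si * lam (-1, -1)) = 1 := by
  rw [H_dressing₁ hS hX, neg_mul_neg, lam_one_mul_lam]
  calc lam (1, 1) * S * (lam (0, -1) - 1) * Si * (S * dsInv * Si * lam (-1, -1))
      = lam (1, 1) * S * (lam (0, -1) - 1) * (Si * S) * dsInv * Si * lam (-1, -1) := by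
        simp only [mul_assoc]
    _ = lam (1, 1) * S * ((lam (0, -1) - 1) * dsInv) * Si * lam (-1, -1) := by
        rw [hS', mul_one, mul_assoc (lam (1, 1) * S)]
    _ = 1 := by
        rw [mul_dsInv, mul_one, mul_assoc _ S, hS, mul_one]
        exact lam_mul_lam_neg (1, 1)

/-- The inverse of `H` is unique, so any `Hi` equals the one read off from the dressed form of `H`.
This translates the projection formula of `exists_proj2` into wave operators. -/
theorem wave_dsInv {S Si Hi : BOp} (hS : S * Si = 1) (hS' : Si * S = 1)
    (hX : X1 ρ * S = trans (0, 1) S) (hHi : Hi * H ρ = 1) :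
    S * dsInv * Si = -(Hi * lam (1, 1)) := by
  rw [left_inv_eq_right_inv hHi (H_mul_inv hS hS' hX), neg_mul, neg_neg, mul_assoc _ (lam _),
    show lam (-1, -1) * lam (1, 1) = 1 from lam_neg_mul_lam (1, 1), mul_one]

theorem mul_d1Inv : (lam (1, 0) - 1) * d1Inv = 1 := by
  have h := d1Inv_mul
  have e : trans (1, 0) d1Inv = d1Inv := by
    refine ext_coeff fun n => ?_
    rw [coeff_trans, coeff_d1Inv]
    split_ifs <;> rfl
  rw [mul_sub, mul_one] at h
  rw [sub_mul, lam_mul, e, one_mul, h]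

theorem wave_d1Inv {S Si Hi : BOp} (hS : S * Si = 1) (hS' : Si * S = 1)
    (hX : X2 ρ * S = trans (1, 0) S) (hHi : Hi * H ρ = 1) :
    S * d1Inv * Si = -(Hi * func ρ) := by
  have e1 : (lam (-1, 0) - 1) * d1Inv = -lam (-1, 0) := by
    have : lam (-1, 0) - 1 = -(lam (-1, 0) * (lam (1, 0) - 1)) := by
      rw [mul_sub, show lam (-1, 0) * lam (1, 0) = 1 from lam_neg_mul_lam (1, 0), mul_one, neg_sub]
    rw [this, neg_mul, mul_assoc, mul_d1Inv, mul_one]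
  have e2 : lam (1, 0) * S * lam (-1, 0) * Si = X2 ρ := by
    rw [lam_mul, mul_assoc (trans _ S), show lam (1, 0) * lam (-1, 0) = 1 from lam_mul_lam_neg (1, 0),
      mul_one, ← hX, mul_assoc, hS, mul_one]
  have e3 : lam (1, 0) * (lam (0, 1) - 1) = -(1 - lam (0, 1)) * lam (1, 0) := by
    rw [neg_sub, mul_sub, sub_mul, lam_mul_lam, lam_mul_lam, add_comm, mul_one, one_mul]
  have e4 : H ρ * (S * d1Inv * Si) = -func ρ := by
    rw [H_dressing₂ hS hX, e3]
    calc -(-(1 - lam (0, 1)) * lam (1, 0) * S * (lam (-1, 0) - 1) * Si) * (S * d1Inv * Si)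
        = (1 - lam (0, 1)) * (lam (1, 0) * S * (lam (-1, 0) - 1) * (Si * S) * d1Inv * Si) := by
          simp only [mul_assoc, neg_mul, neg_neg]
      _ = (1 - lam (0, 1)) * (lam (1, 0) * S * ((lam (-1, 0) - 1) * d1Inv) * Si) := by
          rw [hS', mul_one, mul_assoc (lam (1, 0) * S)]
      _ = -((1 - lam (0, 1)) * (lam (1, 0) * S * lam (-1, 0) * Si)) := by
          rw [e1, mul_neg, neg_mul, mul_neg]
      _ = -func ρ := by rw [e2, X2, ← mul_assoc, one_sub_lam_mul, one_mul]
  rw [← mul_neg, ← e4, ← mul_assoc, hHi, one_mul]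

/-! ### Flows and curvature modulo `H`. -/

/-- Cancelling `G` from the flow of `H` gives the flow of `X` driven by `B`; replacing `B` by its
projection `Q` costs only a left multiple of `H`. -/
theorem D_X_sub {r : Time} {w : ℤ × ℤ} {G Gi X B Q P C : BOp} (hG : Gi * G = 1)
    (hH : H ρ = G * (X - lam w)) (hDG : D r G = 0) (hB : B = Q + P * H ρ)
    (hDH : D r (H ρ) = C * H ρ - H ρ * B) :
    D r X - (trans w Q * X - X * Q) = (Gi * C - (X - lam w) * P - trans w Q * Gi) * H ρ := by
  have hY : Gi * H ρ = X - lam w := by rw [hH, ← mul_assoc, hG, one_mul]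
  have h1 : D r X = Gi * D r (H ρ) := by
    conv_rhs => rw [hH, D_mul, hDG, zero_mul, zero_add, ← mul_assoc, hG, one_mul, map_sub, D_lam,
      sub_zero]
  have h2 : (Gi * C - (X - lam w) * P - trans w Q * Gi) * H ρ =
      Gi * (C * H ρ) - (X - lam w) * (P * H ρ) - trans w Q * (X - lam w) := by
    rw [sub_mul, sub_mul, mul_assoc, mul_assoc, mul_assoc (trans w Q), hY]
  have h3 : Gi * (C * H ρ - H ρ * B) = Gi * (C * H ρ) - (X - lam w) * (Q + P * H ρ) := by
    rw [mul_sub, ← mul_assoc Gi (H ρ), hY, ← hB]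
  rw [h1, hDH, h2, h3, mul_add, sub_mul _ _ Q, lam_mul, mul_sub (trans w Q)]
  abel

/-- The relation `H B = C H - ∂H` makes the left ideal of `H` stable under `A ↦ ∂_s A + A B_s`, so
the curvature of `B` can be computed with `Q` modulo that ideal. -/
theorem curvature_eq {r s : Time} {B Q P C : Time → BOp} (hB : ∀ r, B r = Q r + P r * H ρ)
    (hDH : ∀ r, D r (H ρ) = C r * H ρ - H ρ * B r) :
    D s (B r) - D r (B s) + (B r * B s - B s * B r) =
      (D s (Q r) - D r (Q s) + (Q r * Q s - Q s * Q r)) +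
      (D s (P r) + P r * C s + Q r * P s - (D r (P s) + P s * C r + Q s * P r)) * H ρ := by
  have h : ∀ r s, D s (B r) + B r * B s =
      D s (Q r) + Q r * Q s + (D s (P r) + P r * C s + Q r * P s) * H ρ := fun r s => by
    have e1 : D s (B r) = D s (Q r) + (D s (P r) * H ρ + P r * (C s * H ρ - H ρ * B s)) := by
      rw [hB r, map_add, D_mul, hDH]
    have e2 : B r * B s = Q r * (Q s + P s * H ρ) + P r * (H ρ * B s) := by
      conv_lhs => rw [hB r, add_mul, mul_assoc]
      conv_lhs => enter [1]; rw [hB s]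
    rw [e1, e2, mul_add, mul_sub, add_mul, add_mul]
    simp only [mul_assoc]
    abel
  have e : D s (B r) - D r (B s) + (B r * B s - B s * B r) =
    (D s (B r) + B r * B s) - (D r (B s) + B s * B r) := by abel
  rw [e, h, h, sub_mul]
  abel

theorem dressing_pow {L S Si : BOp} {j : ℤ × ℤ} (hS : S * Si = 1) (hS' : Si * S = 1)
    (h : L * S = S * lam j) (k : ℕ) : L ^ k = S * lam (k • j) * Si := by
  have h1 : L = S * lam j * Si := by rw [← h, mul_assoc, hS, mul_one]
  induction k with
  | zero => rw [pow_zero, zero_smul, lam_zero, mul_one, hS]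
  | succ k ih =>
    rw [pow_succ, ih]
    conv_lhs => enter [2]; rw [h1]
    rw [succ_nsmul, ← lam_mul_lam]
    calc S * lam (k • j) * Si * (S * lam j * Si)
        = S * lam (k • j) * (Si * S) * lam j * Si := by simp only [mul_assoc]
      _ = _ := by rw [hS', mul_one]; simp only [mul_assoc]

end BOp

theorem neg_frame1_v : -frame1.v = (1, 0) := rfl

theorem neg_frame2_v : -frame2.v = (0, -1) := rfl

/-! ### The Lax system in the bounded ring and its wave operators. -/

/-- The Lax system inside the ring of bounded operators, with the projections characterized by the
decompositions `B_r = Q + P H`. -/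
structure BoundedLax (ρ : Coef) (L₁ L₂ : BOp) (B C : Time → BOp) : Prop where
  isUnit : IsUnit ρ
  ord₁ : frame1.Ord (-1) L₁
  lead₁ : L₁.coeff (1, 0) = 1
  ord₂ : frame2.Ord (-1) L₂
  lead₂ : IsUnit (L₂.coeff (0, -1))
  supp₁ : ∀ k, Supp (fun n => 0 ≤ n.1 ∧ n.2 = 0) (B (0, k))
  sub₁ : ∀ k : ℕ+, frame1.Ord 1 (B (0, k) - L₁ ^ (k : ℕ))
  supp₂ : ∀ k, ∃ B', B (1, k) = B' * (lam (0, -1) - 1) ∧ Supp (fun n => n.1 = 0 ∧ n.2 ≤ 0) B'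
  sub₂ : ∀ k : ℕ+, frame2.Ord 0 (B (1, k) - L₂ ^ (k : ℕ))
  suppC : ∀ r, Supp (fun n => 0 ≤ n.1 ∧ n.2 ≤ 0) (C r)
  flowH : ∀ r, D r (H ρ) = C r * H ρ - H ρ * B r
  intertwine₁ : H ρ * L₁ = trans (1, 1) L₁ * H ρ
  intertwine₂ : H ρ * L₂ = (lam (0, -1) - 1) * trans (1, 1) L₂ * dsInv * H ρ
  flow₁ : ∀ r Q P, Supp (fun n => n.2 = 0) Q → Supp (fun n => n.2 ≤ 0) P → B r = Q + P * H ρ →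
    D r L₁ = Q * L₁ - L₁ * Q
  flow₂ : ∀ r Q P, Supp (fun n => n.1 = 0) Q → Supp (fun n => 0 ≤ n.1) P → B r = Q + P * H ρ →
    D r L₂ = Q * L₂ - L₂ * Q

namespace BoundedLax

variable {ρ : Coef} {L₁ L₂ : BOp} {B C : Time → BOp}

theorem suppB₂ (h : BoundedLax ρ L₁ L₂ B C) (k : ℕ+) :
    Supp (fun n => n.1 = 0 ∧ n.2 ≤ 0) (B (1, k)) := by
  obtain ⟨B', hB, hB'⟩ := h.supp₂ k
  rw [hB]
  refine hB'.mul (q := fun n => n.1 = 0 ∧ n.2 ≤ 0) (Supp.sub (Supp.lam (by simp))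
    (Supp.one (by simp))) fun a b ha hb => ?_
  simp only [Prod.fst_add, Prod.snd_add]
  omega

theorem suppB (h : BoundedLax ρ L₁ L₂ B C) (r : Time) :
    Supp (fun n => 0 ≤ n.1 ∧ n.2 ≤ 0) (B r) := by
  obtain ⟨a, k⟩ := r
  fin_cases a
  · exact (h.supp₁ k).mono fun n hn => ⟨hn.1, hn.2.le⟩
  · exact (h.suppB₂ k).mono fun n hn => ⟨hn.1.ge, hn.2⟩

theorem exists_dressing₁ (h : BoundedLax ρ L₁ L₂ B C) :
    ∃ S Si, frame1.Ord 0 S ∧ frame1.Ord 0 Si ∧ S * Si = 1 ∧ Si * S = 1 ∧ S.coeff 0 = 1 ∧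
      L₁ * S = S * lam (1, 0) ∧ X1 ρ * S = trans (0, 1) S := by
  obtain ⟨S, Si, h1, h2, h3, h4, -, h5, h6, h7⟩ := Frame.exists_dressing h.ord₁
    (by rw [neg_frame1_v, h.lead₁]; exact isUnit_one) ord_X1
    (by rw [X1_coeff_zero]; exact isUnit_one) (X1_intertwine h.intertwine₁)
  exact ⟨S, Si, h1, h2, h3, h4, h5 h.lead₁ X1_coeff_zero, h6, h7⟩

theorem exists_dressing₂ (h : BoundedLax ρ L₁ L₂ B C) :
    ∃ S Si, frame2.Ord 0 S ∧ frame2.Ord 0 Si ∧ S * Si = 1 ∧ Si * S = 1 ∧ IsUnit (S.coeff 0) ∧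
      L₂ * S = S * lam (0, -1) ∧ X2 ρ * S = trans (1, 0) S := by
  obtain ⟨S, Si, h1, h2, h3, h4, h5, -, h6, h7⟩ := Frame.exists_dressing h.ord₂
    h.lead₂ ord_X2 (by rw [X2_coeff_zero]; exact h.isUnit) (X2_intertwine h.intertwine₂)
  exact ⟨S, Si, h1, h2, h3, h4, h5, h6, h7⟩

theorem exists_H_inv (h : BoundedLax ρ L₁ L₂ B C) :
    ∃ Hi, Hi * H ρ = 1 ∧ Supp (fun n => n.1 ≤ -1 ∧ 0 ≤ n.2) Hi := by
  obtain ⟨S, Si, hS, hSi, h1, h2, -, -, hX⟩ := h.exists_dressing₁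
  refine ⟨_, H_inv_mul h1 h2 hX, Supp.neg ?_⟩
  have e1 : Supp (fun n => n.1 ≤ 0 ∧ 1 ≤ n.2) (S * dsInv) :=
    (ord_frame1.1 hS).mul supp_dsInv fun a b ha hb => by
      simp only [Prod.fst_add, Prod.snd_add]; omega
  have e2 : Supp (fun n => n.1 ≤ 0 ∧ 1 ≤ n.2) (S * dsInv * Si) :=
    e1.mul (ord_frame1.1 hSi) fun a b ha hb => by
      simp only [Prod.fst_add, Prod.snd_add]; omega
  refine e2.mul (q := fun n => n = (-1, -1)) (Supp.lam rfl) ?_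
  rintro a _ ha rfl
  simp only [Prod.fst_add, Prod.snd_add]
  omega

/-- The vacuum flow on `S₁`. -/
def vac₁ (r : Time) : BOp := if r.1 = 0 then lam ((r.2 : ℤ), 0) else 0

/-- The vacuum flow on `S₂`. -/
def vac₂ (r : Time) : BOp := if r.1 = 0 then 0 else lam (0, -(r.2 : ℤ))

/-- Both sides are series in `Λ₁⁻¹`, and by `D_X_sub` their difference is a left multiple of `H`;
such an operator is zero. -/
theorem flowX₁ (h : BoundedLax ρ L₁ L₂ B C) {r : Time} {Q P : BOp}
    (hQ : Supp (fun n => n.2 = 0) Q) (hP : Supp (fun n => n.2 ≤ -1) P) (hB : B r = Q + P * H ρ) :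
    D r (X1 ρ) = trans (0, 1) Q * X1 ρ - X1 ρ * Q := by
  have hX : Supp (fun n => n.2 = 0) (X1 ρ) := (ord_frame1.1 ord_X1).mono fun _ h => h.1
  have hadd : ∀ a b : ℤ × ℤ, a.2 = 0 → b.2 = 0 → (a + b).2 = 0 := fun a b ha hb => by
    simp only [Prod.snd_add]; omega
  have hlam : Supp (fun n => n.2 = 0) (-lam (-1, 0)) := Supp.neg (Supp.lam rfl)
  have hle : ∀ a b : ℤ × ℤ, a.2 = 0 → (0 ≤ b.1 ∧ b.2 ≤ 0) → (a + b).2 ≤ 0 := fun a b ha hb => by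
    simp only [Prod.snd_add]; omega
  refine sub_eq_zero.1 (eq_zero_of_eq_mul_H₁ (N := 0)
    ((hX.D r).sub (((hQ.trans _).mul hX hadd).sub (hX.mul hQ hadd))) ?_
    (D_X_sub neg_lam_mul' (H_eq₁ ρ) (by rw [map_neg, D_lam, neg_zero]) hB (h.flowH r)))
  refine ((hlam.mul (h.suppC r) hle).sub ?_).sub ((hQ.trans _).mul hlam fun a b ha hb => (hadd a b ha hb).le)
  refine Supp.mul (p := fun n => n.2 ≤ 1) ((hX.mono fun n hn => ?_).sub (Supp.lam (by simp)))
    hP fun a b ha hb => ?_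
  · simp only [hn]; norm_num
  · simp only [Prod.snd_add]; omega

theorem flowX₂ (h : BoundedLax ρ L₁ L₂ B C) {r : Time} {Q P : BOp}
    (hQ : Supp (fun n => n.1 = 0) Q) (hP : Supp (fun n => 0 ≤ n.1) P) (hB : B r = Q + P * H ρ) :
    D r (X2 ρ) = trans (1, 0) Q * X2 ρ - X2 ρ * Q := by
  have hX : Supp (fun n => n.1 = 0) (X2 ρ) := (ord_frame2.1 ord_X2).mono fun _ h => h.1
  have hadd : ∀ a b : ℤ × ℤ, a.1 = 0 → b.1 = 0 → (a + b).1 = 0 := fun a b ha hb => by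
    simp only [Prod.fst_add]; omega
  have hG : Supp (fun n => n.1 = 0) (1 + dsInv) := supp_one_add_dsInv.mono fun _ h => h.1
  have hle : ∀ a b : ℤ × ℤ, a.1 = 0 → (0 ≤ b.1 ∧ b.2 ≤ 0) → 0 ≤ (a + b).1 := fun a b ha hb => by
    simp only [Prod.fst_add]; omega
  refine sub_eq_zero.1 (eq_zero_of_eq_mul_H₂ (M := 0) h.isUnit
    ((hX.D r).sub (((hQ.trans _).mul hX hadd).sub (hX.mul hQ hadd))) ?_
    (D_X_sub mul_one_sub_lam (H_eq₂ ρ) (by rw [map_sub, D_lam, D_one, sub_zero]) hB (h.flowH r)))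
  refine ((hG.mul (h.suppC r) hle).sub ?_).sub ((hQ.trans _).mul hG fun a b ha hb => (hadd a b ha hb).ge)
  refine Supp.mul (p := fun n => 0 ≤ n.1) ((hX.mono fun n hn => hn.ge).sub (Supp.lam (by simp)))
    hP fun a b ha hb => ?_
  simp only [Prod.fst_add]; omega

theorem exists_decomposition₁ (h : BoundedLax ρ L₁ L₂ B C) {Hi : BOp} (hHi : Hi * H ρ = 1)
    (hHs : Supp (fun n => n.1 ≤ -1 ∧ 0 ≤ n.2) Hi) (r : Time) :
    ∃ Q P, B r = Q + P * H ρ ∧ Supp (fun n => n.2 = 0) Q ∧ Supp (fun n => n.2 ≤ -1) P ∧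
      frame1.Ord 1 (Q - if r.1 = 0 then L₁ ^ (r.2 : ℕ) else 0) ∧
      (r.1 = 0 → Q = B r) ∧
      (r.1 = 1 → Q = restrict (fun n => n.2 = 0) (-(B r * Hi * func ρ * dsInv))) := by
  obtain ⟨a, k⟩ := r
  fin_cases a
  · refine ⟨B (0, k), 0, by simp, (h.supp₁ k).mono fun n hn => hn.2, Supp.zero, ?_, fun _ => rfl,
      fun h => absurd h (by simp)⟩
    simpa using h.sub₁ k
  · obtain ⟨B', hB, hB'⟩ := h.supp₂ k
    obtain ⟨A, P, h1, h2, h3, h4⟩ := exists_proj1 hHi hHs hB hB'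
    refine ⟨A, P, h1, h2.mono fun n hn => hn.1, h3, ?_, fun h => absurd h (by simp), fun _ => h4⟩
    simp only [Fin.mk_one, Fin.isValue, one_ne_zero, if_false, sub_zero]
    refine ord_frame1.2 (h2.mono fun n hn => ⟨hn.1, ?_⟩)
    omega

theorem exists_decomposition₂ (h : BoundedLax ρ L₁ L₂ B C) {Hi : BOp} (hHi : Hi * H ρ = 1)
    (hHs : Supp (fun n => n.1 ≤ -1 ∧ 0 ≤ n.2) Hi) (r : Time) :
    ∃ Q P, B r = Q + P * H ρ ∧ Supp (fun n => n.1 = 0) Q ∧ Supp (fun n => 0 ≤ n.1) P ∧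
      frame2.Ord 0 (Q - if r.1 = 0 then 0 else L₂ ^ (r.2 : ℕ)) ∧
      (r.1 = 1 → Q = B r) ∧
      (r.1 = 0 → Q = restrict (fun n => n.1 = 0) (-(B r * Hi * lam (1, 1))) * (lam (0, -1) - 1)) := by
  obtain ⟨a, k⟩ := r
  fin_cases a
  · obtain ⟨A, P, h1, h2, h3, h4⟩ := exists_proj2 hHi hHs (h.supp₁ k)
    refine ⟨A, P, h1, h2.mono fun n hn => hn.1, h3, ?_, fun h => absurd h (by simp), fun _ => h4⟩
    simp only [Fin.zero_eta, Fin.isValue, if_true, sub_zero]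
    exact ord_frame2.2 h2
  · refine ⟨B (1, k), 0, by simp, (h.suppB₂ k).mono fun n hn => hn.1, Supp.zero, ?_, fun _ => rfl,
      fun h => absurd h (by simp)⟩
    simpa using h.sub₂ k

theorem exists_flow₁ (h : BoundedLax ρ L₁ L₂ B C) {Q P : Time → BOp}
    (hB : ∀ r, B r = Q r + P r * H ρ) (hQ : ∀ r, Supp (fun n => n.2 = 0) (Q r))
    (hP : ∀ r, Supp (fun n => n.2 ≤ -1) (P r))
    (hord : ∀ r : Time, frame1.Ord 1 (Q r - if r.1 = 0 then L₁ ^ (r.2 : ℕ) else 0)) :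
    ∃ S Si, S.coeff 0 = 1 ∧ frame1.Flow 1 L₁ (X1 ρ) S Si Q vac₁ := by
  obtain ⟨S, Si, hS, hSi, h1, h2, h0, hL, hX⟩ := h.exists_dressing₁
  refine ⟨S, Si, h0, hS, hSi, h1, h2, h0 ▸ isUnit_one, hL, hX, fun r => ?_, fun r => ?_, fun r => ?_,
    fun r => ?_, fun r => ?_⟩
  · exact h.flow₁ r _ _ (hQ r) ((hP r).mono fun n hn => by omega) (hB r)
  · exact h.flowX₁ (hQ r) (hP r) (hB r)
  · obtain ⟨a, k⟩ := r
    by_cases ha : a = 0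
    · refine Or.inr ⟨-(k : ℤ), ?_⟩
      rw [vac₁, if_pos ha]
      congr 1
      simp [frame1]
    · exact Or.inl (if_neg ha)
  · have := hord r
    by_cases ha : r.1 = 0
    · rw [if_pos ha, dressing_pow h1 h2 hL] at this
      rw [vac₁, if_pos ha]
      convert this using 5
      simp
    · rw [if_neg ha] at this
      rwa [vac₁, if_neg ha, mul_zero, zero_mul]
  -- The derivative of `S` gains one order because the leading coefficient is the constant `1`; this
  -- is why `ε = 1` is available here, but only `ε = 0` for `S₂`.
  · intro n hn
    have hn' := hS.D r n hn
    refine ⟨hn'.1, ?_⟩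
    by_contra hlt
    have h00 : n = 0 := by
      have e1 : n.2 = 0 := hn'.1
      have e2 : 0 ≤ -n.1 := hn'.2
      have e3 : ¬ 1 ≤ -n.1 := hlt
      exact Prod.ext (by simp only [Prod.fst_zero]; omega) e1
    rw [h00, coeff_D, h0] at hn
    exact hn (dCoef_one r)

theorem exists_flow₂ (h : BoundedLax ρ L₁ L₂ B C) {Q P : Time → BOp}
    (hB : ∀ r, B r = Q r + P r * H ρ) (hQ : ∀ r, Supp (fun n => n.1 = 0) (Q r))
    (hP : ∀ r, Supp (fun n => 0 ≤ n.1) (P r))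
    (hord : ∀ r : Time, frame2.Ord 0 (Q r - if r.1 = 0 then 0 else L₂ ^ (r.2 : ℕ))) :
    ∃ S Si, frame2.Flow 0 L₂ (X2 ρ) S Si Q vac₂ := by
  obtain ⟨S, Si, hS, hSi, h1, h2, h0, hL, hX⟩ := h.exists_dressing₂
  refine ⟨S, Si, hS, hSi, h1, h2, h0, hL, hX, fun r => ?_, fun r => ?_, fun r => ?_,
    fun r => ?_, fun r => hS.D r⟩
  · exact h.flow₂ r _ _ (hQ r) (hP r) (hB r)
  · exact h.flowX₂ (hQ r) (hP r) (hB r)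
  · by_cases ha : r.1 = 0
    · exact Or.inl (if_pos ha)
    · refine Or.inr ⟨-(r.2 : ℤ), ?_⟩
      rw [vac₂, if_neg ha]
      congr 1
      simp [frame2]
  · have := hord r
    by_cases ha : r.1 = 0
    · rw [if_pos ha] at this
      rwa [vac₂, if_pos ha, mul_zero, zero_mul]
    · rw [if_neg ha, dressing_pow h1 h2 hL] at this
      rw [vac₂, if_neg ha]
      convert this using 5
      simp

/-- The two decompositions of each `B_r` give two decompositions of one curvature, with the supports
demanded by `both_projections_eq_zero`. -/
theorem curvature_eq_zero (h : BoundedLax ρ L₁ L₂ B C) {Q₁ P₁ Q₂ P₂ : Time → BOp} {Hi : BOp}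
    (hHi : Hi * H ρ = 1)
    (hB₁ : ∀ r, B r = Q₁ r + P₁ r * H ρ) (hQ₁ : ∀ r, Supp (fun n => n.2 = 0) (Q₁ r))
    (hP₁ : ∀ r, Supp (fun n => n.2 ≤ -1) (P₁ r))
    (hB₂ : ∀ r, B r = Q₂ r + P₂ r * H ρ) (hQ₂ : ∀ r, Supp (fun n => n.1 = 0) (Q₂ r))
    (hP₂ : ∀ r, Supp (fun n => 0 ≤ n.1) (P₂ r)) (r s : Time)
    (h₁ : frame1.Ord 1 (D s (Q₁ r) - D r (Q₁ s) + (Q₁ r * Q₁ s - Q₁ s * Q₁ r)))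
    (h₂ : frame2.Ord 0 (D s (Q₂ r) - D r (Q₂ s) + (Q₂ r * Q₂ s - Q₂ s * Q₂ r))) :
    D s (Q₁ r) - D r (Q₁ s) + (Q₁ r * Q₁ s - Q₁ s * Q₁ r) = 0 ∧
      D s (Q₂ r) - D r (Q₂ s) + (Q₂ r * Q₂ s - Q₂ s * Q₂ r) = 0 := by
  have hBB : ∀ r s, Supp (fun n => 0 ≤ n.1 ∧ n.2 ≤ 0) (B r * B s) := fun r s =>
    (h.suppB r).mul (h.suppB s) fun a b ha hb => by
      simp only [Prod.fst_add, Prod.snd_add]; omega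
  have hrem₁ : ∀ r s, Supp (fun n => n.2 ≤ 0) (D s (P₁ r) + P₁ r * C s + Q₁ r * P₁ s) := fun r s =>
    (((hP₁ r).D s).mono (fun n hn => by omega)).add ((hP₁ r).mul (h.suppC s) fun a b ha hb => by
      simp only [Prod.snd_add]; omega) |>.add ((hQ₁ r).mul (hP₁ s) fun a b ha hb => by
      simp only [Prod.snd_add]; omega)
  have hrem₂ : ∀ r s, Supp (fun n => 0 ≤ n.1) (D s (P₂ r) + P₂ r * C s + Q₂ r * P₂ s) := fun r s =>
    ((hP₂ r).D s).add ((hP₂ r).mul (h.suppC s) fun a b ha hb => by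
      simp only [Prod.fst_add]; omega) |>.add ((hQ₂ r).mul (hP₂ s) fun a b ha hb => by
      simp only [Prod.fst_add]; omega)
  refine both_projections_eq_zero h.isUnit hHi
    ((((h.suppB r).D s).sub ((h.suppB s).D r)).add ((hBB r s).sub (hBB s r)))
    ((ord_frame1.1 h₁).mono fun n hn => ⟨hn.1, by omega⟩) (ord_frame2.1 h₂)
    ((hrem₁ r s).sub (hrem₁ s r)) ((hrem₂ r s).sub (hrem₂ s r))
    (curvature_eq hB₁ h.flowH) (curvature_eq hB₂ h.flowH)

theorem exists_wave (h : BoundedLax ρ L₁ L₂ B C) : ∃ S₁ S₁i S₂ S₂i : BOp,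
    (frame1.Ord 0 S₁ ∧ S₁.coeff 0 = 1) ∧ (frame2.Ord 0 S₂ ∧ IsUnit (S₂.coeff 0)) ∧
    (frame1.Ord 0 S₁i ∧ S₁ * S₁i = 1 ∧ S₁i * S₁ = 1) ∧
    (frame2.Ord 0 S₂i ∧ S₂ * S₂i = 1 ∧ S₂i * S₂ = 1) ∧
    L₁ = S₁ * lam (1, 0) * S₁i ∧ L₂ = S₂ * lam (0, -1) * S₂i ∧
    H ρ = -(lam (1, 0) * lam (0, 1) * S₁ * (lam (0, -1) - 1) * S₁i) ∧
    H ρ = -(lam (1, 0) * (lam (0, 1) - 1) * S₂ * (lam (-1, 0) - 1) * S₂i) ∧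
    (∀ k : ℕ+, D (0, k) S₁ = B (0, k) * S₁ - S₁ * lam ((k : ℤ), 0)) ∧
    (∀ k : ℕ+, D (0, k) S₂ =
      restrict (fun n => n.1 = 0) (B (0, k) * S₁ * dsInv * S₁i) * (lam (0, -1) - 1) * S₂) ∧
    (∀ k : ℕ+, D (1, k) S₁ =
      restrict (fun n => n.2 = 0) (B (1, k) * S₂ * d1Inv * S₂i * dsInv) * S₁) ∧
    ∀ k : ℕ+, D (1, k) S₂ = B (1, k) * S₂ - S₂ * lam (0, -(k : ℤ)) := by
  obtain ⟨Hi, hHi, hHs⟩ := h.exists_H_inv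
  choose Q₁ P₁ hB₁ hQ₁ hP₁ hord₁ hown₁ hoth₁ using h.exists_decomposition₁ hHi hHs
  choose Q₂ P₂ hB₂ hQ₂ hP₂ hord₂ hown₂ hoth₂ using h.exists_decomposition₂ hHi hHs
  obtain ⟨T₁, T₁i, hT₁, hF₁⟩ := h.exists_flow₁ hB₁ hQ₁ hP₁ hord₁
  obtain ⟨T₂, T₂i, hF₂⟩ := h.exists_flow₂ hB₂ hQ₂ hP₂ hord₂
  have hZ := fun r s => h.curvature_eq_zero hHi hB₁ hQ₁ hP₁ hB₂ hQ₂ hP₂ r s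
    (hF₁.ord_curvature zero_le_one r s) (hF₂.ord_curvature le_rfl r s)
  obtain ⟨S₁, S₁i, a1, a2, a3, a4, -, a5, a6, a7, a8⟩ :=
    hF₁.exists_wave zero_le_one fun r s => (hZ r s).1
  obtain ⟨S₂, S₂i, b1, b2, b3, b4, b5, -, b6, b7, b8⟩ :=
    hF₂.exists_wave le_rfl fun r s => (hZ r s).2
  rw [neg_frame1_v] at a6
  rw [neg_frame2_v] at b6
  refine ⟨S₁, S₁i, S₂, S₂i, ⟨a1, a5 le_rfl hT₁⟩, ⟨b1, b5⟩, ⟨a2, a3, a4⟩, ⟨b2, b3, b4⟩, ?_, ?_,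
    H_dressing₁ a3 a7, H_dressing₂ b3 b7, fun k => ?_, fun k => ?_, fun k => ?_, fun k => ?_⟩
  · rw [← a6, mul_assoc, a3, mul_one]
  · rw [← b6, mul_assoc, b3, mul_one]
  · rw [a8, hown₁ (0, k) rfl]
    rfl
  · have e : B (0, k) * S₁ * dsInv * S₁i = -(B (0, k) * Hi * lam (1, 1)) := by
      rw [mul_assoc (B (0, k)) Hi, ← mul_neg, ← wave_dsInv a3 a4 a7 hHi]
      simp only [mul_assoc]
    rw [b8, e, ← hoth₂ (0, k) rfl, vac₂, if_pos rfl, mul_zero, sub_zero]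
  · have e : B (1, k) * S₂ * d1Inv * S₂i * dsInv = -(B (1, k) * Hi * func ρ * dsInv) := by
      rw [mul_assoc (B (1, k)) Hi, ← neg_mul, ← mul_neg, ← wave_d1Inv b3 b4 b7 hHi]
      simp only [mul_assoc]
    rw [a8, e, ← hoth₁ (1, k) rfl, vac₁, if_neg (by simp), mul_zero, sub_zero]
  · rw [b8, hown₂ (1, k) rfl]
    rfl

end BoundedLax

/-! ### Transfer from the Lax system to bounded operators. -/

theorem Frame.Ord.pow {F : Frame} {A : BOp} (hA : F.Ord (-1) A) (k : ℕ) :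
    F.Ord (-(k : ℤ)) (A ^ k) := by
  induction k with
  | zero => simpa using Frame.ord_one
  | succ k ih =>
    rw [pow_succ]
    exact ih.mul hA (by push_cast; omega)

theorem BOp.ord_restrict_sub {A : BOp} (hA : Supp (fun n => n.2 = 0) A) :
    frame1.Ord 1 (restrict (fun n => 0 ≤ n.1) A - A) := by
  rw [← neg_sub]
  refine Supp.neg fun n hn => ⟨(hA.sub (hA.restrict _)) n hn, ?_⟩
  have : ¬ 0 ≤ n.1 := sub_restrict_supp _ _ n hn
  change 1 ≤ -n.1
  omega

theorem exists_boundedLax {L₁ L₂ : Op} {ρ : Coef} (hL₁ : IsLax1 L₁) (hL₂ : IsLax2 L₂)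
    (hρ : IsUnit ρ) (hLax : LaxSystem L₁ L₂ ρ) :
    ∃ l₁ l₂ : BOp, ∃ B C : Time → BOp, l₁.1 = L₁ ∧ l₂.1 = L₂ ∧ BoundedLax ρ l₁ l₂ B C ∧
      ∀ k, (B (0, k)).1 = opB1 L₁ k ∧ (B (1, k)).1 = opB2 L₂ k := by
  obtain ⟨l₁, rfl⟩ : ∃ l₁ : BOp, l₁.1 = L₁ :=
    ⟨⟨L₁, 1, 0, fun n hn => ⟨(hL₁.1 n hn).2, (hL₁.1 n hn).1.ge⟩⟩, rfl⟩
  obtain ⟨l₂, rfl⟩ : ∃ l₂ : BOp, l₂.1 = L₂ :=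
    ⟨⟨L₂, 0, -1, fun n hn => ⟨(hL₂.1 n hn).1.le, (hL₂.1 n hn).2⟩⟩, rfl⟩
  have ho₁ : frame1.Ord (-1) l₁ := fun n hn => ⟨(hL₁.1 n hn).1, by
    have := (hL₁.1 n hn).2
    change -1 ≤ -n.1
    omega⟩
  have ho₂ : frame2.Ord (-1) l₂ := fun n hn => hL₂.1 n hn
  choose b b' hb hb' hbs hbo using fun k : ℕ+ => exists_dstarPos (ord_frame2.1 (ho₂.pow k))
  have hl₁ : ∀ k : ℕ, Supp (fun n => n.2 = 0) (l₁ ^ k) := fun k =>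
    (ord_frame1.1 (ho₁.pow k)).mono fun _ h => h.1
  let B : Time → BOp := fun r =>
    if r.1 = 0 then restrict (fun n => 0 ≤ n.1) (l₁ ^ (r.2 : ℕ)) else b r.2
  let C : Time → BOp := fun r => if r.1 = 0 then trans (1, 1) (B r) else
    (lam (0, -1) - 1) * trans (1, 1) (b r.2) * dsInv
  have hB0 : ∀ k : ℕ+, B (0, k) = restrict (fun n => 0 ≤ n.1) (l₁ ^ (k : ℕ)) := fun k => if_pos rfl
  have hB1 : ∀ k : ℕ+, B (1, k) = b k := fun k => if_neg (by simp)
  have hC0 : ∀ k : ℕ+, C (0, k) = trans (1, 1) (B (0, k)) := fun k => if_pos rfl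
  have hC1 : ∀ k : ℕ+, C (1, k) = (lam (0, -1) - 1) * trans (1, 1) (B (1, k)) * dsInv := fun k => by
    rw [hB1]
    exact if_neg (by simp)
  have e1 : ∀ k, (B (0, k)).1 = opB1 l₁.1 k := fun k => by
    rw [hB0, coe_restrict_nonneg, coe_pow]
    rfl
  have e2 : ∀ k, (B (1, k)).1 = opB2 l₂.1 k := fun k => by
    rw [hB1, hb, coe_pow]
    rfl
  have s0 : ∀ k, Supp (fun n => 0 ≤ n.1 ∧ n.2 = 0) (B (0, k)) := fun k n hn => by
    rw [hB0] at hn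
    exact ⟨restrict_supp _ _ n hn, (hl₁ k).restrict _ n hn⟩
  refine ⟨l₁, l₂, B, C, rfl, rfl, ?_, fun k => ⟨e1 k, e2 k⟩⟩
  constructor
  · exact hρ
  · exact ho₁
  · exact hL₁.2
  · exact ho₂
  · exact hL₂.2
  · exact s0
  · exact fun k => hB0 k ▸ ord_restrict_sub (hl₁ k)
  · exact fun k => ⟨b' k, (hB1 k).trans (hb' k), hbs k⟩
  · exact fun k => hB1 k ▸ hbo k
  · rintro ⟨a, k⟩
    fin_cases a
    · change Supp _ (C (0, k))
      rw [hC0]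
      exact ((s0 k).mono fun n hn => ⟨hn.1, hn.2.le⟩).trans _
    · change Supp _ (C (1, k))
      -- The infinite tail of `Δ₂^{*-1}` cancels against the right factor `Δ₂^*` of `B`, leaving
      -- only nonpositive powers of `Λ₂`.
      rw [hC1, hB1, hb' k, map_mul, map_sub, trans_lam, map_one, ← mul_assoc, mul_assoc _ _ dsInv,
        mul_dsInv, mul_one]
      refine Supp.mul (p := fun n => n.1 = 0 ∧ n.2 ≤ 0) (Supp.sub (Supp.lam (by simp))
        (Supp.one (by simp))) ((hbs k).trans _) fun a b ha hb => ?_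
      simp only [Prod.fst_add, Prod.snd_add]
      omega
  · rintro ⟨a, k⟩
    fin_cases a
    · have := hLax.flowH1 k
      rw [opC1, ← e1] at this
      change D (0, k) (H ρ) = C (0, k) * H ρ - H ρ * B (0, k)
      rw [hC0]
      exact Subtype.ext this
    · have := hLax.flowH2 k
      rw [opC2, ← e2] at this
      change D (1, k) (H ρ) = C (1, k) * H ρ - H ρ * B (1, k)
      rw [hC1]
      exact Subtype.ext this
  · exact Subtype.ext hLax.intertwine1
  · exact Subtype.ext hLax.intertwine2
  · rintro ⟨a, k⟩ Q P hQ hP hBQ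
    fin_cases a
    · have hBQ' : (B (0, k)).1 = (Q + P * H ρ : BOp).1 := congrArg Subtype.val hBQ
      have := hLax.flow11 k
      rw [← e1, proj1_eq hQ.inE1Zero hP.inE1 hBQ'] at this
      exact Subtype.ext this
    · have hBQ' : (B (1, k)).1 = (Q + P * H ρ : BOp).1 := congrArg Subtype.val hBQ
      have := hLax.flow21 k
      rw [← e2, proj1_eq hQ.inE1Zero hP.inE1 hBQ'] at this
      exact Subtype.ext this
  · rintro ⟨a, k⟩ Q P hQ hP hBQ
    fin_cases a
    · have hBQ' : (B (0, k)).1 = (Q + P * H ρ : BOp).1 := congrArg Subtype.val hBQ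
      have := hLax.flow12 k
      rw [← e1, proj2_eq hρ hQ.inE2Zero hP.inE2 hBQ'] at this
      exact Subtype.ext this
    · have hBQ' : (B (1, k)).1 = (Q + P * H ρ : BOp).1 := congrArg Subtype.val hBQ
      have := hLax.flow22 k
      rw [← e2, proj2_eq hρ hQ.inE2Zero hP.inE2 hBQ'] at this
      exact Subtype.ext this

end TwoDKP
end

theorem mainTheorem2 (L₁ L₂ : TwoDKP.Op) (ρ : TwoDKP.Coef)
    (hL₁ : TwoDKP.IsLax1 L₁) (hL₂ : TwoDKP.IsLax2 L₂) (hρ : IsUnit ρ)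
    (hLax : TwoDKP.LaxSystem L₁ L₂ ρ) :
    ∃ S₁ S₁inv S₂ S₂inv : TwoDKP.Op,
      TwoDKP.IsWave1 S₁ ∧ TwoDKP.IsWave2 S₂ ∧
      (TwoDKP.InE1Zero S₁inv ∧ S₁ * S₁inv = 1 ∧ S₁inv * S₁ = 1) ∧
      (TwoDKP.InE2Zero S₂inv ∧ S₂ * S₂inv = 1 ∧ S₂inv * S₂ = 1) ∧
      L₁ = S₁ * TwoDKP.Lam (1, 0) * S₁inv ∧
      L₂ = S₂ * TwoDKP.Lam (0, -1) * S₂inv ∧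
      TwoDKP.opH ρ =
        -(TwoDKP.Lam (1, 0) * TwoDKP.Lam (0, 1) * S₁ * TwoDKP.Delta2Star * S₁inv) ∧
      TwoDKP.opH ρ =
        -(TwoDKP.Lam (1, 0) * TwoDKP.Delta2 * S₂ * TwoDKP.Delta1Star * S₂inv) ∧
      (∀ k : ℕ+, TwoDKP.dt1 k S₁ =
        TwoDKP.opB1 L₁ k * S₁ - S₁ * TwoDKP.Lam ((k : ℤ), 0)) ∧
      (∀ k : ℕ+, TwoDKP.dt1 k S₂ =
        TwoDKP.zeroPart1 (TwoDKP.opB1 L₁ k * S₁ * TwoDKP.Delta2StarInv * S₁inv) *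
          TwoDKP.Delta2Star * S₂) ∧
      (∀ k : ℕ+, TwoDKP.dt2 k S₁ =
        TwoDKP.zeroPart2 (TwoDKP.opB2 L₂ k * S₂ * TwoDKP.Delta1Inv * S₂inv *
          TwoDKP.Delta2StarInv) * S₁) ∧
      (∀ k : ℕ+, TwoDKP.dt2 k S₂ =
        TwoDKP.opB2 L₂ k * S₂ - S₂ * TwoDKP.Lam (0, -(k : ℤ))) := by
  obtain ⟨l₁, l₂, B, C, rfl, rfl, h, hB⟩ := TwoDKP.exists_boundedLax hL₁ hL₂ hρ hLax
  obtain ⟨S₁, S₁i, S₂, S₂i, ⟨a1, a2⟩, ⟨b1, b2⟩, ⟨a3, a4, a5⟩, ⟨b3, b4, b5⟩, c1, c2, c3, c4, d1, d2,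
    d3, d4⟩ := h.exists_wave
  refine ⟨S₁.1, S₁i.1, S₂.1, S₂i.1, ⟨fun n hn => ⟨(a1 n hn).1, ?_⟩, a2⟩, ⟨fun n hn => b1 n hn, b2⟩,
    ⟨TwoDKP.BOp.Supp.inE1Zero fun n hn => (a3 n hn).1, congrArg Subtype.val a4,
      congrArg Subtype.val a5⟩,
    ⟨TwoDKP.BOp.Supp.inE2Zero fun n hn => (b3 n hn).1, congrArg Subtype.val b4,
      congrArg Subtype.val b5⟩,
    congrArg Subtype.val c1, congrArg Subtype.val c2, congrArg Subtype.val c3,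
    congrArg Subtype.val c4, fun k => ?_, fun k => ?_, fun k => ?_, fun k => ?_⟩
  · have : (0 : ℤ) ≤ -n.1 := (a1 n hn).2
    omega
  · rw [← (hB k).1]
    exact congrArg Subtype.val (d1 k)
  · rw [← (hB k).1]
    refine (congrArg Subtype.val (d2 k)).trans ?_
    rw [TwoDKP.BOp.coe_mul, TwoDKP.BOp.coe_mul, TwoDKP.BOp.coe_restrict_zero₁]
    rfl
  · rw [← (hB k).2]
    refine (congrArg Subtype.val (d3 k)).trans ?_
    rw [TwoDKP.BOp.coe_mul, TwoDKP.BOp.coe_restrict_zero₂]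
    rfl
  · rw [← (hB k).2]
    exact congrArg Subtype.val (d4 k)
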